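/- **Setting.** Let $\mathbf{M}_1,\mathbf{M}_2$ be two linear matroids on the same $n$-element set $V=\{0,\dots,n-1\}$, represented over a common field $\mathbb{F}$ by the columns of an $r\times n$ matrix $Q_1$ and by the rows of an $n\times r$ matrix $Q_2$, where $1\le r\le n$. An *intersection* is a set independent in both matroids; the problem is to find an intersection of maximum cardinality. Let $\mathbb{K}$ be an extension field of $\mathbb{F}$ (possibly $\mathbb{K}=\mathbb{F}$), and let $z_i\in\mathbb{K}\setminus\{0\}$ for $i\in V$. Put $X=\operatorname{diag}(z_i)$. For $J\subseteq V$ with complement $\bar J$ write $Q_1^J$ for the columns $J$ of $Q_1$, $Q_2^J$ for the rows $J$ of $Q_2$, $X(J)$ for the restriction of $X$ to $\bar J$, and $$Z(J)=\begin{pmatrix} & Q_1^J & Q_1^{\bar J}\\ Q_2^J & & \\ Q_2^{\bar J} & & X(J)\end{pmatrix},\qquad Y(J)=\begin{pmatrix} -Q_1^{\bar J}X(J)^{-1}Q_2^{\bar J} & Q_1^J\\ Q_2^J & \end{pmatrix},\qquad Y=Y(\emptyset).$$ When $Y(J)$ is nonsingular, $\mathcal{Y}(J)$ denotes the leading block of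 $Y(J)^{-1}$, indexed by the columns of $Q_2$ and the rows of $Q_1$. **The algorithm.** Given $Q_1,Q_2,z$, restrict $Q_1$ to rows and $Q_2$ to columns such that the corresponding submatrix of $Y$ is nonsingular of size $k=\operatorname{rank} Y$; from now on $Q_1,Q_2,Y,Z(J),\mathcal{Y}(J)$ refer to the restricted matrices. Start with $J=\emptyset$, $W=Y^{-1}$. Scan $V$ in order, in blocks of $r$ consecutive elements. At the beginning of a block, let $D$ be the corresponding diagonal block of $X^{-1}+X^{-1}Q_2WQ_1X^{-1}$. For each $i$ in the block, if $D_{i,i}\ne z_i^{-1}$, then with $u=(Q_1)_{*,i}$ and $v^{\mathsf T}=(Q_2)_{i,*}$ replace $$J\leftarrow J\cup\{i\},\qquad W\leftarrow W-(v^{\mathsf T}Wu)^{-1}(Wu)(v^{\mathsf T}W),\qquad D\leftarrow D-(D_{i,i}-z_i^{-1})^{-1}D_{*,i}D_{i,*}.$$ Output the final $J$. **Machine model.** A program is a fixed finite program, not depending on the field, of a unit-cost arithmetic random access machine: it has integer arrays (addition, truncated subtraction, comparison) and two-dimensional arrays of field elements (field operations in $\mathbb{K}$, equality tests); each read, operation,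 test and assignment costs one step. Initial contents of memory other than the input are arbitrary. The randomness is an additional input vector $z\in\mathbb{K}^n$. A program *multiplies matrices over $\mathbb{K}$ in $C m^{\omega}$ steps* if for all $m\ge1$ it multiplies any two $m\times m$ matrices over $\mathbb{K}$ in at most $Cm^\omega$ steps. A program *solves linear matroid intersection in $T$ steps with error constant $e$* (for given $n,r,\mathbb{F},\mathbb{K}$) if for all inputs $(Q_1,Q_2)$ over $\mathbb{F}$ as above: for every $z$ with nonzero entries it halts within $T$ steps with an output of the algorithm above (for some choice of the nonsingular submatrix of $Y$); and for every finite nonempty $S\subseteq\mathbb{K}\setminus\{0\}$, if the $z_i$ are independent and uniform in $S$, then the program halts within $T$ steps with a maximum-cardinality intersection of $\mathbf{M}_1,\mathbf{M}_2$, except with probability at most $e\,n^2/|S|$. **Theorem.** 1. *($\mathcal{Y}(J)$ and the diagonal blocks are maintained.)* Let $z$ have nonzero entries, let the block size $r$ be at least $1$, and let $Q_1$ ($k\times n$) and $Q_2$ ($n\times k$) be such that $Y$ is nonsingular. Then after each step of the scan, $Z(J)$ and $Y(J)$ are nonsingular and $W=\mathcal{Y}(J)$; immediately after element $i$ is processed,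 $D$ equals the diagonal block of $Z(J)^{-1}$ indexed by the block containing $i$; and $i$ is added to the current $J$ if and only if $Z(J\cup\{i\})$ is nonsingular. 2. Let $\omega\ge2$ and $C$ be real numbers and let a program for matrix multiplication be given. There are a program $P$ and constants $c,e$ such that for all fields $\mathbb{F}\subseteq\mathbb{K}$ such that the given program multiplies matrices over $\mathbb{K}$ in $Cm^\omega$ steps, and all $1\le r\le n$, the program $P$ solves linear matroid intersection in $$c\,(n r^{\omega-1}+r^3)$$ steps with error constant $e$. Moreover, for every $a>0$ there is a constant $c'$ such that for all such fields and all $1\le r\le n$ with $n\ge a\,r^{4-\omega}$, the same $P$ does so in $c'\,n r^{\omega-1}$ steps with error constant $e$. 3. Without fast matrix multiplication: there are a program $P$ and constants $c,e$ such that for all fields $\mathbb{F}\subseteq\mathbb{K}$ and all $1\le r\le n$, the program $P$ solves linear matroid intersection in $c\,n r^2$ steps with error constant $e$. (In particular, taking $\mathbb{K}=\mathbb{F}$, only operations of $\mathbb{F}$ are used if $\mathbb{F}$ is large enough for the error bound to be small.) -/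

import Mathlib

/-! ### The machine: a unit-cost arithmetic random access machine over a field

The memory consists of named integer arrays and named two-dimensional arrays of field elements.
Integers are used for addressing and control and can only be added, subtracted and compared.
Every read, every integer or field operation, every comparison and every assignment costs one step.
Programs are finite pieces of syntax that do not mention the field. -/

namespace MatInt

/-- Memory contents: `nat a i` is entry `i` of integer array `a`, and `fld a i j` is entry `(i, j)`
of field array `a`. -/
structure State (K : Type*) where
  nat : ℕ → ℕ → ℕ
  fld : ℕ → ℕ → ℕ → K

/-- Integer expressions (`sub` is truncated subtraction). -/
inductive NExpr where
  | const (c : ℕ) : NExpr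
  | get (a : ℕ) (i : NExpr) : NExpr
  | add (x y : NExpr) : NExpr
  | sub (x y : NExpr) : NExpr

/-- Field expressions. -/
inductive FExpr where
  | zero : FExpr
  | one : FExpr
  | get (a : ℕ) (i j : NExpr) : FExpr
  | add (x y : FExpr) : FExpr
  | sub (x y : FExpr) : FExpr
  | mul (x y : FExpr) : FExpr
  | div (x y : FExpr) : FExpr

/-- Tests. -/
inductive Test where
  | natLt (x y : NExpr) : Test
  | natEq (x y : NExpr) : Test
  | fldEq (x y : FExpr) : Test
  | not (b : Test) : Test

/-- Programs. -/
inductive Prog where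
  | skip : Prog
  | setNat (a : ℕ) (i x : NExpr) : Prog
  | setFld (a : ℕ) (i j : NExpr) (x : FExpr) : Prog
  | seq (p q : Prog) : Prog
  | ite (b : Test) (p q : Prog) : Prog
  | while (b : Test) (p : Prog) : Prog

/-- Number of steps needed to evaluate an integer expression. -/
def NExpr.cost : NExpr → ℕ
  | .const _ => 1
  | .get _ i => i.cost + 1
  | .add x y => x.cost + y.cost + 1
  | .sub x y => x.cost + y.cost + 1

/-- Number of steps needed to evaluate a field expression. -/
def FExpr.cost : FExpr → ℕ
  | .zero => 1
  | .one => 1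
  | .get _ i j => i.cost + j.cost + 1
  | .add x y => x.cost + y.cost + 1
  | .sub x y => x.cost + y.cost + 1
  | .mul x y => x.cost + y.cost + 1
  | .div x y => x.cost + y.cost + 1

/-- Number of steps needed to evaluate a test. -/
def Test.cost : Test → ℕ
  | .natLt x y => x.cost + y.cost + 1
  | .natEq x y => x.cost + y.cost + 1
  | .fldEq x y => x.cost + y.cost + 1
  | .not b => b.cost + 1

section Semantics

variable {K : Type*} [Field K]

/-- Value of an integer expression. -/
def NExpr.eval (s : State K) : NExpr → ℕ
  | .const c => c
  | .get a i => s.nat a (i.eval s)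
  | .add x y => x.eval s + y.eval s
  | .sub x y => x.eval s - y.eval s

/-- Value of a field expression (division by zero returns zero). -/
def FExpr.eval (s : State K) : FExpr → K
  | .zero => 0
  | .one => 1
  | .get a i j => s.fld a (i.eval s) (j.eval s)
  | .add x y => x.eval s + y.eval s
  | .sub x y => x.eval s - y.eval s
  | .mul x y => x.eval s * y.eval s
  | .div x y => x.eval s / y.eval s

/-- Truth of a test. -/
def Test.Holds (s : State K) : Test → Prop
  | .natLt x y => x.eval s < y.eval s
  | .natEq x y => x.eval s = y.eval s
  | .fldEq x y => x.eval s = y.eval s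
  | .not b => ¬ b.Holds s

/-- Overwrite one entry of an integer array. -/
def State.putNat (s : State K) (a i v : ℕ) : State K where
  nat := fun a' i' => if a' = a ∧ i' = i then v else s.nat a' i'
  fld := s.fld

/-- Overwrite one entry of a field array. -/
def State.putFld (s : State K) (a i j : ℕ) (v : K) : State K where
  nat := s.nat
  fld := fun a' i' j' => if a' = a ∧ i' = i ∧ j' = j then v else s.fld a' i' j'

/-- `Runs p s t s'`: started in memory `s`, the program `p` halts after exactly `t` steps with
memory `s'`. -/
inductive Runs : Prog → State K → ℕ → State K → Prop where
  | skip (s : State K) : Runs .skip s 1 s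
  | setNat (s : State K) (a : ℕ) (i x : NExpr) :
      Runs (.setNat a i x) s (i.cost + x.cost + 1) (s.putNat a (i.eval s) (x.eval s))
  | setFld (s : State K) (a : ℕ) (i j : NExpr) (x : FExpr) :
      Runs (.setFld a i j x) s (i.cost + j.cost + x.cost + 1)
        (s.putFld a (i.eval s) (j.eval s) (x.eval s))
  | seq {p q : Prog} {s s₁ s₂ : State K} {t₁ t₂ : ℕ} (hp : Runs p s t₁ s₁) (hq : Runs q s₁ t₂ s₂) :
      Runs (.seq p q) s (t₁ + t₂) s₂
  | iteTrue {b : Test} {p q : Prog} {s s₁ : State K} {t : ℕ} (hb : b.Holds s) (hp : Runs p s t s₁) :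
      Runs (.ite b p q) s (b.cost + 1 + t) s₁
  | iteFalse {b : Test} {p q : Prog} {s s₁ : State K} {t : ℕ} (hb : ¬ b.Holds s)
      (hq : Runs q s t s₁) : Runs (.ite b p q) s (b.cost + 1 + t) s₁
  | whileTrue {b : Test} {p : Prog} {s s₁ s₂ : State K} {t₁ t₂ : ℕ} (hb : b.Holds s)
      (hp : Runs p s t₁ s₁) (hw : Runs (.while b p) s₁ t₂ s₂) :
      Runs (.while b p) s (b.cost + 1 + t₁ + t₂) s₂
  | whileFalse {b : Test} {p : Prog} {s : State K} (hb : ¬ b.Holds s) :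
      Runs (.while b p) s (b.cost + 1) s

/-- Started in memory `s`, the program `p` halts within `T` steps, and then `post` holds. -/
def HaltsWithin (p : Prog) (s : State K) (T : ℝ) (post : State K → Prop) : Prop :=
  ∃ (t : ℕ) (s' : State K), Runs p s t s' ∧ (t : ℝ) ≤ T ∧ post s'

/-- The program `p` multiplies any two `m × m` matrices over `K` within `C * m ^ ω` steps: it reads
`m` from entry `0` of integer array `0` and the factors from the field arrays `0` and `1`, and
leaves the product in field array `2`; the rest of the memory is arbitrary. -/
def MultipliesMatrices (p : Prog) (K : Type*) [Field K] (ω C : ℝ) : Prop :=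
  ∀ m : ℕ, 1 ≤ m → ∀ A B : Matrix (Fin m) (Fin m) K, ∀ s : State K,
    s.nat 0 0 = m → (∀ i j : Fin m, s.fld 0 i j = A i j) → (∀ i j : Fin m, s.fld 1 i j = B i j) →
    HaltsWithin p s (C * (m : ℝ) ^ ω) (fun s' => ∀ i j : Fin m, s'.fld 2 i j = (A * B) i j)

end Semantics

/-! ### Linear matroids and their intersections -/

/-- The columns of `Q` represent the matroid `M`. -/
def ColsRepresent {F : Type*} [Field F] {n r : ℕ} (Q : Matrix (Fin r) (Fin n) F)
    (M : Matroid (Fin n)) : Prop :=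
  M.E = Set.univ ∧ ∀ I : Set (Fin n), M.Indep I ↔ LinearIndepOn F Q.col I

/-- The rows of `Q` represent the matroid `M`. -/
def RowsRepresent {F : Type*} [Field F] {n r : ℕ} (Q : Matrix (Fin n) (Fin r) F)
    (M : Matroid (Fin n)) : Prop :=
  M.E = Set.univ ∧ ∀ I : Set (Fin n), M.Indep I ↔ LinearIndepOn F Q.row I

/-- `J` is an intersection (common independent set) of two matroids. -/
def IsIntersection {n : ℕ} (M₁ M₂ : Matroid (Fin n)) (J : Finset (Fin n)) : Prop :=
  M₁.Indep (J : Set (Fin n)) ∧ M₂.Indep (J : Set (Fin n))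

/-- `J` is an intersection of maximum cardinality. -/
def IsMaxIntersection {n : ℕ} (M₁ M₂ : Matroid (Fin n)) (J : Finset (Fin n)) : Prop :=
  IsIntersection M₁ M₂ J ∧ ∀ J' : Finset (Fin n), IsIntersection M₁ M₂ J' → J'.card ≤ J.card

/-! ### The matrices `Z(J)`, `Y(J)`, `𝒴(J)` -/

noncomputable section Matrices

variable {K : Type*} [Field K] {n r k : ℕ}

/-- `Y = - Q₁ X⁻¹ Q₂` where `X` is the diagonal matrix with diagonal `z`. -/
def Y₀ (Q₁ : Matrix (Fin r) (Fin n) K) (Q₂ : Matrix (Fin n) (Fin r) K) (z : Fin n → K) :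
    Matrix (Fin r) (Fin r) K :=
  -(Q₁ * Matrix.diagonal (fun i => (z i)⁻¹) * Q₂)

/-- `Z(J)`: the block matrix with blocks `0`, `Q₁`, `Q₂` and the diagonal matrix of the `z i`,
where `z i` is replaced by zero for `i ∈ J`. -/
def Z (Q₁ : Matrix (Fin k) (Fin n) K) (Q₂ : Matrix (Fin n) (Fin k) K) (z : Fin n → K)
    (J : Finset (Fin n)) : Matrix (Fin k ⊕ Fin n) (Fin k ⊕ Fin n) K :=
  Matrix.fromBlocks 0 Q₁ Q₂ (Matrix.diagonal (fun i => if i ∈ J then 0 else z i))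

/-- `Y(J)`: the Schur complement in `Z(J)` of the diagonal block indexed by the complement
of `J`. -/
def Y (Q₁ : Matrix (Fin k) (Fin n) K) (Q₂ : Matrix (Fin n) (Fin k) K) (z : Fin n → K)
    (J : Finset (Fin n)) :
    Matrix (Fin k ⊕ {i : Fin n // i ∈ J}) (Fin k ⊕ {i : Fin n // i ∈ J}) K :=
  Matrix.fromBlocks
    (-(Q₁.submatrix id (Subtype.val : {i : Fin n // i ∉ J} → Fin n) *
        Matrix.diagonal (fun i : {i : Fin n // i ∉ J} => (z i)⁻¹) *
        Q₂.submatrix (Subtype.val : {i : Fin n // i ∉ J} → Fin n) id))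
    (Q₁.submatrix id Subtype.val) (Q₂.submatrix Subtype.val id) 0

/-- `𝒴(J)`: the leading block of `Y(J)⁻¹`, indexed by the rows of `Q₁` and columns of `Q₂`. -/
def calY (Q₁ : Matrix (Fin k) (Fin n) K) (Q₂ : Matrix (Fin n) (Fin k) K) (z : Fin n → K)
    (J : Finset (Fin n)) : Matrix (Fin k) (Fin k) K :=
  ((Y Q₁ Q₂ z J)⁻¹).toBlocks₁₁

/-! ### The algorithm, as a mathematical procedure

The elements are scanned in the order `0, 1, …, n - 1`, in blocks of `r` consecutive elements. -/

/-- The data maintained by the algorithm: the current intersection, the current `k × k` matrix,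
and the current diagonal block (stored as an `n × n` matrix that vanishes outside the block). -/
structure AlgState (K : Type*) (n k : ℕ) where
  J : Finset (Fin n)
  W : Matrix (Fin k) (Fin k) K
  D : Matrix (Fin n) (Fin n) K

/-- The diagonal block number `b`, with rows and columns `i` such that `i / r = b`, of
`X⁻¹ + X⁻¹ Q₂ W Q₁ X⁻¹`. -/
def diagBlock (r : ℕ) (Q₁ : Matrix (Fin k) (Fin n) K) (Q₂ : Matrix (Fin n) (Fin k) K)
    (z : Fin n → K) (W : Matrix (Fin k) (Fin k) K) (b : ℕ) : Matrix (Fin n) (Fin n) K :=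
  Matrix.of fun p q =>
    if (p : ℕ) / r = b ∧ (q : ℕ) / r = b then
      (Matrix.diagonal (fun i => (z i)⁻¹) +
        Matrix.diagonal (fun i => (z i)⁻¹) * Q₂ * W * Q₁ * Matrix.diagonal (fun i => (z i)⁻¹)) p q
    else 0

open Classical in
/-- Processing of element `i`. If `i` is the first element of its block, the diagonal block is
computed from `W`. If then the diagonal entry of `i` differs from `(z i)⁻¹`, the element `i` is
added to `J`, and `W` and the block undergo rank-1 updates. -/
def algStep (r : ℕ) (Q₁ : Matrix (Fin k) (Fin n) K) (Q₂ : Matrix (Fin n) (Fin k) K)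
    (z : Fin n → K) (i : Fin n) (s : AlgState K n k) : AlgState K n k :=
  let D := if (i : ℕ) % r = 0 then diagBlock r Q₁ Q₂ z s.W ((i : ℕ) / r) else s.D
  let u : Fin k → K := Q₁.col i
  let v : Fin k → K := Q₂.row i
  if D i i ≠ (z i)⁻¹ then
    { J := insert i s.J
      W := s.W - (v ⬝ᵥ s.W.mulVec u)⁻¹ • Matrix.vecMulVec (s.W.mulVec u) (Matrix.vecMul v s.W)
      D := D - (D i i - (z i)⁻¹)⁻¹ • Matrix.vecMulVec (D.col i) (D.row i) }
  else
    { J := s.J, W := s.W, D := D }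

/-- State of the algorithm after the elements `0, …, t - 1` have been processed. -/
def algState (r : ℕ) (Q₁ : Matrix (Fin k) (Fin n) K) (Q₂ : Matrix (Fin n) (Fin k) K)
    (z : Fin n → K) : ℕ → AlgState K n k
  | 0 => { J := ∅, W := (Y₀ Q₁ Q₂ z)⁻¹, D := 0 }
  | t + 1 =>
      if h : t < n then algStep r Q₁ Q₂ z ⟨t, h⟩ (algState r Q₁ Q₂ z t)
      else algState r Q₁ Q₂ z t

/-- `J` is an output of the algorithm on `Q₁`, `Q₂` with values `z`: for some nonsingular submatrix
of `Y` of maximum size, with rows `a` and columns `b`, the scan of all `n` elements with the rows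
`a` of `Q₁` and the columns `b` of `Q₂` ends with `J`. -/
def IsAlgOutput (Q₁ : Matrix (Fin r) (Fin n) K) (Q₂ : Matrix (Fin n) (Fin r) K) (z : Fin n → K)
    (J : Finset (Fin n)) : Prop :=
  ∃ a b : Fin (Y₀ Q₁ Q₂ z).rank → Fin r,
    ((Y₀ Q₁ Q₂ z).submatrix a b).det ≠ 0 ∧
    J = (algState r (Q₁.submatrix a id) (Q₂.submatrix id b) z n).J

/-! ### Solving matroid intersection on the machine -/

/-- The memory holds `n`, `r` in integer array `0`, and `Q₁`, `Q₂` and the vector `z` in the field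
arrays `0`, `1`, `2`; the rest of the memory is arbitrary. -/
def HoldsInput (Q₁ : Matrix (Fin r) (Fin n) K) (Q₂ : Matrix (Fin n) (Fin r) K) (z : Fin n → K)
    (s : State K) : Prop :=
  s.nat 0 0 = n ∧ s.nat 0 1 = r ∧ (∀ (i : Fin r) (j : Fin n), s.fld 0 i j = Q₁ i j) ∧
    (∀ (i : Fin n) (j : Fin r), s.fld 1 i j = Q₂ i j) ∧ ∀ i : Fin n, s.fld 2 0 i = z i

/-- The set of elements marked in integer array `1`. -/
def outputSet (n : ℕ) (s : State K) : Finset (Fin n) :=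
  Finset.univ.filter fun i => s.nat 1 i ≠ 0

open Classical in
/-- The fraction of the vectors `z` with entries in `S` for which `bad z` holds: the probability of
`bad z` when the entries of `z` are drawn independently and uniformly from `S`. -/
def probability (S : Finset K) (bad : (Fin n → K) → Prop) : ℝ :=
  (((Fintype.piFinset fun _ : Fin n => S).filter bad).card : ℝ) / (S.card : ℝ) ^ n

/-- On matroids with `n` elements represented by matrices with `r` rows (columns) over `F`, the
program `p`, computing in the extension field `K` with random field elements `z`, always halts
within `T` steps and returns an output of the algorithm. If the entries of `z` are drawn from a
finite set `S` of nonzero elements, then it returns a maximum intersection, except with probability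
at most `e * n ^ 2 / |S|`. -/
def SolvesMatroidIntersection (p : Prog) (F K : Type*) [Field F] [Field K] [Algebra F K]
    (n r : ℕ) (T e : ℝ) : Prop :=
  ∀ (Q₁ : Matrix (Fin r) (Fin n) F) (Q₂ : Matrix (Fin n) (Fin r) F) (M₁ M₂ : Matroid (Fin n)),
    ColsRepresent Q₁ M₁ → RowsRepresent Q₂ M₂ →
    (∀ z : Fin n → K, (∀ i, z i ≠ 0) → ∀ s : State K,
      HoldsInput (Q₁.map (algebraMap F K)) (Q₂.map (algebraMap F K)) z s →
      HaltsWithin p s T (fun s' =>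
        IsAlgOutput (Q₁.map (algebraMap F K)) (Q₂.map (algebraMap F K)) z (outputSet n s'))) ∧
    (∀ S : Finset K, S.Nonempty → 0 ∉ S →
      probability S (fun z : Fin n → K => ¬ ∀ s : State K,
        HoldsInput (Q₁.map (algebraMap F K)) (Q₂.map (algebraMap F K)) z s →
        HaltsWithin p s T (fun s' => IsMaxIntersection M₁ M₂ (outputSet n s'))) ≤
      e * (n : ℝ) ^ 2 / (S.card : ℝ))

end Matrices

end MatInt

/-! Correctness of the scan. Adding `i` to `J` replaces the diagonal entry `z i` of `Z(J)` by zero,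
a rank-one change. By Sherman–Morrison the new matrix is nonsingular exactly when the diagonal entry
of `Z(J)⁻¹` at `i` differs from `(z i)⁻¹`, and then every block of the inverse undergoes a rank-one
update (`Z_insert_inv`, `det_Z_insert_eq_zero`). Outside `J` the inverse is determined by its
leading block (`Z_inv_inr_inr`), which block elimination identifies with `𝒴(J)` (`Y_mul_Z_inv`). So
the scan is the greedy algorithm for the test `det Z(J) ≠ 0`, and nonsingularity of `Z(J)` forces
`J` to be independent in both matroids.

Optimality. The pivot choices and the scan both ask whether some `det Z(J)` of restricted matrices
vanishes, a polynomial of degree at most `n` in `z`. With variables in place of `z` the run is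
optimal: the rank of `Y` is at least the size of every common independent set (`card_le_genSel_m`),
and multilinear expansion of the determinant shows that the scan reaches the size of the selected
submatrix (`exists_base_of_zPoly_ne_zero`, `card_scanSet_zPoly`). No min-max theorem is needed. A
run with actual values agrees with the generic run as soon as the `r + n` polynomials of the generic
run's own intermediate results do not vanish at `z`; Schwartz–Zippel and a union bound give failure
probability at most `(r + n) * n / |S|`.

Running time. `Y` is a sum of about `n / r` products of `r × r` matrices. Pivoting in the array with
quadrants `Y`, `1`, `1`, `0` selects a maximal nonsingular submatrix and leaves minus its inverse in
the last quadrant, in `O(r³)` steps. For a block with columns `U` and rows `V`, three products give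
the quadrants `X`, `XU`, `VX`, `VXU`; the test for an element is whether a diagonal entry of `VXU`
vanishes, and one pivot there updates all quadrants. A rejected element costs `O(1)`, an accepted
one `O(r²)`, and at most `r` are accepted in the whole scan. Together this is `O(n / r)` products
and `O(nr + r³)` further steps (`exec_intersection`). -/

namespace MatInt

open scoped Matrix

/-! ### The inverse of `Z(J)`: its blocks and its rank-one update -/

section Inverse

variable {K : Type*} [Field K] {n k : ℕ} {Q₁ : Matrix (Fin k) (Fin n) K}
  {Q₂ : Matrix (Fin n) (Fin k) K} {z : Fin n → K} {J : Finset (Fin n)}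

theorem Z_mul_inl {m : Type*} (A : Matrix (Fin k ⊕ Fin n) m K) (s : Fin k) (c : m) :
    (Z Q₁ Q₂ z J * A) (Sum.inl s) c = ∑ p, Q₁ s p * A (Sum.inr p) c := by
  simp [Z, Matrix.mul_apply, Fintype.sum_sum_type]

theorem Z_mul_inr {m : Type*} (A : Matrix (Fin k ⊕ Fin n) m K) (p : Fin n) (c : m) :
    (Z Q₁ Q₂ z J * A) (Sum.inr p) c =
      ∑ s, Q₂ p s * A (Sum.inl s) c + (if p ∈ J then 0 else z p) * A (Sum.inr p) c := by
  simp [Z, Matrix.mul_apply, Fintype.sum_sum_type, Matrix.diagonal_apply]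

theorem mul_Z_inr {m : Type*} (A : Matrix m (Fin k ⊕ Fin n) K) (q : Fin n) (c : m) :
    (A * Z Q₁ Q₂ z J) c (Sum.inr q) =
      ∑ s, A c (Sum.inl s) * Q₁ s q + A c (Sum.inr q) * (if q ∈ J then 0 else z q) := by
  simp [Z, Matrix.mul_apply, Fintype.sum_sum_type, Matrix.diagonal_apply]

/-- For `q` outside `J` the diagonal entry in column `q` of `Z(J)` is the invertible `z q`, so
column `q` of the equation `Z(J)⁻¹ Z(J) = 1` can be solved for the entries of the inverse in that
column. -/
theorem Z_inv_inl_inr (hdet : (Z Q₁ Q₂ z J).det ≠ 0) (hz : ∀ i, z i ≠ 0) {q : Fin n} (hq : q ∉ J)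
    (c : Fin k ⊕ Fin n) (hc : c ≠ Sum.inr q) :
    (Z Q₁ Q₂ z J)⁻¹ c (Sum.inr q) = -(z q)⁻¹ * ∑ s, (Z Q₁ Q₂ z J)⁻¹ c (Sum.inl s) * Q₁ s q := by
  have h : ((Z Q₁ Q₂ z J)⁻¹ * Z Q₁ Q₂ z J) c (Sum.inr q) = 0 := by
    rw [Matrix.nonsing_inv_mul _ (isUnit_iff_ne_zero.mpr hdet), Matrix.one_apply_ne hc]
  rw [mul_Z_inr, if_neg hq] at h
  have := hz q
  field_simp
  linear_combination h

/-- The mirror image, from row `p` of `Z(J) Z(J)⁻¹ = 1`. The entry of the identity is kept because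
`c` may be `p` itself. -/
theorem Z_inv_inr_left (hdet : (Z Q₁ Q₂ z J).det ≠ 0) (hz : ∀ i, z i ≠ 0) {p : Fin n} (hp : p ∉ J)
    (c : Fin k ⊕ Fin n) :
    (Z Q₁ Q₂ z J)⁻¹ (Sum.inr p) c = (z p)⁻¹ *
      ((1 : Matrix (Fin k ⊕ Fin n) (Fin k ⊕ Fin n) K) (Sum.inr p) c -
        ∑ s, Q₂ p s * (Z Q₁ Q₂ z J)⁻¹ (Sum.inl s) c) := by
  have h : (Z Q₁ Q₂ z J * (Z Q₁ Q₂ z J)⁻¹) (Sum.inr p) c =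
      (1 : Matrix (Fin k ⊕ Fin n) (Fin k ⊕ Fin n) K) (Sum.inr p) c := by
    rw [Matrix.mul_nonsing_inv _ (isUnit_iff_ne_zero.mpr hdet)]
  rw [Z_mul_inr, if_neg hp] at h
  have := hz p
  field_simp
  linear_combination h

/-- The blocks of `Z(J)⁻¹` outside `J` in terms of the leading block. -/
theorem Z_inv_inr_inr (hdet : (Z Q₁ Q₂ z J).det ≠ 0) (hz : ∀ i, z i ≠ 0) {p q : Fin n}
    (hp : p ∉ J) (hq : q ∉ J) :
    (Z Q₁ Q₂ z J)⁻¹ (Sum.inr p) (Sum.inr q) =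
      (if p = q then (z p)⁻¹ else 0) +
        (z p)⁻¹ * (Q₂ * (Z Q₁ Q₂ z J)⁻¹.toBlocks₁₁ * Q₁) p q * (z q)⁻¹ := by
  rw [Z_inv_inr_left hdet hz hp]
  have : ∀ s, (Z Q₁ Q₂ z J)⁻¹ (Sum.inl s) (Sum.inr q) =
      -(z q)⁻¹ * ∑ t, (Z Q₁ Q₂ z J)⁻¹ (Sum.inl s) (Sum.inl t) * Q₁ t q :=
    fun s => Z_inv_inl_inr hdet hz hq _ (by simp)
  simp only [this]
  have h2 : (Q₂ * (Z Q₁ Q₂ z J)⁻¹.toBlocks₁₁ * Q₁) p q =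
      ∑ s, Q₂ p s * ∑ t, (Z Q₁ Q₂ z J)⁻¹ (Sum.inl s) (Sum.inl t) * Q₁ t q := by
    rw [Matrix.mul_assoc]
    simp [Matrix.mul_apply, Matrix.toBlocks₁₁]
  rw [h2, Finset.mul_sum, Finset.sum_mul, Matrix.one_apply]
  simp only [Sum.inr.injEq]
  rw [mul_sub, sub_eq_add_neg, Finset.mul_sum, ← Finset.sum_neg_distrib]
  congr 1
  · split_ifs <;> simp
  · exact Finset.sum_congr rfl fun s _ => by ring

theorem diag_Z_inv (hdet : (Z Q₁ Q₂ z J).det ≠ 0) (hz : ∀ i, z i ≠ 0) {i : Fin n} (hi : i ∉ J) :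
    (Z Q₁ Q₂ z J)⁻¹ (Sum.inr i) (Sum.inr i) - (z i)⁻¹ =
      (z i)⁻¹ * (Q₂ * (Z Q₁ Q₂ z J)⁻¹.toBlocks₁₁ * Q₁) i i * (z i)⁻¹ := by
  rw [Z_inv_inr_inr hdet hz hi hi, if_pos rfl]; ring

theorem Z_insert_mul {m : Type*} {i : Fin n} (hi : i ∉ J) (A : Matrix (Fin k ⊕ Fin n) m K)
    (x : Fin k ⊕ Fin n) (y : m) :
    (Z Q₁ Q₂ z (insert i J) * A) x y = (Z Q₁ Q₂ z J * A) x y -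
      if x = Sum.inr i then z i * A (Sum.inr i) y else 0 := by
  rcases x with s | p
  · simp [Z_mul_inl]
  · rw [Z_mul_inr, Z_mul_inr]
    by_cases hp : p = i
    · subst hp; simp [hi]
    · simp [hp]

/-- Column `i` of `Z(J)⁻¹` is a kernel vector: `Z(J)` maps it to the unit vector at `i`, and
removing `z i` from the diagonal subtracts `z i * (z i)⁻¹ = 1` at that place. -/
theorem det_Z_insert_eq_zero (hdet : (Z Q₁ Q₂ z J).det ≠ 0) (hz : ∀ i, z i ≠ 0) {i : Fin n}
    (hi : i ∉ J) (h : (Z Q₁ Q₂ z J)⁻¹ (Sum.inr i) (Sum.inr i) = (z i)⁻¹) :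
    (Z Q₁ Q₂ z (insert i J)).det = 0 := by
  have hinv := Matrix.mul_nonsing_inv _ (isUnit_iff_ne_zero.mpr hdet)
  rw [← Matrix.exists_mulVec_eq_zero_iff]
  refine ⟨(Z Q₁ Q₂ z J)⁻¹.col (Sum.inr i), ?_, ?_⟩
  · intro h0
    have := congrFun h0 (Sum.inr i)
    simp only [Matrix.col_apply, Pi.zero_apply, h] at this
    exact inv_ne_zero (hz i) this
  · funext x
    have h1 := Z_insert_mul (z := z) (Q₁ := Q₁) (Q₂ := Q₂) hi (Z Q₁ Q₂ z J)⁻¹ x (Sum.inr i)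
    rw [hinv, h, mul_inv_cancel₀ (hz i), Matrix.one_apply, sub_self] at h1
    exact h1

/-- The rank-1 update of `Z(J)⁻¹` when `i` is added to `J`. -/
theorem Z_insert_inv (hdet : (Z Q₁ Q₂ z J).det ≠ 0) (hz : ∀ i, z i ≠ 0) {i : Fin n}
    (hi : i ∉ J) (h : (Z Q₁ Q₂ z J)⁻¹ (Sum.inr i) (Sum.inr i) ≠ (z i)⁻¹) :
    (Z Q₁ Q₂ z (insert i J)).det ≠ 0 ∧
    (Z Q₁ Q₂ z (insert i J))⁻¹ = (Z Q₁ Q₂ z J)⁻¹ -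
      ((Z Q₁ Q₂ z J)⁻¹ (Sum.inr i) (Sum.inr i) - (z i)⁻¹)⁻¹ •
        Matrix.vecMulVec ((Z Q₁ Q₂ z J)⁻¹.col (Sum.inr i)) ((Z Q₁ Q₂ z J)⁻¹.row (Sum.inr i)) := by
  have hinv := Matrix.mul_nonsing_inv _ (isUnit_iff_ne_zero.mpr hdet)
  set A := (Z Q₁ Q₂ z J)⁻¹ with hA
  set c := A (Sum.inr i) (Sum.inr i) - (z i)⁻¹ with hc
  have hc0 : c ≠ 0 := sub_ne_zero.mpr h
  -- Sherman–Morrison for `Z(J) - z i • eᵢeᵢᵀ`, with the denominator divided by `- z i`.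
  have key : Z Q₁ Q₂ z (insert i J) *
      (A - c⁻¹ • Matrix.vecMulVec (A.col (Sum.inr i)) (A.row (Sum.inr i))) = 1 := by
    ext x y
    rw [Z_insert_mul hi, mul_sub, hinv, Matrix.mul_smul, Matrix.mul_vecMulVec]
    have h1 : Z Q₁ Q₂ z J *ᵥ A.col (Sum.inr i) = Pi.single (Sum.inr i) 1 := by
      funext w
      have := congrFun (congrFun hinv w) (Sum.inr i)
      rw [Matrix.one_apply] at this
      rw [Pi.single_apply]
      exact this
    rw [h1]
    simp only [Matrix.sub_apply, Matrix.smul_apply, Matrix.vecMulVec_apply, Matrix.row_apply,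
      Matrix.col_apply, Pi.single_apply, smul_eq_mul]
    by_cases hx : x = Sum.inr i
    · subst hx
      have hA : A (Sum.inr i) (Sum.inr i) = c + (z i)⁻¹ := by rw [hc]; ring
      rw [hA]
      have := hz i
      simp only [if_true]
      field_simp
      ring
    · simp [hx]
  have hu : IsUnit (Z Q₁ Q₂ z (insert i J)).det := Matrix.isUnit_det_of_right_inverse key
  exact ⟨hu.ne_zero, Matrix.inv_eq_right_inv key⟩

theorem mul_diagonal_mul_apply {l m o : Type*} [Fintype m] [DecidableEq m] (A : Matrix l m K)
    (d : m → K) (B : Matrix m o K) (s : l) (t : o) :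
    (A * Matrix.diagonal d * B) s t = ∑ p, A s p * d p * B p t := by
  rw [Matrix.mul_apply]
  simp only [Matrix.mul_diagonal]

/-- Block elimination: the rows of `Z(J) Z(J)⁻¹ = 1` outside `J` express those rows of the inverse
by its leading rows. Substituted into the remaining rows, they turn the coefficient matrix into the
Schur complement `Y(J)`. -/
theorem Y_mul_Z_inv (hdet : (Z Q₁ Q₂ z J).det ≠ 0) (hz : ∀ i, z i ≠ 0) :
    Y Q₁ Q₂ z J * (Z Q₁ Q₂ z J)⁻¹.submatrix (Sum.map id Subtype.val) (Sum.map id Subtype.val)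
      = 1 := by
  have hinv := Matrix.mul_nonsing_inv _ (isUnit_iff_ne_zero.mpr hdet)
  set A := (Z Q₁ Q₂ z J)⁻¹ with hA
  have hinj : Function.Injective
      (Sum.map id Subtype.val : Fin k ⊕ {i : Fin n // i ∈ J} → Fin k ⊕ Fin n) :=
    Function.injective_id.sumMap Subtype.val_injective
  have hout : ∀ (p : Fin n) (c : Fin k ⊕ {i : Fin n // i ∈ J}), p ∉ J →
      A (Sum.inr p) (Sum.map id Subtype.val c) =
        -(z p)⁻¹ * ∑ s, Q₂ p s * A (Sum.inl s) (Sum.map id Subtype.val c) := by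
    intro p c hp
    rw [hA, Z_inv_inr_left hdet hz hp, Matrix.one_apply_ne]
    · ring
    · rcases c with c | c
      · simp
      · simp only [Sum.map_inr, ne_eq, Sum.inr.injEq]
        rintro rfl
        exact hp c.2
  ext x c
  have hrow := congrFun (congrFun hinv (Sum.map id Subtype.val x)) (Sum.map id Subtype.val c)
  rw [show (1 : Matrix _ _ K) x c = (1 : Matrix (Fin k ⊕ Fin n) (Fin k ⊕ Fin n) K)
    (Sum.map id Subtype.val x) (Sum.map id Subtype.val c) by simp [Matrix.one_apply, hinj.eq_iff],
    ← hrow]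
  rcases x with s | p
  · rw [Sum.map_inl, Z_mul_inl, ← Fintype.sum_subtype_add_sum_subtype (fun p => p ∈ J)]
    rw [Matrix.mul_apply]
    have hout' : ∀ p : {p : Fin n // p ∉ J}, A (Sum.inr p) (Sum.map id Subtype.val c) =
        -(z p)⁻¹ * ∑ s, Q₂ p s * A (Sum.inl s) (Sum.map id Subtype.val c) :=
      fun p => hout p c p.2
    simp only [hout', Y, Fintype.sum_sum_type, Matrix.fromBlocks_apply₁₁,
      Matrix.fromBlocks_apply₁₂, Matrix.submatrix_apply, Sum.map_inl, Sum.map_inr, id]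
    rw [add_comm]
    congr 1
    · congr!
    · simp only [Matrix.neg_apply, mul_diagonal_mul_apply, Matrix.submatrix_apply, id,
        Finset.mul_sum, Finset.sum_mul, neg_mul, Finset.sum_neg_distrib, mul_neg]
      rw [Finset.sum_comm]
      congr 1
      exact Finset.sum_congr rfl fun _ _ => Finset.sum_congr rfl fun _ _ => by ring
  · rw [Sum.map_inr, Z_mul_inr, if_pos p.2]
    simp [Y, Matrix.mul_apply, Fintype.sum_sum_type]

theorem det_Y_ne_zero (hdet : (Z Q₁ Q₂ z J).det ≠ 0) (hz : ∀ i, z i ≠ 0) :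
    (Y Q₁ Q₂ z J).det ≠ 0 :=
  (Matrix.isUnit_det_of_right_inverse (Y_mul_Z_inv hdet hz)).ne_zero

theorem calY_eq (hdet : (Z Q₁ Q₂ z J).det ≠ 0) (hz : ∀ i, z i ≠ 0) :
    calY Q₁ Q₂ z J = (Z Q₁ Q₂ z J)⁻¹.toBlocks₁₁ := by
  rw [calY, Matrix.inv_eq_right_inv (Y_mul_Z_inv hdet hz)]
  rfl

/-- Besides starting the scan, this turns every minor of `Y` into a value of a polynomial `det
Z(∅)`, up to a nonzero factor. Pivot selection and scan are thus governed by the same kind of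
polynomial. -/
theorem det_Z_empty (hz : ∀ i, z i ≠ 0) :
    (Z Q₁ Q₂ z ∅).det = (∏ i, z i) * (Y₀ Q₁ Q₂ z).det := by
  have hu : IsUnit (Matrix.diagonal z) := by
    rw [Matrix.isUnit_iff_isUnit_det, Matrix.det_diagonal]
    exact isUnit_iff_ne_zero.mpr (Finset.prod_ne_zero_iff.mpr fun i _ => hz i)
  let _ := hu.invertible
  have h1 : ⅟(Matrix.diagonal z) = Matrix.diagonal (fun i => (z i)⁻¹) := by
    refine invOf_eq_right_inv ?_
    rw [Matrix.diagonal_mul_diagonal, ← Matrix.diagonal_one]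
    congr 1
    funext i
    exact mul_inv_cancel₀ (hz i)
  have h2 := Matrix.det_fromBlocks₂₂ 0 Q₁ Q₂ (Matrix.diagonal z)
  rw [h1, Matrix.det_diagonal, zero_sub] at h2
  simpa [Z, Y₀] using h2

/-- The matrix `Y(∅)` carries an extra, empty index type, so the block elimination is repeated for
`Y₀` itself. -/
theorem Y₀_inv_eq (hz : ∀ i, z i ≠ 0) (hdet : (Z Q₁ Q₂ z ∅).det ≠ 0) :
    (Y₀ Q₁ Q₂ z)⁻¹ = (Z Q₁ Q₂ z ∅)⁻¹.toBlocks₁₁ := by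
  refine Matrix.inv_eq_right_inv ?_
  have h := Y_mul_Z_inv hdet hz
  ext s t
  have h1 := congrFun (congrFun h (Sum.inl s)) (Sum.inl t)
  have hinv := Matrix.mul_nonsing_inv _ (isUnit_iff_ne_zero.mpr hdet)
  have hrow := congrFun (congrFun hinv (Sum.inl s)) (Sum.inl t)
  rw [Z_mul_inl] at hrow
  have hout : ∀ p, (Z Q₁ Q₂ z ∅)⁻¹ (Sum.inr p) (Sum.inl t) =
      -(z p)⁻¹ * ∑ s, Q₂ p s * (Z Q₁ Q₂ z ∅)⁻¹ (Sum.inl s) (Sum.inl t) := by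
    intro p
    rw [Z_inv_inr_left hdet hz (by simp), Matrix.one_apply_ne (by simp)]
    ring
  simp only [hout] at hrow
  rw [show (1 : Matrix _ _ K) s t = (1 : Matrix (Fin k ⊕ Fin n) (Fin k ⊕ Fin n) K)
    (Sum.inl s) (Sum.inl t) by simp [Matrix.one_apply], ← hrow]
  rw [Matrix.mul_apply]
  simp only [Y₀, Matrix.neg_apply, mul_diagonal_mul_apply, Finset.mul_sum, Finset.sum_mul, neg_mul,
    Finset.sum_neg_distrib, mul_neg, Matrix.toBlocks₁₁, Matrix.of_apply]
  rw [Finset.sum_comm]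
  congr 1
  exact Finset.sum_congr rfl fun _ _ => Finset.sum_congr rfl fun _ _ => by ring

end Inverse

end MatInt

namespace MatInt

open scoped Matrix

/-! ### The invariant of the scan -/

section Scan

variable {K : Type*} [Field K] {n k : ℕ}

/-- The invariant of the scan after `t` elements. -/
structure ScanInv (r : ℕ) (Q₁ : Matrix (Fin k) (Fin n) K) (Q₂ : Matrix (Fin n) (Fin k) K)
    (z : Fin n → K) (t : ℕ) (s : AlgState K n k) : Prop where
  det_ne : (Z Q₁ Q₂ z s.J).det ≠ 0
  W_eq : s.W = (Z Q₁ Q₂ z s.J)⁻¹.toBlocks₁₁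
  lt_of_mem : ∀ p ∈ s.J, (p : ℕ) < t
  D_eq : ∀ i : ℕ, i + 1 = t → ∀ p q : Fin n, (p : ℕ) / r = i / r → (q : ℕ) / r = i / r →
    s.D p q = (Z Q₁ Q₂ z s.J)⁻¹ (Sum.inr p) (Sum.inr q)

variable {r : ℕ} {Q₁ : Matrix (Fin k) (Fin n) K} {Q₂ : Matrix (Fin n) (Fin k) K} {z : Fin n → K}

theorem ScanInv.notMem {i : Fin n} {s : AlgState K n k} (h : ScanInv r Q₁ Q₂ z i s) : i ∉ s.J :=
  fun hi => lt_irrefl _ (h.lt_of_mem i hi)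

/-- At the start of a block, `J` contains only earlier elements, hence none of the block, and the
formula in `W` valid outside `J` gives the whole diagonal block. Otherwise `i - 1` lies in the same
block and the stored block is current. -/
theorem ScanInv.block_eq (hz : ∀ i, z i ≠ 0) {i : Fin n} {s : AlgState K n k}
    (h : ScanInv r Q₁ Q₂ z i s) (p q : Fin n) (hp : (p : ℕ) / r = (i : ℕ) / r)
    (hq : (q : ℕ) / r = (i : ℕ) / r) :
    (if (i : ℕ) % r = 0 then diagBlock r Q₁ Q₂ z s.W ((i : ℕ) / r) else s.D) p q =
      (Z Q₁ Q₂ z s.J)⁻¹ (Sum.inr p) (Sum.inr q) := by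
  split_ifs with hi
  · have hmem : ∀ p : Fin n, (p : ℕ) / r = (i : ℕ) / r → p ∉ s.J := by
      intro p hp hpJ
      have h1 := h.lt_of_mem p hpJ
      have h2 := Nat.div_add_mod (i : ℕ) r
      have h3 := Nat.div_mul_le_self (p : ℕ) r
      rw [hp, mul_comm] at h3
      omega
    rw [Z_inv_inr_inr h.det_ne hz (hmem p hp) (hmem q hq), diagBlock, Matrix.of_apply,
      if_pos ⟨hp, hq⟩, Matrix.add_apply, Matrix.diagonal_apply, Matrix.mul_diagonal,
      Matrix.mul_assoc, Matrix.mul_assoc, Matrix.diagonal_mul, h.W_eq, Matrix.mul_assoc]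
  · have hi0 : (i : ℕ) ≠ 0 := fun h0 => hi (by rw [h0, Nat.zero_mod])
    have hpred : ((i : ℕ) - 1) / r = (i : ℕ) / r := by
      obtain ⟨j, hj⟩ := Nat.exists_eq_succ_of_ne_zero hi0
      rw [hj, Nat.succ_eq_add_one, Nat.add_sub_cancel, Nat.succ_div_of_not_dvd]
      rw [← Nat.succ_eq_add_one, ← hj]
      exact fun hd => hi (Nat.mod_eq_zero_of_dvd hd)
    exact h.D_eq (i - 1) (by omega) p q (by rw [hpred, hp]) (by rw [hpred, hq])

theorem dot_mulVec_eq (W : Matrix (Fin k) (Fin k) K) (i : Fin n) :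
    Q₂.row i ⬝ᵥ W *ᵥ Q₁.col i = (Q₂ * W * Q₁) i i := by
  rw [Matrix.mul_assoc]
  simp [dotProduct, Matrix.mulVec, Matrix.mul_apply]

/-- The diagonal entry and `(z i)⁻¹` differ by `(z i)⁻¹ * vᵀWu * (z i)⁻¹`, so the test depends on
`W` alone. The program uses this form and never computes the diagonal block of `Z(J)⁻¹`. -/
theorem ScanInv.test_iff (hz : ∀ i, z i ≠ 0) {i : Fin n} {s : AlgState K n k}
    (h : ScanInv r Q₁ Q₂ z i s) :
    (Z Q₁ Q₂ z s.J)⁻¹ (Sum.inr i) (Sum.inr i) ≠ (z i)⁻¹ ↔ (Q₂ * s.W * Q₁) i i ≠ 0 := by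
  have h1 := diag_Z_inv h.det_ne hz h.notMem
  rw [← h.W_eq] at h1
  have := inv_ne_zero (hz i)
  rw [← sub_ne_zero, h1]
  simp [this]

/-- The part of a step of the scan that does not refer to the diagonal block. -/
theorem ScanInv.step_eq (hz : ∀ i, z i ≠ 0) {i : Fin n} {s : AlgState K n k}
    (h : ScanInv r Q₁ Q₂ z i s) :
    ((Q₂ * s.W * Q₁) i i ≠ 0 → (algStep r Q₁ Q₂ z i s).J = insert i s.J ∧
      (algStep r Q₁ Q₂ z i s).W = s.W - ((Q₂ * s.W * Q₁) i i)⁻¹ •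
        Matrix.vecMulVec (s.W *ᵥ Q₁.col i) (Q₂.row i ᵥ* s.W)) ∧
    ((Q₂ * s.W * Q₁) i i = 0 →
      (algStep r Q₁ Q₂ z i s).J = s.J ∧ (algStep r Q₁ Q₂ z i s).W = s.W) := by
  have hD := h.block_eq hz i i rfl rfl
  have ht := h.test_iff hz
  rw [← hD] at ht
  constructor
  · intro h0
    have := ht.mpr h0
    simp only [algStep, if_pos this, dot_mulVec_eq, and_self]
  · intro h0
    have := fun hc => ht.mp hc h0
    simp only [algStep, if_neg this, and_self]

theorem ScanInv.step (hz : ∀ i, z i ≠ 0) {i : Fin n} {s : AlgState K n k}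
    (h : ScanInv r Q₁ Q₂ z i s) : ScanInv r Q₁ Q₂ z (i + 1) (algStep r Q₁ Q₂ z i s) := by
  have hblock := h.block_eq hz
  have hstep := h.step_eq hz
  have htest := h.test_iff hz
  by_cases h0 : (Q₂ * s.W * Q₁) i i = 0
  · obtain ⟨hJ, hW⟩ := hstep.2 h0
    refine ⟨by rw [hJ]; exact h.det_ne, by rw [hJ, hW]; exact h.W_eq, ?_, ?_⟩
    · intro p hp
      rw [hJ] at hp
      exact (h.lt_of_mem p hp).trans (Nat.lt_succ_self _)
    · intro j hj p q hp hq
      obtain rfl : j = i := by omega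
      have h1 : ¬ (if (i : ℕ) % r = 0 then diagBlock r Q₁ Q₂ z s.W ((i : ℕ) / r) else s.D) i i ≠
          (z i)⁻¹ := by
        rw [hblock i i rfl rfl]
        exact fun hc => htest.mp hc h0
      simp only [algStep, if_neg h1]
      exact hblock p q hp hq
  · obtain ⟨hJ, hW⟩ := hstep.1 h0
    obtain ⟨hdet, hinv⟩ := Z_insert_inv h.det_ne hz h.notMem (htest.mpr h0)
    have hdiag := diag_Z_inv h.det_ne hz h.notMem
    rw [← h.W_eq] at hdiag
    refine ⟨by rw [hJ]; exact hdet, ?_, ?_, ?_⟩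
    · rw [hJ, hW, hinv, hdiag]
      ext a b
      -- The factors `-(z i)⁻¹` of the border column and the border row cancel the two factors `(z
      -- i)⁻¹` of the pivot in `hdiag`; what remains is the update of `W` with denominator `vᵀWu`.
      have hl : (Z Q₁ Q₂ z s.J)⁻¹ (Sum.inl a) (Sum.inr i) = -(z i)⁻¹ * (s.W *ᵥ Q₁.col i) a := by
        rw [Z_inv_inl_inr h.det_ne hz h.notMem _ (by simp), h.W_eq]
        simp [Matrix.mulVec, dotProduct, Matrix.toBlocks₁₁]
      have hr : (Z Q₁ Q₂ z s.J)⁻¹ (Sum.inr i) (Sum.inl b) = -(z i)⁻¹ * (Q₂.row i ᵥ* s.W) b := by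
        rw [Z_inv_inr_left h.det_ne hz h.notMem, Matrix.one_apply_ne (by simp), h.W_eq]
        simp [Matrix.vecMul, dotProduct, Matrix.toBlocks₁₁]
      have hz' := hz i
      simp only [Matrix.sub_apply, Matrix.smul_apply, Matrix.vecMulVec_apply, Matrix.toBlocks₁₁,
        Matrix.of_apply, Matrix.col_apply, Matrix.row_apply, hl, hr, smul_eq_mul]
      rw [h.W_eq]
      simp only [Matrix.toBlocks₁₁, Matrix.of_apply]
      congr 1
      rw [← Matrix.toBlocks₁₁, ← h.W_eq]
      field_simp
    · intro p hp
      rw [hJ, Finset.mem_insert] at hp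
      rcases hp with rfl | hp
      · exact Nat.lt_succ_self _
      · exact (h.lt_of_mem p hp).trans (Nat.lt_succ_self _)
    · intro j hj p q hp hq
      obtain rfl : j = i := by omega
      have h1 : (if (i : ℕ) % r = 0 then diagBlock r Q₁ Q₂ z s.W ((i : ℕ) / r) else s.D) i i ≠
          (z i)⁻¹ := by
        rw [hblock i i rfl rfl]
        exact htest.mpr h0
      rw [hJ, hinv]
      simp only [algStep, if_pos h1, Matrix.sub_apply, Matrix.smul_apply, Matrix.vecMulVec_apply,
        Matrix.col_apply, Matrix.row_apply, hblock p q hp hq, hblock i i rfl rfl,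
        hblock p i hp rfl, hblock i q rfl hq]

theorem scanInv_algState (hz : ∀ i, z i ≠ 0) (hdet : (Y₀ Q₁ Q₂ z).det ≠ 0) (t : ℕ) (ht : t ≤ n) :
    ScanInv r Q₁ Q₂ z t (algState r Q₁ Q₂ z t) := by
  induction t with
  | zero =>
    have hZ : (Z Q₁ Q₂ z ∅).det ≠ 0 := by
      rw [det_Z_empty hz]
      exact mul_ne_zero (Finset.prod_ne_zero_iff.mpr fun i _ => hz i) hdet
    exact ⟨hZ, Y₀_inv_eq hz hZ, by simp [algState], by simp⟩
  | succ t ih =>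
    have h := ScanInv.step (i := ⟨t, ht⟩) hz (ih (by omega))
    rw [algState, dif_pos (show t < n from ht)]
    exact h

theorem algState_succ (r : ℕ) (Q₁ : Matrix (Fin k) (Fin n) K) (Q₂ : Matrix (Fin n) (Fin k) K)
    (z : Fin n → K) (i : Fin n) :
    algState r Q₁ Q₂ z (i + 1) = algStep r Q₁ Q₂ z i (algState r Q₁ Q₂ z i) := by
  rw [algState, dif_pos i.2]

theorem algState_of_le (r : ℕ) (Q₁ : Matrix (Fin k) (Fin n) K) (Q₂ : Matrix (Fin n) (Fin k) K)
    (z : Fin n → K) (t : ℕ) (ht : n ≤ t) : algState r Q₁ Q₂ z t = algState r Q₁ Q₂ z n := by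
  induction t, ht using Nat.le_induction with
  | base => rfl
  | succ t ht ih => rw [algState, dif_neg (by omega), ih]

theorem mem_algState_succ_iff (hz : ∀ i, z i ≠ 0) (hdet : (Y₀ Q₁ Q₂ z).det ≠ 0) (i : Fin n) :
    i ∈ (algState r Q₁ Q₂ z (i + 1)).J ↔
      (Z Q₁ Q₂ z (insert i (algState r Q₁ Q₂ z i).J)).det ≠ 0 := by
  have h := scanInv_algState (r := r) hz hdet i i.2.le
  rw [algState_succ]
  by_cases h0 : (Q₂ * (algState r Q₁ Q₂ z i).W * Q₁) i i = 0
  · rw [((h.step_eq hz).2 h0).1]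
    have := fun hc => (h.test_iff hz).mp hc h0
    simp [h.notMem, det_Z_insert_eq_zero h.det_ne hz h.notMem (not_not.mp this)]
  · rw [((h.step_eq hz).1 h0).1]
    simpa using (Z_insert_inv h.det_ne hz h.notMem ((h.test_iff hz).mpr h0)).1

-- In this form the scan depends on `z` only through the vanishing of determinants, which allows the
-- comparison with generic values.
open Classical in
theorem algState_succ_J (hz : ∀ i, z i ≠ 0) (hdet : (Y₀ Q₁ Q₂ z).det ≠ 0) (i : Fin n) :
    (algState r Q₁ Q₂ z (i + 1)).J =
      if (Z Q₁ Q₂ z (insert i (algState r Q₁ Q₂ z i).J)).det ≠ 0 then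
        insert i (algState r Q₁ Q₂ z i).J else (algState r Q₁ Q₂ z i).J := by
  have h := scanInv_algState (r := r) hz hdet i i.2.le
  have hm := mem_algState_succ_iff (r := r) hz hdet i
  rw [algState_succ] at hm ⊢
  by_cases h0 : (Q₂ * (algState r Q₁ Q₂ z i).W * Q₁) i i = 0
  · rw [((h.step_eq hz).2 h0).1] at hm ⊢
    rw [if_neg (fun hc => h.notMem (hm.mpr hc))]
  · rw [((h.step_eq hz).1 h0).1] at hm ⊢
    rw [if_pos (hm.mp (Finset.mem_insert_self _ _))]

theorem scan_maintains (hz : ∀ i, z i ≠ 0) (hdet : (Y₀ Q₁ Q₂ z).det ≠ 0) :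
    (∀ t ≤ n, (Z Q₁ Q₂ z (algState r Q₁ Q₂ z t).J).det ≠ 0 ∧
      (Y Q₁ Q₂ z (algState r Q₁ Q₂ z t).J).det ≠ 0 ∧
      (algState r Q₁ Q₂ z t).W = calY Q₁ Q₂ z (algState r Q₁ Q₂ z t).J) ∧
    ∀ i : Fin n,
      (i ∈ (algState r Q₁ Q₂ z (i + 1)).J ↔
        (Z Q₁ Q₂ z (insert i (algState r Q₁ Q₂ z i).J)).det ≠ 0) ∧
      ∀ p q : Fin n, (p : ℕ) / r = (i : ℕ) / r → (q : ℕ) / r = (i : ℕ) / r →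
        (algState r Q₁ Q₂ z (i + 1)).D p q =
          (Z Q₁ Q₂ z (algState r Q₁ Q₂ z (i + 1)).J)⁻¹ (Sum.inr p) (Sum.inr q) := by
  refine ⟨fun t ht => ?_, fun i => ⟨mem_algState_succ_iff hz hdet i, ?_⟩⟩
  · have h := scanInv_algState (r := r) hz hdet t ht
    exact ⟨h.det_ne, det_Y_ne_zero h.det_ne hz, by rw [calY_eq h.det_ne hz, h.W_eq]⟩
  · exact (scanInv_algState hz hdet (i + 1) i.2).D_eq i rfl

end Scan

end MatInt

namespace MatInt

open scoped Matrix

/-! ### Bordered determinants and common independence -/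

section Bordered

/-- The matrix with blocks `0`, `Q₁`, `Q₂` and a diagonal matrix. -/
def bordered {R : Type*} [CommRing R] {k n : ℕ} (Q₁ : Matrix (Fin k) (Fin n) R)
    (Q₂ : Matrix (Fin n) (Fin k) R) (d : Fin n → R) :
    Matrix (Fin k ⊕ Fin n) (Fin k ⊕ Fin n) R :=
  Matrix.fromBlocks 0 Q₁ Q₂ (Matrix.diagonal d)

variable {R K : Type*} [CommRing R] [Field K] {k n : ℕ}

theorem Z_eq_bordered (Q₁ : Matrix (Fin k) (Fin n) K) (Q₂ : Matrix (Fin n) (Fin k) K)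
    (z : Fin n → K) (J : Finset (Fin n)) :
    Z Q₁ Q₂ z J = bordered Q₁ Q₂ (fun i => if i ∈ J then 0 else z i) := rfl

theorem map_det_bordered {S : Type*} [CommRing S] (f : R →+* S) (Q₁ : Matrix (Fin k) (Fin n) R)
    (Q₂ : Matrix (Fin n) (Fin k) R) (d : Fin n → R) :
    f (bordered Q₁ Q₂ d).det = (bordered (Q₁.map f) (Q₂.map f) (fun i => f (d i))).det := by
  rw [RingHom.map_det, bordered, RingHom.mapMatrix_apply, Matrix.fromBlocks_map,
    Matrix.diagonal_map (map_zero f), Matrix.map_zero _ (map_zero f)]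
  rfl

theorem det_bordered_ne_zero_iff {Q₁ : Matrix (Fin k) (Fin n) K} {Q₂ : Matrix (Fin n) (Fin k) K}
    {d : Fin n → K} :
    (bordered Q₁ Q₂ d).det ≠ 0 ↔
      ∀ x y, Q₁ *ᵥ y = 0 → Q₂ *ᵥ x + d * y = 0 → x = 0 ∧ y = 0 := by
  rw [ne_eq, ← Matrix.exists_mulVec_eq_zero_iff]
  push Not
  have hmul : ∀ x y, bordered Q₁ Q₂ d *ᵥ Sum.elim x y = Sum.elim (Q₁ *ᵥ y) (Q₂ *ᵥ x + d * y) := by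
    intro x y
    rw [bordered, Matrix.fromBlocks_mulVec]
    congr 1
    · simp
    · funext i
      simp [Matrix.mulVec_diagonal]
  constructor
  · intro h x y h1 h2
    by_contra hne
    refine h (Sum.elim x y) (fun h0 => hne ⟨?_, ?_⟩) ?_
    · funext i; exact congrFun h0 (Sum.inl i)
    · funext i; exact congrFun h0 (Sum.inr i)
    · rw [hmul, h1, h2]
      funext i; rcases i <;> rfl
  · intro h v hv h0
    obtain ⟨x, y, rfl⟩ : ∃ x y, v = Sum.elim x y :=
      ⟨v ∘ Sum.inl, v ∘ Sum.inr, (Sum.elim_comp_inl_inr v).symm⟩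
    rw [hmul] at h0
    obtain ⟨rfl, rfl⟩ := h x y (funext fun i => congrFun h0 (Sum.inl i))
      (funext fun i => congrFun h0 (Sum.inr i))
    exact hv (funext fun i => by rcases i <;> rfl)

/-- Transposition exchanges the roles of the two matroids, so statements are proved for the columns
of `Q₁` only. -/
theorem det_bordered_transpose (Q₁ : Matrix (Fin k) (Fin n) R) (Q₂ : Matrix (Fin n) (Fin k) R)
    (d : Fin n → R) : (bordered Q₂ᵀ Q₁ᵀ d).det = (bordered Q₁ Q₂ d).det := by
  rw [← Matrix.det_transpose, bordered, bordered, Matrix.fromBlocks_transpose]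
  simp

/-- A relation among the columns in `J`, extended by zero and completed by `x = 0`, lies in the
kernel, since `d` vanishes on `J`. -/
theorem linearIndepOn_col_of_det_bordered {Q₁ : Matrix (Fin k) (Fin n) K}
    {Q₂ : Matrix (Fin n) (Fin k) K} {d : Fin n → K} {J : Finset (Fin n)} (hd : ∀ i ∈ J, d i = 0)
    (h : (bordered Q₁ Q₂ d).det ≠ 0) : LinearIndepOn K Q₁.col (J : Set (Fin n)) := by
  classical
  rw [linearIndepOn_finset_iff]
  intro f hf i hi
  have := (det_bordered_ne_zero_iff.mp h 0 (fun i => if i ∈ J then f i else 0) ?_ ?_).2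
  · have h1 := congrFun this i
    simpa [hi] using h1
  · rw [← hf]
    funext s
    simp [Matrix.mulVec, dotProduct, Finset.sum_apply, mul_comm]
  · funext j
    by_cases hj : j ∈ J
    · simp [hj, hd]
    · simp [hj]

theorem linearIndepOn_of_det_Z {Q₁ : Matrix (Fin k) (Fin n) K}
    {Q₂ : Matrix (Fin n) (Fin k) K} {z : Fin n → K} {J : Finset (Fin n)}
    (h : (Z Q₁ Q₂ z J).det ≠ 0) :
    LinearIndepOn K Q₁.col (J : Set (Fin n)) ∧ LinearIndepOn K Q₂.row (J : Set (Fin n)) := by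
  rw [Z_eq_bordered] at h
  refine ⟨linearIndepOn_col_of_det_bordered (fun i hi => if_pos hi) h, ?_⟩
  rw [← det_bordered_transpose] at h
  exact linearIndepOn_col_of_det_bordered (Q₁ := Q₂ᵀ) (fun i hi => if_pos hi) h

theorem card_le_of_linearIndepOn {f : Fin n → Fin k → K} {J : Finset (Fin n)}
    (h : LinearIndepOn K f (J : Set (Fin n))) : J.card ≤ k := by
  have := LinearIndependent.fintype_card_le_finrank h
  simpa using this

/-- The bordered matrix with the columns of `Q₁` scaled by `c`. -/
def scaledBordered (Q₁ : Matrix (Fin k) (Fin n) R) (Q₂ : Matrix (Fin n) (Fin k) R)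
    (c d : Fin n → R) : Matrix (Fin k ⊕ Fin n) (Fin k ⊕ Fin n) R :=
  bordered (Matrix.of fun s i => c i * Q₁ s i) Q₂ d

/-- Column `i` of the second kind is `c i` times a column of `Q₁` plus `d i` times a unit vector,
and the determinant is linear in it. -/
theorem det_scaledBordered_update (Q₁ : Matrix (Fin k) (Fin n) R) (Q₂ : Matrix (Fin n) (Fin k) R)
    (c d : Fin n → R) (i : Fin n) :
    (scaledBordered Q₁ Q₂ c d).det =
      c i * (scaledBordered Q₁ Q₂ (Function.update c i 1) (Function.update d i 0)).det +
      d i * (scaledBordered Q₁ Q₂ (Function.update c i 0) (Function.update d i 1)).det := by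
  have h : ∀ a b : R, scaledBordered Q₁ Q₂ (Function.update c i a) (Function.update d i b) =
      (scaledBordered Q₁ Q₂ c d).updateCol (Sum.inr i)
        (a • Sum.elim (fun s => Q₁ s i) (0 : Fin n → R) +
          b • Sum.elim (0 : Fin k → R) (Pi.single i 1)) := by
    intro a b
    ext x y
    rw [Matrix.updateCol_apply]
    rcases y with y | q
    · rcases x <;> simp [scaledBordered, bordered]
    · by_cases hq : q = i
      · subst hq
        rcases x with s | p
        · simp [scaledBordered, bordered]
        · by_cases hp : p = q <;> simp [scaledBordered, bordered, hp]
      · rcases x with s | p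
        · simp [scaledBordered, bordered, hq]
        · simp only [scaledBordered, bordered, Matrix.fromBlocks_apply₂₂, Matrix.diagonal_apply,
            Sum.inr.injEq, if_neg hq]
          by_cases hp : p = q
          · subst hp; simp [hq]
          · simp [hp]
  have h1 := h (c i) (d i)
  rw [Function.update_eq_self, Function.update_eq_self] at h1
  rw [h1, h 1 0, h 0 1, Matrix.det_updateCol_add, Matrix.det_updateCol_smul,
    Matrix.det_updateCol_smul]
  simp

/-- Splitting the columns one after another writes the determinant as a sum over subsets `I`, of
which some summand is nonzero. This plays the role of Cauchy–Binet, but only one summand has to be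
followed. The ring is general because the lemma is applied to polynomials. -/
theorem exists_det_scaledBordered_ne_zero (Q₁ : Matrix (Fin k) (Fin n) R)
    (Q₂ : Matrix (Fin n) (Fin k) R) (d : Fin n → R) (h : (bordered Q₁ Q₂ d).det ≠ 0) :
    ∃ I : Finset (Fin n), (∀ i, d i = 0 → i ∈ I) ∧
      (scaledBordered Q₁ Q₂ (fun i => if i ∈ I then 1 else 0)
        (fun i => if i ∈ I then 0 else 1)).det ≠ 0 := by
  classical
  have key : ∀ s : Finset (Fin n), ∃ I : Finset (Fin n), (∀ i ∈ s, d i = 0 → i ∈ I) ∧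
      (scaledBordered Q₁ Q₂ (fun i => if i ∈ s then (if i ∈ I then 1 else 0) else 1)
        (fun i => if i ∈ s then (if i ∈ I then 0 else 1) else d i)).det ≠ 0 := by
    intro s
    induction s using Finset.induction_on with
    | empty =>
      refine ⟨∅, by simp, ?_⟩
      simp only [scaledBordered, Finset.notMem_empty, if_false, one_mul]
      exact h
    | insert i s hi ih =>
      obtain ⟨I, hI, hdet⟩ := ih
      rw [det_scaledBordered_update _ _ _ _ i] at hdet
      rcases ne_or_eq (scaledBordered Q₁ Q₂
        (Function.update (fun i => if i ∈ s then (if i ∈ I then 1 else 0) else 1) i 1)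
        (Function.update (fun i => if i ∈ s then (if i ∈ I then 0 else 1) else d i) i 0)).det 0
        with h1 | h1
      · refine ⟨insert i I, ?_, ?_⟩
        · intro j hj hdj
          rcases Finset.mem_insert.mp hj with rfl | hj
          · exact Finset.mem_insert_self _ _
          · exact Finset.mem_insert_of_mem (hI j hj hdj)
        · convert h1 using 3 <;>
          · funext j
            by_cases hj : j = i
            · subst hj; simp
            · simp [hj]
      · rw [h1, mul_zero, zero_add] at hdet
        refine ⟨I.erase i, ?_, ?_⟩
        · intro j hj hdj
          -- In this branch the summand with factor `d i` is the nonzero one, so `d i = 0` is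
          -- impossible and every forced element stays in `I`.
          have hne : j ≠ i := by
            rintro rfl
            simp [hi, hdj] at hdet
          exact Finset.mem_erase.mpr ⟨hne, hI j ((Finset.mem_insert.mp hj).resolve_left hne) hdj⟩
        · convert right_ne_zero_of_mul hdet using 3 <;>
          · funext j
            by_cases hj : j = i
            · subst hj; simp
            · simp [hj]
  obtain ⟨I, hI, hdet⟩ := key Finset.univ
  exact ⟨I, fun i => hI i (Finset.mem_univ i), by simpa using hdet⟩

/-- If `x` is orthogonal to the columns `I` of `Q₁`, it gives a kernel vector of the transposed
scaled matrix; hence restriction to `I` is injective and `k ≤ |I|`. Restoring the columns outside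
`I` does no harm: a kernel vector first has `x = 0`, then `y = 0` outside `I` by the diagonal ones,
so these columns do not contribute. -/
theorem det_bordered_of_det_scaledBordered {Q₁ : Matrix (Fin k) (Fin n) K}
    {Q₂ : Matrix (Fin n) (Fin k) K} {I : Finset (Fin n)}
    (h : (scaledBordered Q₁ Q₂ (fun i => if i ∈ I then 1 else 0)
        (fun i => if i ∈ I then 0 else 1)).det ≠ 0) :
    k ≤ I.card ∧ (bordered Q₁ Q₂ (fun i => if i ∈ I then 0 else 1)).det ≠ 0 := by
  constructor
  · rw [scaledBordered, ← det_bordered_transpose] at h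
    have h2 := det_bordered_ne_zero_iff.mp h
    have hinj : Function.Injective (fun (x : Fin k → K) (i : I) => (Q₁ᵀ *ᵥ x) i) := by
      intro x x' hx
      have := (h2 (x - x') 0 (by simp) ?_).1
      · exact sub_eq_zero.mp this
      · funext i
        by_cases hi : i ∈ I
        · have h3 := congrFun hx ⟨i, hi⟩
          simp only [Matrix.mulVec, dotProduct, Matrix.transpose_apply] at h3
          simp [Matrix.mulVec, dotProduct, hi, mul_sub, Finset.sum_sub_distrib, h3]
        · simp [Matrix.mulVec, dotProduct, hi]
    have := LinearMap.finrank_le_finrank_of_injective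
      (f := (LinearMap.funLeft K K (Subtype.val : I → Fin n)).comp (Matrix.mulVecLin Q₁ᵀ)) hinj
    simpa using this
  · rw [scaledBordered, det_bordered_ne_zero_iff] at h
    rw [det_bordered_ne_zero_iff]
    intro x y h1 h2
    have hx : x = 0 := by
      refine (h x (fun i => if i ∈ I then 0 else y i) ?_ ?_).1
      · funext s
        simp only [Matrix.mulVec, dotProduct, Matrix.of_apply, Pi.zero_apply]
        exact Finset.sum_eq_zero fun i _ => by split_ifs <;> simp
      · funext i
        have := congrFun h2 i
        by_cases hi : i ∈ I <;> simpa [hi] using this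
    subst hx
    have hy : ∀ i, i ∉ I → y i = 0 := by
      intro i hi
      simpa [hi] using congrFun h2 i
    refine h 0 y ?_ h2
    rw [← h1]
    funext s
    simp only [Matrix.mulVec, dotProduct, Matrix.of_apply]
    refine Finset.sum_congr rfl fun i _ => ?_
    by_cases hi : i ∈ I
    · simp [hi]
    · simp [hi, hy]

theorem exists_leftInverse_of_linearIndependent {r : ℕ} (A : Matrix (Fin r) (Fin k) K)
    (h : LinearIndependent K A.col) : ∃ L : Matrix (Fin k) (Fin r) K, L * A = 1 := by
  have hinj := Matrix.mulVec_injective_iff.mpr h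
  obtain ⟨g, hg⟩ := LinearMap.exists_leftInverse_of_injective A.mulVecLin
    (LinearMap.ker_eq_bot.mpr hinj)
  refine ⟨LinearMap.toMatrix' g, ?_⟩
  have := congrArg LinearMap.toMatrix' hg
  rw [LinearMap.toMatrix'_comp, ← Matrix.toLin'_apply', LinearMap.toMatrix'_toLin',
    LinearMap.toMatrix'_id] at this
  exact this

/-- Two matrices with identity submatrices in the same places give a nonsingular matrix. -/
theorem det_bordered_of_submatrix_eq_one {Q₁ : Matrix (Fin k) (Fin n) K}
    {Q₂ : Matrix (Fin n) (Fin k) K} {I : Finset (Fin n)} (e : Fin k ≃ I)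
    (h1 : Q₁.submatrix id (fun i => (e i : Fin n)) = 1)
    (h2 : Q₂.submatrix (fun i => (e i : Fin n)) id = 1) :
    (bordered Q₁ Q₂ (fun i => if i ∈ I then 0 else 1)).det ≠ 0 := by
  rw [det_bordered_ne_zero_iff]
  intro x y hy hx
  have hx0 : x = 0 := by
    funext i
    have := congrFun hx (e i)
    have h3 : (Q₂ *ᵥ x) (e i) = (Q₂.submatrix (fun i => (e i : Fin n)) id *ᵥ x) i := rfl
    simpa [h3, h2, (e i).2] using this
  subst hx0
  refine ⟨rfl, ?_⟩
  have hy0 : ∀ i, i ∉ I → y i = 0 := by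
    intro i hi
    simpa [hi] using congrFun hx i
  have hsum : Q₁ *ᵥ y = Q₁.submatrix id (fun i => (e i : Fin n)) *ᵥ fun i => y (e i) := by
    funext s
    simp only [Matrix.mulVec, dotProduct, Matrix.submatrix_apply, id]
    rw [e.sum_comp (fun i : I => Q₁ s i * y i), Finset.sum_coe_sort I (fun i => Q₁ s i * y i)]
    symm
    refine Finset.sum_subset (Finset.subset_univ _) fun i _ hi => ?_
    rw [hy0 i hi, mul_zero]
  rw [hsum, h1, Matrix.one_mulVec] at hy
  funext i
  by_cases hi : i ∈ I
  · have := congrFun hy (e.symm ⟨i, hi⟩)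
    simpa using this
  · exact hy0 i hi

end Bordered

end MatInt

namespace MatInt

open scoped Matrix

/-! ### Greedy selection of rows and columns -/

section Selection

/-- A sequence of pairs of a row and a column. -/
structure Sel (r : ℕ) where
  m : ℕ
  a : Fin m → Fin r
  b : Fin m → Fin r

variable {r : ℕ}

/-- Append the pair of row `i` and column `j`. -/
def Sel.snoc (σ : Sel r) (i j : Fin r) : Sel r where
  m := σ.m + 1
  a := Fin.snoc (α := fun _ => Fin r) σ.a i
  b := Fin.snoc (α := fun _ => Fin r) σ.b j

theorem Sel.snoc_a_castSucc (σ : Sel r) (i j : Fin r) (t : Fin σ.m) :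
    (σ.snoc i j).a (Fin.castSucc t : Fin (σ.m + 1)) = σ.a t :=
  Fin.snoc_castSucc (α := fun _ => Fin r) _ _ _

theorem Sel.snoc_b_castSucc (σ : Sel r) (i j : Fin r) (t : Fin σ.m) :
    (σ.snoc i j).b (Fin.castSucc t : Fin (σ.m + 1)) = σ.b t :=
  Fin.snoc_castSucc (α := fun _ => Fin r) _ _ _

theorem Sel.snoc_a_last (σ : Sel r) (i j : Fin r) :
    (σ.snoc i j).a (Fin.last σ.m : Fin (σ.m + 1)) = i :=
  Fin.snoc_last (α := fun _ => Fin r) _ _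

theorem Sel.snoc_b_last (σ : Sel r) (i j : Fin r) :
    (σ.snoc i j).b (Fin.last σ.m : Fin (σ.m + 1)) = j :=
  Fin.snoc_last (α := fun _ => Fin r) _ _

/-- The empty sequence. -/
def Sel.nil (r : ℕ) : Sel r := ⟨0, Fin.elim0, Fin.elim0⟩

/-- The last column is preferred because the program's search overwrites its result at every nonzero
entry. -/
theorem exists_last (p : Fin r → Prop) (h : ∃ j, p j) : ∃ j, p j ∧ ∀ j', j < j' → ¬ p j' := by
  classical
  obtain ⟨j₀, hj₀⟩ := h
  obtain ⟨j, hj, hmax⟩ := (Finset.univ.filter p).exists_max_image id ⟨j₀, by simp [hj₀]⟩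
  refine ⟨j, (Finset.mem_filter.mp hj).2, fun j' hlt hp => ?_⟩
  have := hmax j' (by simp [hp])
  exact absurd hlt (not_lt.mpr this)

open Classical in
/-- Append row `i` with the last column that is acceptable to `T`, if there is one. -/
noncomputable def selStep (T : Sel r → Prop) (i : Fin r) (σ : Sel r) : Sel r :=
  if h : ∃ j, T (σ.snoc i j) then σ.snoc i (exists_last _ h).choose else σ

/-- Greedy selection in the first `t` rows. -/
noncomputable def selRun (T : Sel r → Prop) : ℕ → Sel r
  | 0 => Sel.nil r
  | t + 1 => if h : t < r then selStep T ⟨t, h⟩ (selRun T t) else selRun T t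

theorem selStep_of_last {T : Sel r → Prop} {i j : Fin r} {σ : Sel r} (h : T (σ.snoc i j))
    (hlast : ∀ j', j < j' → ¬ T (σ.snoc i j')) : selStep T i σ = σ.snoc i j := by
  have hex : ∃ j, T (σ.snoc i j) := ⟨j, h⟩
  rw [selStep, dif_pos hex]
  have hc := (exists_last _ hex).choose_spec
  congr 1
  rcases lt_trichotomy (exists_last _ hex).choose j with hlt | heq | hgt
  · exact absurd h (hc.2 _ hlt)
  · exact heq
  · exact absurd hc.1 (hlast _ hgt)

theorem selStep_of_forall_not {T : Sel r → Prop} {i : Fin r} {σ : Sel r}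
    (h : ∀ j, ¬ T (σ.snoc i j)) : selStep T i σ = σ := by
  rw [selStep, dif_neg (by simpa using h)]

theorem selStep_cases (T : Sel r → Prop) (i : Fin r) (σ : Sel r) :
    (selStep T i σ = σ ∧ ∀ j, ¬ T (σ.snoc i j)) ∨
      ∃ j, selStep T i σ = σ.snoc i j ∧ T (σ.snoc i j) ∧ ∀ j', j < j' → ¬ T (σ.snoc i j') := by
  by_cases h : ∃ j, T (σ.snoc i j)
  · obtain ⟨j, hj, hlast⟩ := exists_last _ h
    exact Or.inr ⟨j, selStep_of_last hj hlast, hj, hlast⟩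
  · push Not at h
    exact Or.inl ⟨selStep_of_forall_not h, h⟩

theorem selRun_succ (T : Sel r → Prop) (i : Fin r) :
    selRun T (i + 1) = selStep T i (selRun T i) := by
  rw [selRun, dif_pos i.2]

theorem selRun_holds {T : Sel r → Prop} (h0 : T (Sel.nil r)) (t : ℕ) : T (selRun T t) := by
  induction t with
  | zero => exact h0
  | succ t ih =>
    rw [selRun]
    split_ifs with ht
    · rcases selStep_cases T ⟨t, ht⟩ (selRun T t) with ⟨h, -⟩ | ⟨j, h, hT, -⟩
      · rw [h]; exact ih
      · rw [h]; exact hT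
    · exact ih

/-- A weaker acceptance test makes the same selection if it accepts the results. -/
theorem selRun_congr {T T' : Sel r → Prop} (hTT' : ∀ σ, T σ → T' σ) (t : ℕ)
    (h : ∀ i : ℕ, i < t → T (selRun T' (i + 1))) : selRun T t = selRun T' t := by
  induction t with
  | zero => rfl
  | succ t ih =>
    have ih' := ih fun i hi => h i (hi.trans (Nat.lt_succ_self _))
    have ht := h t (Nat.lt_succ_self _)
    rw [selRun] at ht ⊢
    rw [selRun, ih']
    split_ifs at ht ⊢ with htr
    -- A column rejected by `T'` is rejected by `T`; the column chosen by `T'` is accepted by `T` by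
    -- hypothesis. Hence both make the same choice.
    · rcases selStep_cases T' ⟨t, htr⟩ (selRun T' t) with ⟨h1, hno⟩ | ⟨j, h1, -, hlast⟩
      · rw [h1, selStep_of_forall_not fun j hT => hno j (hTT' _ hT)]
      · rw [h1] at ht ⊢
        exact selStep_of_last ht fun j' hj' hT => hlast j' hj' (hTT' _ hT)
    · rfl

end Selection

/-! ### Gaussian elimination and the placed inverse -/

section Elimination

variable {K : Type*} [Field K] {r : ℕ}

/-- The rows of the identity matrix with indices `a`. -/
def rowSel (K : Type*) [Field K] {r : ℕ} (σ : Sel r) : Matrix (Fin σ.m) (Fin r) K :=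
  (1 : Matrix (Fin r) (Fin r) K).submatrix σ.a id

/-- The columns of the identity matrix with indices `b`. -/
def colSel (K : Type*) [Field K] {r : ℕ} (σ : Sel r) : Matrix (Fin r) (Fin σ.m) K :=
  (1 : Matrix (Fin r) (Fin r) K).submatrix id σ.b

theorem rowSel_mul {o : Type*} (σ : Sel r) (A : Matrix (Fin r) o K) :
    rowSel K σ * A = A.submatrix σ.a id := by
  ext x y
  simp [rowSel, Matrix.mul_apply, Matrix.one_apply]

theorem mul_colSel {o : Type*} (σ : Sel r) (A : Matrix o (Fin r) K) :
    A * colSel K σ = A.submatrix id σ.b := by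
  ext x y
  simp [colSel, Matrix.mul_apply, Matrix.one_apply]

/-- The inverse of the selected submatrix, with its rows and columns put in their places. -/
noncomputable def placedInv (A : Matrix (Fin r) (Fin r) K) (σ : Sel r) :
    Matrix (Fin r) (Fin r) K :=
  colSel K σ * (A.submatrix σ.a σ.b)⁻¹ * rowSel K σ

/-- The Schur complement of the selected submatrix, extended by zeros. -/
noncomputable def schur (A : Matrix (Fin r) (Fin r) K) (σ : Sel r) : Matrix (Fin r) (Fin r) K :=
  A - A * placedInv A σ * A

/-- Nonsingularity of the selected submatrix. -/
def SelDet (A : Matrix (Fin r) (Fin r) K) (σ : Sel r) : Prop := (A.submatrix σ.a σ.b).det ≠ 0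

variable {A : Matrix (Fin r) (Fin r) K} {σ : Sel r}

theorem selDet_nil (A : Matrix (Fin r) (Fin r) K) : SelDet A (Sel.nil r) := by
  have : (A.submatrix (Sel.nil r).a (Sel.nil r).b).det = 1 :=
    Matrix.det_isEmpty (n := Fin 0)
  rw [SelDet, this]
  exact one_ne_zero

theorem placedInv_mul_colSel (h : SelDet A σ) : placedInv A σ * (A * colSel K σ) = colSel K σ := by
  rw [placedInv, Matrix.mul_assoc, rowSel_mul, mul_colSel, Matrix.submatrix_submatrix,
    Matrix.mul_assoc]
  erw [Matrix.nonsing_inv_mul _ (isUnit_iff_ne_zero.mpr h)]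
  rw [Matrix.mul_one]

/-- The Schur determinant formula for a minor bordered by one row and one column. It makes a nonzero
entry of the current array equivalent to a nonsingular larger selection. -/
theorem det_snoc (h : SelDet A σ) (i j : Fin r) :
    (A.submatrix (σ.snoc i j).a (σ.snoc i j).b).det =
      (A.submatrix σ.a σ.b).det * schur A σ i j := by
  have hu : IsUnit (A.submatrix σ.a σ.b) :=
    (Matrix.isUnit_iff_isUnit_det _).mpr (isUnit_iff_ne_zero.mpr h)
  let _ := hu.invertible
  let e : Fin σ.m ⊕ Fin 1 ≃ Fin (σ.m + 1) := finSumFinEquiv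
  let B : Matrix (Fin (σ.m + 1)) (Fin (σ.m + 1)) K := A.submatrix (σ.snoc i j).a (σ.snoc i j).b
  change B.det = _
  have hsub : B.submatrix e e =
      Matrix.fromBlocks (A.submatrix σ.a σ.b) (A.submatrix σ.a fun _ : Fin 1 => j)
        (A.submatrix (fun _ : Fin 1 => i) σ.b)
        (A.submatrix (fun _ : Fin 1 => i) (fun _ : Fin 1 => j)) := by
    have hl : ∀ x : Fin σ.m, e (Sum.inl x) = Fin.castSucc x := fun x => rfl
    have hr : ∀ x : Fin 1, e (Sum.inr x) = Fin.last σ.m := by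
      intro x
      ext
      simp [e]
    ext x y
    have hB : ∀ u v, B u v = A ((σ.snoc i j).a u) ((σ.snoc i j).b v) := fun u v => rfl
    rcases x with x | x <;> rcases y with y | y <;>
      simp [hl, hr, hB, Sel.snoc_a_castSucc, Sel.snoc_b_castSucc, Sel.snoc_a_last, Sel.snoc_b_last]
  rw [← Matrix.det_submatrix_equiv_self e, hsub, Matrix.det_fromBlocks₁₁]
  congr 1
  rw [Matrix.invOf_eq_nonsing_inv, schur, placedInv, ← Matrix.mul_assoc, ← Matrix.mul_assoc,
    mul_colSel, Matrix.mul_assoc _ (rowSel K σ), rowSel_mul]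
  exact Matrix.det_fin_one _

theorem selDet_snoc_iff (h : SelDet A σ) (i j : Fin r) :
    SelDet A (σ.snoc i j) ↔ schur A σ i j ≠ 0 := by
  rw [SelDet, det_snoc h]
  exact ⟨right_ne_zero_of_mul, mul_ne_zero h⟩

/-- The product `placedInv A σ * A` fixes the selected unit vectors, so `A` and `A * placedInv A σ *
A` agree in the selected columns. -/
theorem schur_apply_b (h : SelDet A σ) (x : Fin r) (t : Fin σ.m) : schur A σ x (σ.b t) = 0 := by
  have h1 := placedInv_mul_colSel h
  have h2 : schur A σ * colSel K σ = 0 := by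
    rw [schur, Matrix.sub_mul, Matrix.mul_assoc, Matrix.mul_assoc, h1, sub_self]
  rw [mul_colSel] at h2
  exact congrFun (congrFun h2 x) t

/-- The bordering step for the placed inverse. -/
theorem placedInv_snoc (h : SelDet A σ) {i j : Fin r} (hp : schur A σ i j ≠ 0) :
    placedInv A (σ.snoc i j) = placedInv A σ + (schur A σ i j)⁻¹ •
      Matrix.vecMulVec ((1 - placedInv A σ * A).col j) ((1 - A * placedInv A σ).row i) := by
  have h' : SelDet A (σ.snoc i j) := (selDet_snoc_iff h i j).mpr hp
  set p := schur A σ i j with hpdef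
  set W := placedInv A σ with hW
  set g := (1 - W * A).col j with hg
  set V := W + p⁻¹ • Matrix.vecMulVec g ((1 - A * W).row i) with hV
  have hVA : ∀ x y, (V * A) x y = (W * A) x y + p⁻¹ * (g x * schur A σ i y) := by
    intro x y
    rw [hV, Matrix.add_mul, Matrix.smul_mul, Matrix.vecMulVec_mul]
    have h1 : (1 - A * W).row i ᵥ* A = (schur A σ).row i := by
      have : (1 - A * W) * A = schur A σ := by
        rw [Matrix.sub_mul, Matrix.one_mul, schur]
      rw [← this]
      rfl
    rw [h1]
    simp [Matrix.vecMulVec_apply]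
  -- The placed inverse is determined by two properties: `V * A` fixes the selected unit columns,
  -- and `V` factors through the selected rows (`hX`). The candidate is shown to have both, so no
  -- block inverse has to be computed.
  have h1 : V * A * colSel K (σ.snoc i j) = colSel K (σ.snoc i j) := by
    rw [mul_colSel]
    have h0 := placedInv_mul_colSel h
    rw [← Matrix.mul_assoc, mul_colSel] at h0
    ext x t
    induction t using Fin.lastCases with
    | last =>
      change (V * A) x ((σ.snoc i j).b (Fin.last σ.m : Fin (σ.m + 1))) =
        (1 : Matrix (Fin r) (Fin r) K) x ((σ.snoc i j).b (Fin.last σ.m : Fin (σ.m + 1)))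
      rw [Sel.snoc_b_last, hVA, ← hpdef, hg]
      simp only [Matrix.col_apply, Matrix.sub_apply]
      field_simp
      ring
    | cast t =>
      change (V * A) x ((σ.snoc i j).b (Fin.castSucc t : Fin (σ.m + 1))) =
        (1 : Matrix (Fin r) (Fin r) K) x ((σ.snoc i j).b (Fin.castSucc t : Fin (σ.m + 1)))
      rw [Sel.snoc_b_castSucc, hVA, schur_apply_b h, mul_zero, mul_zero, add_zero]
      exact congrFun (congrFun h0 x) t
  obtain ⟨X, hX⟩ : ∃ X : Matrix (Fin r) (Fin (σ.snoc i j).m) K, V = X * rowSel K (σ.snoc i j) := by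
    let X₀ : Matrix (Fin r) (Fin σ.m) K := colSel K σ * (A.submatrix σ.a σ.b)⁻¹ -
      p⁻¹ • Matrix.vecMulVec g ((A * (colSel K σ * (A.submatrix σ.a σ.b)⁻¹)).row i)
    refine ⟨Matrix.of fun x => Fin.snoc (α := fun _ => K) (X₀ x) (p⁻¹ * g x), ?_⟩
    have hVX : V = X₀ * rowSel K σ + p⁻¹ • Matrix.vecMulVec g ((1 : Matrix _ _ K).row i) := by
      have hrow : (A * (colSel K σ * (A.submatrix σ.a σ.b)⁻¹)).row i ᵥ* rowSel K σ =
          (A * W).row i := by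
        rw [hW, placedInv, ← Matrix.mul_assoc A (colSel K σ * _)]
        rfl
      rw [Matrix.sub_mul, Matrix.smul_mul, Matrix.vecMulVec_mul, hrow, hV]
      have : (1 - A * W).row i = (1 : Matrix _ _ K).row i - (A * W).row i := rfl
      rw [this, Matrix.vecMulVec_sub, smul_sub, hW, placedInv]
      abel
    rw [hVX]
    ext x y
    have hsum := Fin.sum_univ_castSucc fun t : Fin (σ.m + 1) =>
      (Fin.snoc (α := fun _ => K) (X₀ x) (p⁻¹ * g x) : Fin (σ.m + 1) → K) t *
        rowSel K (σ.snoc i j) t y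
    refine Eq.trans ?_ hsum.symm
    have hc : ∀ t, rowSel K (σ.snoc i j) (Fin.castSucc t : Fin (σ.m + 1)) y = rowSel K σ t y :=
      fun t => by
        change (1 : Matrix (Fin r) (Fin r) K) _ y = (1 : Matrix (Fin r) (Fin r) K) _ y
        rw [Sel.snoc_a_castSucc]
    have hl : rowSel K (σ.snoc i j) (Fin.last σ.m : Fin (σ.m + 1)) y =
        (1 : Matrix (Fin r) (Fin r) K) i y := by
      change (1 : Matrix (Fin r) (Fin r) K) _ y = _
      rw [Sel.snoc_a_last]
    simp only [hc, hl, Fin.snoc_castSucc, Fin.snoc_last, Matrix.add_apply, Matrix.mul_apply,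
      Matrix.smul_apply, Matrix.vecMulVec_apply, Matrix.row_apply, smul_eq_mul, mul_assoc]
  rw [hX, Matrix.mul_assoc, Matrix.mul_assoc, mul_colSel, rowSel_mul,
    Matrix.submatrix_submatrix] at h1
  have h2 : X = colSel K (σ.snoc i j) *
      (A.submatrix (σ.snoc i j).a (σ.snoc i j).b)⁻¹ := by
    rw [← h1, Matrix.mul_assoc]
    erw [Matrix.mul_nonsing_inv _ (isUnit_iff_ne_zero.mpr h')]
    rw [Matrix.mul_one]
  rw [hX, h2, placedInv]

variable (h : SelDet A σ) {i j : Fin r} (hp : schur A σ i j ≠ 0)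
include h hp

/-- Up to sign, this and the following three formulas are the quadrants of a single pivot step on
the array with quadrants `schur`, `1 - AW`, `1 - WA`, `-W`, where `W` is the placed inverse. -/
theorem placedInv_snoc_apply (x y : Fin r) :
    placedInv A (σ.snoc i j) x y = placedInv A σ x y +
      (1 - placedInv A σ * A) x j * ((1 - A * placedInv A σ) i y / schur A σ i j) := by
  rw [placedInv_snoc h hp]
  simp [Matrix.vecMulVec_apply]
  ring

theorem placedInv_mul_snoc_apply (x y : Fin r) :
    (1 - placedInv A (σ.snoc i j) * A) x y = (1 - placedInv A σ * A) x y -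
      (1 - placedInv A σ * A) x j * (schur A σ i y / schur A σ i j) := by
  have h1 : (1 - A * placedInv A σ).row i ᵥ* A = (schur A σ).row i := by
    have : (1 - A * placedInv A σ) * A = schur A σ := by
      rw [Matrix.sub_mul, Matrix.one_mul, schur]
    rw [← this]
    rfl
  rw [placedInv_snoc h hp, Matrix.add_mul, Matrix.smul_mul, Matrix.vecMulVec_mul, h1]
  simp [Matrix.vecMulVec_apply]
  ring

theorem mul_placedInv_snoc_apply (x y : Fin r) :
    (1 - A * placedInv A (σ.snoc i j)) x y = (1 - A * placedInv A σ) x y -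
      schur A σ x j * ((1 - A * placedInv A σ) i y / schur A σ i j) := by
  have h1 : A *ᵥ (1 - placedInv A σ * A).col j = (schur A σ).col j := by
    have : A * (1 - placedInv A σ * A) = schur A σ := by
      rw [Matrix.mul_sub, Matrix.mul_one, schur, Matrix.mul_assoc]
    rw [← this]
    rfl
  rw [placedInv_snoc h hp, Matrix.mul_add, Matrix.mul_smul, Matrix.mul_vecMulVec, h1]
  simp [Matrix.vecMulVec_apply]
  ring

theorem schur_snoc_apply (x y : Fin r) :
    schur A (σ.snoc i j) x y = schur A σ x y - schur A σ x j * (schur A σ i y / schur A σ i j) := by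
  have h1 : ∀ τ : Sel r, schur A τ = A * (1 - placedInv A τ * A) := fun τ => by
    rw [Matrix.mul_sub, Matrix.mul_one, schur, Matrix.mul_assoc]
  have h2 : ∀ τ x y, schur A τ x y = ∑ w, A x w * (1 - placedInv A τ * A) w y := fun τ x y => by
    rw [h1, Matrix.mul_apply]
  rw [h2 (σ.snoc i j), h2 σ x y, h2 σ x j, Finset.sum_mul, ← Finset.sum_sub_distrib]
  refine Finset.sum_congr rfl fun w _ => ?_
  rw [placedInv_mul_snoc_apply h hp]
  ring

omit h hp

theorem selDet_selRun (A : Matrix (Fin r) (Fin r) K) (t : ℕ) : SelDet A (selRun (SelDet A) t) :=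
  selRun_holds (selDet_nil A) t

/-- A row without a pivot was already zero; a row with a pivot is cleared by it. Later pivots
subtract multiples with factors taken from the row itself, so zero rows stay zero. -/
theorem schur_selRun_row (A : Matrix (Fin r) (Fin r) K) (t : ℕ) (ht : t ≤ r) (i : Fin r)
    (hi : (i : ℕ) < t) (y : Fin r) : schur A (selRun (SelDet A) t) i y = 0 := by
  induction t generalizing i y with
  | zero => omega
  | succ t ih =>
    have hdet := selDet_selRun A t
    rw [show t + 1 = ((⟨t, ht⟩ : Fin r) : ℕ) + 1 from rfl, selRun_succ]
    rcases selStep_cases (SelDet A) ⟨t, ht⟩ (selRun (SelDet A) t) with ⟨h1, hno⟩ | ⟨j, h1, hT, -⟩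
    · simp only [h1]
      rcases Nat.lt_succ_iff_lt_or_eq.mp hi with hlt | heq
      · exact ih (by omega) i hlt y
      · have : i = ⟨t, ht⟩ := Fin.ext heq
        rw [this]
        have := hno y
        rw [selDet_snoc_iff hdet] at this
        exact not_not.mp this
    · simp only [h1]
      have hp := (selDet_snoc_iff hdet _ _).mp hT
      rw [schur_snoc_apply hdet hp]
      rcases Nat.lt_succ_iff_lt_or_eq.mp hi with hlt | heq
      · rw [ih (by omega) i hlt y, ih (by omega) i hlt j]
        simp
      · have : i = ⟨t, ht⟩ := Fin.ext heq
        rw [this]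
        field_simp
        ring

/-- A nonsingular submatrix cannot be larger than the rank. Conversely, the Schur complement is zero
at the end, so `A` factors through a space whose dimension is the number of pivots. -/
theorem selRun_m_eq_rank (A : Matrix (Fin r) (Fin r) K) : (selRun (SelDet A) r).m = A.rank := by
  set σ := selRun (SelDet A) r with hσ
  have hdet : SelDet A σ := selDet_selRun A r
  apply le_antisymm
  · have h1 := Matrix.rank_of_det_ne_zero hdet
    rw [Fintype.card_fin] at h1
    have h2 : rowSel K σ * (A * colSel K σ) = A.submatrix σ.a σ.b := by
      rw [mul_colSel, rowSel_mul, Matrix.submatrix_submatrix]; rfl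
    rw [← h1, ← h2]
    exact (Matrix.rank_mul_le_right _ _).trans (Matrix.rank_mul_le_left _ _)
  · have h0 : schur A σ = 0 := by
      ext i y
      exact schur_selRun_row A r le_rfl i i.2 y
    rw [schur, sub_eq_zero] at h0
    rw [h0, placedInv]
    refine ((Matrix.rank_mul_le_left _ _).trans (Matrix.rank_mul_le_right _ _)).trans
      ((Matrix.rank_mul_le_left _ _).trans ((Matrix.rank_mul_le_left _ _).trans ?_))
    simpa using Matrix.rank_le_width (colSel K σ)

end Elimination

end MatInt

namespace MatInt

open scoped Matrix

/-! ### Determinants as polynomials in `z` and the generic scan -/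

noncomputable section Generic

variable {K : Type*} [Field K] {n k r : ℕ}

/-- The determinant of `Z(J)` as a polynomial in the entries of `z`. -/
def zPoly (Q₁ : Matrix (Fin k) (Fin n) K) (Q₂ : Matrix (Fin n) (Fin k) K) (J : Finset (Fin n)) :
    MvPolynomial (Fin n) K :=
  (bordered (Q₁.map (MvPolynomial.C : K →+* MvPolynomial (Fin n) K))
    (Q₂.map (MvPolynomial.C : K →+* MvPolynomial (Fin n) K))
    (fun i => if i ∈ J then 0 else MvPolynomial.X i)).det

variable (Q₁ : Matrix (Fin k) (Fin n) K) (Q₂ : Matrix (Fin n) (Fin k) K)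

theorem ringHom_zPoly {L : Type*} [CommRing L] (f : MvPolynomial (Fin n) K →+* L)
    (J : Finset (Fin n)) :
    f (zPoly Q₁ Q₂ J) = (bordered (Q₁.map (f.comp MvPolynomial.C)) (Q₂.map (f.comp MvPolynomial.C))
      (fun i => if i ∈ J then 0 else f (MvPolynomial.X i))).det := by
  rw [zPoly, map_det_bordered, Matrix.map_map, Matrix.map_map]
  congr 2
  funext i
  split_ifs <;> simp

theorem eval_zPoly (z : Fin n → K) (J : Finset (Fin n)) :
    MvPolynomial.eval z (zPoly Q₁ Q₂ J) = (Z Q₁ Q₂ z J).det := by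
  rw [ringHom_zPoly, Z_eq_bordered]
  have : (MvPolynomial.eval z).comp MvPolynomial.C = RingHom.id K := by
    ext x; simp
  rw [this]
  congr 2
  funext i
  simp

/-- Variables occur only in the `n` columns of the second kind, with degree at most one in each
entry, so each product in the Leibniz formula has degree at most `n`. -/
theorem totalDegree_zPoly_le (J : Finset (Fin n)) : (zPoly Q₁ Q₂ J).totalDegree ≤ n := by
  rw [zPoly, Matrix.det_apply]
  refine MvPolynomial.totalDegree_finsetSum_le fun σ _ => ?_
  refine le_trans ?_ (le_trans (MvPolynomial.totalDegree_finsetProd Finset.univ fun i =>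
    bordered (Q₁.map (MvPolynomial.C : K →+* MvPolynomial (Fin n) K))
    (Q₂.map (MvPolynomial.C : K →+* MvPolynomial (Fin n) K))
    (fun i => if i ∈ J then 0 else MvPolynomial.X i) (σ i) i) ?_)
  · rcases Int.units_eq_one_or (Equiv.Perm.sign σ) with h | h <;> rw [h]
    · simp
    · simp
  · rw [Fintype.sum_sum_type]
    have h1 : ∀ (x : Fin k ⊕ Fin n) (s : Fin k),
        (bordered (Q₁.map (MvPolynomial.C : K →+* MvPolynomial (Fin n) K))
        (Q₂.map (MvPolynomial.C : K →+* MvPolynomial (Fin n) K))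
        (fun i => if i ∈ J then 0 else MvPolynomial.X i) x (Sum.inl s)).totalDegree = 0 := by
      rintro (x | x) s <;> simp [bordered]
    have h2 : ∀ (x : Fin k ⊕ Fin n) (s : Fin n),
        (bordered (Q₁.map (MvPolynomial.C : K →+* MvPolynomial (Fin n) K))
        (Q₂.map (MvPolynomial.C : K →+* MvPolynomial (Fin n) K))
        (fun i => if i ∈ J then 0 else MvPolynomial.X i) x (Sum.inr s)).totalDegree ≤ 1 := by
      rintro (x | x) s
      · simp [bordered]
      · simp only [bordered, Matrix.fromBlocks_apply₂₂, Matrix.diagonal_apply]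
        split_ifs <;> simp
    simp only [h1, Finset.sum_const_zero, zero_add]
    exact (Finset.sum_le_sum fun i _ => h2 _ i).trans (by simp)

/-- Setting the variables in `J'` to zero turns the polynomial of `J` into that of `J'`. -/
theorem zPoly_ne_zero_of_subset {J J' : Finset (Fin n)} (hJ : J ⊆ J') (h : zPoly Q₁ Q₂ J' ≠ 0) :
    zPoly Q₁ Q₂ J ≠ 0 := by
  intro h0
  apply h
  have := ringHom_zPoly Q₁ Q₂ (MvPolynomial.eval₂Hom (MvPolynomial.C : K →+* MvPolynomial (Fin n) K)
    (fun i => if i ∈ J' then 0 else MvPolynomial.X i)) J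
  rw [h0, map_zero] at this
  rw [zPoly]
  refine Eq.trans ?_ this.symm
  have hc : (MvPolynomial.eval₂Hom (MvPolynomial.C : K →+* MvPolynomial (Fin n) K)
      (fun i => if i ∈ J' then 0 else MvPolynomial.X i)).comp MvPolynomial.C =
      MvPolynomial.C := by
    ext x; simp
  rw [hc]
  congr 2
  funext i
  by_cases hi : i ∈ J
  · simp [hi, hJ hi]
  · simp [hi]

/-- The expansion by columns over the polynomial ring yields a nonzero determinant with constant
entries, hence one over `K`, and an `I` that contains `J` because the diagonal is zero there. The
polynomial of `I` is nonzero since its value at the all-ones vector is. -/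
theorem exists_base_of_zPoly_ne_zero {J : Finset (Fin n)} (h : zPoly Q₁ Q₂ J ≠ 0) :
    ∃ I, J ⊆ I ∧ k ≤ I.card ∧ zPoly Q₁ Q₂ I ≠ 0 := by
  obtain ⟨I, hI, hdet⟩ := exists_det_scaledBordered_ne_zero _ _ _ h
  have hK : (scaledBordered Q₁ Q₂ (fun i => if i ∈ I then 1 else 0)
        (fun i => if i ∈ I then 0 else 1)).det ≠ 0 := by
    intro h0
    apply hdet
    have := map_det_bordered (MvPolynomial.C : K →+* MvPolynomial (Fin n) K)
      (Matrix.of fun s i => (if i ∈ I then 1 else 0) * Q₁ s i) Q₂ (fun i => if i ∈ I then 0 else 1)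
    rw [← scaledBordered, h0, map_zero] at this
    rw [scaledBordered]
    refine Eq.trans ?_ this.symm
    congr 2
    · ext1 s i
      simp only [Matrix.of_apply, Matrix.map_apply]
      split_ifs <;> simp
    · funext i
      split_ifs <;> simp
  obtain ⟨hcard, hdet⟩ := det_bordered_of_det_scaledBordered hK
  refine ⟨I, fun i hi => hI i (by simp [hi]), hcard, fun h0 => hdet ?_⟩
  have := eval_zPoly Q₁ Q₂ (fun _ => 1) I
  rw [h0, map_zero, Z_eq_bordered] at this
  exact this.symm

open Classical in
/-- The greedy scan of all elements with acceptance test `T`. -/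
def scanSet (T : Finset (Fin n) → Prop) : ℕ → Finset (Fin n)
  | 0 => ∅
  | t + 1 =>
    if h : t < n then
      if T (insert ⟨t, h⟩ (scanSet T t)) then insert ⟨t, h⟩ (scanSet T t) else scanSet T t
    else scanSet T t

theorem scanSet_mono (T : Finset (Fin n) → Prop) {t u : ℕ} (h : t ≤ u) :
    scanSet T t ⊆ scanSet T u := by
  induction u, h using Nat.le_induction with
  | base => rfl
  | succ u _ ih =>
    rw [scanSet]
    split_ifs
    · exact ih.trans (Finset.subset_insert _ _)
    · exact ih
    · exact ih

theorem scanSet_holds {T : Finset (Fin n) → Prop} (h0 : T ∅) (t : ℕ) : T (scanSet T t) := by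
  induction t with
  | zero => exact h0
  | succ t ih =>
    rw [scanSet]
    split_ifs with _ h
    · exact h
    · exact ih
    · exact ih

/-- To compare a stronger test with a weaker one, only the sets that the weaker one actually
produces must be accepted. Thus `n` polynomials suffice for the scan, rather than one for each
subset. -/
theorem scanSet_congr {T T' : Finset (Fin n) → Prop} (hTT' : ∀ J, T J → T' J) (t : ℕ)
    (h : ∀ i : ℕ, i < t → T (scanSet T' (i + 1))) : scanSet T t = scanSet T' t := by
  induction t with
  | zero => rfl
  | succ t ih =>
    have ih' := ih fun i hi => h i (hi.trans (Nat.lt_succ_self _))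
    have ht := h t (Nat.lt_succ_self _)
    rw [scanSet] at ht ⊢
    rw [scanSet, ih']
    by_cases htn : t < n
    · simp only [dif_pos htn] at ht ⊢
      by_cases h1 : T' (insert ⟨t, htn⟩ (scanSet T' t))
      · rw [if_pos h1] at ht ⊢
        rw [if_pos ht]
      · rw [if_neg h1, if_neg fun h2 => h1 (hTT' _ h2)]
    · rw [dif_neg htn, dif_neg htn]

theorem algState_J_eq_scanSet {Q₁ : Matrix (Fin k) (Fin n) K} {Q₂ : Matrix (Fin n) (Fin k) K}
    {z : Fin n → K} (hz : ∀ i, z i ≠ 0) (hdet : (Y₀ Q₁ Q₂ z).det ≠ 0) (t : ℕ) :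
    (algState r Q₁ Q₂ z t).J = scanSet (fun J => (Z Q₁ Q₂ z J).det ≠ 0) t := by
  induction t with
  | zero => rfl
  | succ t ih =>
    by_cases ht : t < n
    · have := algState_succ_J (r := r) hz hdet ⟨t, ht⟩
      rw [scanSet, dif_pos ht]
      simp only at this
      rw [this, ih]
      split_ifs <;> rfl
    · rw [algState, scanSet, dif_neg ht, dif_neg ht, ih]

/-- The final set extends to some `I` with at least `k` elements. When an element of `I` was
scanned, the current set together with it was a subset of `I`, hence acceptable; so all of `I` was
taken. -/
theorem card_scanSet_zPoly (h : zPoly Q₁ Q₂ ∅ ≠ 0) :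
    k ≤ (scanSet (fun J => zPoly Q₁ Q₂ J ≠ 0) n).card := by
  obtain ⟨I, hI, hcard, hne⟩ := exists_base_of_zPoly_ne_zero Q₁ Q₂
    (scanSet_holds (T := fun J => zPoly Q₁ Q₂ J ≠ 0) h n)
  refine hcard.trans (Finset.card_le_card fun i hi => ?_)
  refine scanSet_mono _ (show (i : ℕ) + 1 ≤ n from i.2) ?_
  rw [scanSet, dif_pos i.2, if_pos]
  · exact Finset.mem_insert_self _ _
  · refine zPoly_ne_zero_of_subset Q₁ Q₂ (Finset.insert_subset hi ?_) hne
    exact (scanSet_mono _ i.2.le).trans hI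

end Generic

/-! ### The output of the algorithm and its generic counterpart -/

noncomputable section Output

variable {K : Type*} [Field K] {n r : ℕ} (Q₁ : Matrix (Fin r) (Fin n) K)
  (Q₂ : Matrix (Fin n) (Fin r) K)

theorem Y₀_submatrix {k : ℕ} (z : Fin n → K) (a b : Fin k → Fin r) :
    Y₀ (Q₁.submatrix a id) (Q₂.submatrix id b) z = (Y₀ Q₁ Q₂ z).submatrix a b := by
  ext x y
  simp [Y₀, mul_diagonal_mul_apply]

/-- The polynomial `det Z(J)` for the restricted matrices. -/
def selPoly (σ : Sel r) (J : Finset (Fin n)) : MvPolynomial (Fin n) K :=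
  zPoly (Q₁.submatrix σ.a id) (Q₂.submatrix id σ.b) J

/-- The selection made by the elimination. -/
def outSel (z : Fin n → K) : Sel r := selRun (SelDet (Y₀ Q₁ Q₂ z)) r

/-- The result of the scan after the elimination. -/
def outSet (z : Fin n → K) : Finset (Fin n) :=
  (algState r (Q₁.submatrix (outSel Q₁ Q₂ z).a id) (Q₂.submatrix id (outSel Q₁ Q₂ z).b) z n).J

variable {Q₁ Q₂} {z : Fin n → K}

theorem selDet_iff_eval (hz : ∀ i, z i ≠ 0) (σ : Sel r) :
    SelDet (Y₀ Q₁ Q₂ z) σ ↔ MvPolynomial.eval z (selPoly Q₁ Q₂ σ ∅) ≠ 0 := by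
  rw [selPoly, eval_zPoly, det_Z_empty hz, SelDet, Y₀_submatrix]
  exact ⟨mul_ne_zero (Finset.prod_ne_zero_iff.mpr fun i _ => hz i), right_ne_zero_of_mul⟩

theorem selDet_outSel (Q₁ : Matrix (Fin r) (Fin n) K) (Q₂ : Matrix (Fin n) (Fin r) K)
    (z : Fin n → K) : SelDet (Y₀ Q₁ Q₂ z) (outSel Q₁ Q₂ z) := selDet_selRun _ _

theorem det_Y₀_outSel (Q₁ : Matrix (Fin r) (Fin n) K) (Q₂ : Matrix (Fin n) (Fin r) K)
    (z : Fin n → K) :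
    (Y₀ (Q₁.submatrix (outSel Q₁ Q₂ z).a id) (Q₂.submatrix id (outSel Q₁ Q₂ z).b) z).det ≠ 0 := by
  rw [Y₀_submatrix]
  exact selDet_outSel Q₁ Q₂ z

theorem isAlgOutput_outSet (Q₁ : Matrix (Fin r) (Fin n) K) (Q₂ : Matrix (Fin n) (Fin r) K)
    (z : Fin n → K) : IsAlgOutput Q₁ Q₂ z (outSet Q₁ Q₂ z) := by
  have hm : (outSel Q₁ Q₂ z).m = (Y₀ Q₁ Q₂ z).rank := selRun_m_eq_rank _
  have hdet := selDet_outSel Q₁ Q₂ z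
  rw [IsAlgOutput, outSet]
  -- The types of the row and column choices depend on the number of pivots, which can be replaced
  -- by the rank only once the selection is a variable.
  generalize outSel Q₁ Q₂ z = σ at hm hdet
  obtain ⟨m, a, b⟩ := σ
  simp only at hm
  subst hm
  exact ⟨a, b, hdet, rfl⟩

theorem outSet_eq_scanSet (hz : ∀ i, z i ≠ 0) :
    outSet Q₁ Q₂ z = scanSet
      (fun J => MvPolynomial.eval z (selPoly Q₁ Q₂ (outSel Q₁ Q₂ z) J) ≠ 0) n := by
  rw [outSet, algState_J_eq_scanSet hz (det_Y₀_outSel Q₁ Q₂ z)]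
  simp only [selPoly, eval_zPoly]

theorem outSel_eq_selRun (hz : ∀ i, z i ≠ 0) :
    outSel Q₁ Q₂ z = selRun (fun σ => MvPolynomial.eval z (selPoly Q₁ Q₂ σ ∅) ≠ 0) r := by
  rw [outSel]
  congr 1
  funext σ
  exact propext (selDet_iff_eval hz σ)

theorem outSet_linearIndepOn (hz : ∀ i, z i ≠ 0) :
    LinearIndepOn K Q₁.col (outSet Q₁ Q₂ z : Set (Fin n)) ∧
      LinearIndepOn K Q₂.row (outSet Q₁ Q₂ z : Set (Fin n)) := by
  have h := (scanInv_algState (r := r) hz (det_Y₀_outSel Q₁ Q₂ z) n le_rfl).det_ne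
  obtain ⟨h1, h2⟩ := linearIndepOn_of_det_Z h
  -- Restriction to the selected coordinates is linear, so independence of the restricted vectors
  -- implies that of the full ones.
  exact ⟨LinearIndepOn.of_comp (LinearMap.funLeft K K (outSel Q₁ Q₂ z).a) h1,
    LinearIndepOn.of_comp (LinearMap.funLeft K K (outSel Q₁ Q₂ z).b) h2⟩

variable (Q₁ Q₂)

/-- The selection made with generic values. -/
def genSel : Sel r := selRun (fun σ => selPoly Q₁ Q₂ σ ∅ ≠ 0) r

/-- The result of the scan with generic values. -/
def genSet : Finset (Fin n) := scanSet (fun J => selPoly Q₁ Q₂ (genSel Q₁ Q₂) J ≠ 0) n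

/-- The polynomials that must not vanish for a run to agree with the generic run. -/
def goodPoly (t : ℕ) : MvPolynomial (Fin n) K :=
  if t < r then selPoly Q₁ Q₂ (selRun (fun σ => selPoly Q₁ Q₂ σ ∅ ≠ 0) (t + 1)) ∅
  else selPoly Q₁ Q₂ (genSel Q₁ Q₂)
    (scanSet (fun J => selPoly Q₁ Q₂ (genSel Q₁ Q₂) J ≠ 0) (t - r + 1))

theorem selPoly_nil_ne_zero : selPoly Q₁ Q₂ (Sel.nil r) ∅ ≠ 0 := by
  intro h
  have h1 := (selDet_iff_eval (Q₁ := Q₁) (Q₂ := Q₂) (z := fun _ => 1) (by simp) (Sel.nil r)).mp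
    (selDet_nil _)
  rw [h, map_zero] at h1
  exact h1 rfl

theorem selPoly_genSel_ne_zero : selPoly Q₁ Q₂ (genSel Q₁ Q₂) ∅ ≠ 0 :=
  selRun_holds (T := fun σ => selPoly Q₁ Q₂ σ ∅ ≠ 0) (selPoly_nil_ne_zero Q₁ Q₂) r

theorem goodPoly_ne_zero (t : ℕ) : goodPoly Q₁ Q₂ t ≠ 0 := by
  rw [goodPoly]
  split_ifs
  · exact selRun_holds (T := fun σ => selPoly Q₁ Q₂ σ ∅ ≠ 0) (selPoly_nil_ne_zero Q₁ Q₂) _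
  · exact scanSet_holds (T := fun J => selPoly Q₁ Q₂ (genSel Q₁ Q₂) J ≠ 0)
      (selPoly_genSel_ne_zero Q₁ Q₂) _

theorem totalDegree_goodPoly_le (t : ℕ) : (goodPoly Q₁ Q₂ t).totalDegree ≤ n := by
  rw [goodPoly]
  split_ifs <;> exact totalDegree_zPoly_le _ _ _

/-- A polynomial with a nonzero value is nonzero, so the test by values is the stronger one and both
comparison lemmas apply. The selections are compared first because the polynomials of the scan
depend on the selection. -/
theorem outSet_eq_genSet (hz : ∀ i, z i ≠ 0)
    (h : ∀ t < r + n, MvPolynomial.eval z (goodPoly Q₁ Q₂ t) ≠ 0) :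
    outSet Q₁ Q₂ z = genSet Q₁ Q₂ := by
  have hne : ∀ p : MvPolynomial (Fin n) K, MvPolynomial.eval z p ≠ 0 → p ≠ 0 := by
    rintro p hp rfl
    exact hp (map_zero _)
  have hsel : outSel Q₁ Q₂ z = genSel Q₁ Q₂ := by
    rw [outSel_eq_selRun hz, genSel]
    refine selRun_congr (fun σ => hne _) r fun i hi => ?_
    have := h i (by omega)
    rwa [goodPoly, if_pos hi] at this
  rw [outSet_eq_scanSet hz, hsel, genSet]
  refine scanSet_congr (fun J => hne _) n fun i hi => ?_
  have := h (r + i) (by omega)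
  rwa [goodPoly, if_neg (by omega), Nat.add_sub_cancel_left] at this

/-- With the variables as values in a field `L`, generic tests become nonsingularity over `L`, so
that rank arguments become available. -/
theorem det_Y₀_map_ne_zero_iff {L : Type*} [Field L] (f : MvPolynomial (Fin n) K →+* L)
    (hf : Function.Injective f) {k : ℕ} (P₁ : Matrix (Fin k) (Fin n) K)
    (P₂ : Matrix (Fin n) (Fin k) K) :
    (Y₀ (P₁.map (f.comp MvPolynomial.C)) (P₂.map (f.comp MvPolynomial.C))
      (fun i => f (MvPolynomial.X i))).det ≠ 0 ↔ zPoly P₁ P₂ ∅ ≠ 0 := by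
  have hx : ∀ i, f (MvPolynomial.X i) ≠ 0 := fun i => by
    rw [← map_zero f]
    exact hf.ne (MvPolynomial.X_ne_zero i)
  have h' : f (zPoly P₁ P₂ ∅) = (Z (P₁.map (f.comp MvPolynomial.C)) (P₂.map (f.comp MvPolynomial.C))
      (fun i => f (MvPolynomial.X i)) ∅).det := ringHom_zPoly P₁ P₂ f ∅
  rw [det_Z_empty hx] at h'
  rw [← hf.ne_iff, h', map_zero, mul_ne_zero_iff]
  exact ⟨fun h => ⟨Finset.prod_ne_zero_iff.mpr fun i _ => hx i, h⟩, fun h => h.2⟩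

theorem genSel_m_eq_rank {L : Type*} [Field L] (f : MvPolynomial (Fin n) K →+* L)
    (hf : Function.Injective f) :
    (genSel Q₁ Q₂).m = (Y₀ (Q₁.map (f.comp MvPolynomial.C)) (Q₂.map (f.comp MvPolynomial.C))
      (fun i => f (MvPolynomial.X i))).rank := by
  rw [← selRun_m_eq_rank, genSel]
  congr 2
  funext σ
  rw [SelDet, ← Y₀_submatrix, Matrix.submatrix_map, Matrix.submatrix_map,
    det_Y₀_map_ne_zero_iff f hf, selPoly]

/-- Left inverses of the independent columns and rows in `I` turn both restrictions to `I` into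
identity matrices. Then `Z(I)` with all values one is nonsingular, and the polynomial of the smaller
set `∅` is nonzero too. -/
theorem exists_zPoly_ne_zero {I : Finset (Fin n)} {k : ℕ} (e : Fin k ≃ I)
    (h1 : LinearIndepOn K Q₁.col (I : Set (Fin n)))
    (h2 : LinearIndepOn K Q₂.row (I : Set (Fin n))) :
    ∃ (L₁ : Matrix (Fin k) (Fin r) K) (L₂ : Matrix (Fin r) (Fin k) K),
      zPoly (L₁ * Q₁) (Q₂ * L₂) ∅ ≠ 0 := by
  have h1' : LinearIndependent K (Q₁.submatrix id (fun i => (e i : Fin n))).col :=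
    LinearIndependent.comp h1 e e.injective
  have h2' : LinearIndependent K (Q₂ᵀ.submatrix id (fun i => (e i : Fin n))).col :=
    LinearIndependent.comp h2 e e.injective
  obtain ⟨L₁, hL₁⟩ := exists_leftInverse_of_linearIndependent _ h1'
  obtain ⟨L₂, hL₂⟩ := exists_leftInverse_of_linearIndependent _ h2'
  refine ⟨L₁, L₂ᵀ, ?_⟩
  refine zPoly_ne_zero_of_subset _ _ (Finset.empty_subset I) fun h0 => ?_
  have h3 := eval_zPoly (L₁ * Q₁) (Q₂ * L₂ᵀ) (fun _ => 1) I
  rw [h0, map_zero, Z_eq_bordered] at h3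
  refine det_bordered_of_submatrix_eq_one e ?_ ?_ h3.symm
  · rw [← hL₁]
    ext u v
    simp [Matrix.mul_apply]
  · rw [← Matrix.transpose_one, ← hL₂, Matrix.transpose_mul]
    ext u v
    simp [Matrix.mul_apply]

/-- The product `L₁ Y L₂` is nonsingular of size `|I|`, and multiplication cannot raise the rank; so
the generic rank of `Y`, which is the number of generic pivots, is at least `|I|`. -/
theorem card_le_genSel_m {I : Finset (Fin n)} (h1 : LinearIndepOn K Q₁.col (I : Set (Fin n)))
    (h2 : LinearIndepOn K Q₂.row (I : Set (Fin n))) {L : Type*} [Field L]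
    (f : MvPolynomial (Fin n) K →+* L) (hf : Function.Injective f) :
    I.card ≤ (genSel Q₁ Q₂).m := by
  rw [genSel_m_eq_rank Q₁ Q₂ f hf]
  obtain ⟨L₁, L₂, hz⟩ := exists_zPoly_ne_zero Q₁ Q₂ I.equivFin.symm h1 h2
  have hrank := Matrix.rank_of_det_ne_zero ((det_Y₀_map_ne_zero_iff f hf _ _).mpr hz)
  rw [Fintype.card_fin] at hrank
  refine hrank.symm.le.trans ?_
  generalize f.comp MvPolynomial.C = g
  generalize (fun i => f (MvPolynomial.X i)) = x
  have hfac : Y₀ ((L₁ * Q₁).map g) ((Q₂ * L₂).map g) x =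
      L₁.map g * (Y₀ (Q₁.map g) (Q₂.map g) x * L₂.map g) := by
    rw [Y₀, Y₀, Matrix.map_mul, Matrix.map_mul]
    simp only [Matrix.neg_mul, Matrix.mul_neg, Matrix.mul_assoc]
  rw [hfac]
  exact (Matrix.rank_mul_le_right _ _).trans (Matrix.rank_mul_le_left _ _)

/-- The generic run finds at least as many elements as any common independent set has. -/
theorem card_le_card_genSet {I : Finset (Fin n)} (h1 : LinearIndepOn K Q₁.col (I : Set (Fin n)))
    (h2 : LinearIndepOn K Q₂.row (I : Set (Fin n))) : I.card ≤ (genSet Q₁ Q₂).card :=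
  (card_le_genSel_m Q₁ Q₂ h1 h2
    (algebraMap _ (FractionRing (MvPolynomial (Fin n) K))) (IsFractionRing.injective _ _)).trans
    (card_scanSet_zPoly _ _ (selPoly_genSel_ne_zero Q₁ Q₂))

end Output

end MatInt

namespace MatInt

open scoped Matrix

/-! ### Error probability -/

noncomputable section Randomness

variable {K : Type*} [Field K] {n r : ℕ}

/-- A union bound over `m` applications of the Schwartz–Zippel lemma. -/
theorem probability_le_sum {S : Finset K} (hS : S.Nonempty) {m d : ℕ}
    (P : ℕ → MvPolynomial (Fin n) K) (hP : ∀ t, P t ≠ 0) (hd : ∀ t, (P t).totalDegree ≤ d)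
    (bad : (Fin n → K) → Prop)
    (h : ∀ z ∈ Fintype.piFinset fun _ : Fin n => S, bad z →
      ∃ t < m, MvPolynomial.eval z (P t) = 0) :
    probability S bad ≤ m * d / S.card := by
  classical
  have hsub : (Fintype.piFinset fun _ : Fin n => S).filter bad ⊆
      (Finset.range m).biUnion fun t =>
        (Fintype.piFinset fun _ : Fin n => S).filter fun z => MvPolynomial.eval z (P t) = 0 := by
    intro z hz
    obtain ⟨hz, hb⟩ := Finset.mem_filter.mp hz
    obtain ⟨t, ht, h0⟩ := h z hz hb
    exact Finset.mem_biUnion.mpr ⟨t, Finset.mem_range.mpr ht, Finset.mem_filter.mpr ⟨hz, h0⟩⟩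
  have hSpos : (0 : ℝ) < S.card := by exact_mod_cast hS.card_pos
  have hone : ∀ t, (((Fintype.piFinset fun _ : Fin n => S).filter
      fun z => MvPolynomial.eval z (P t) = 0).card : ℝ) / (S.card : ℝ) ^ n ≤ d / S.card := by
    intro t
    have hsz := MvPolynomial.schwartz_zippel_totalDegree (hP t) S
    have hsz' : ((((Fintype.piFinset fun _ : Fin n => S).filter
        fun z => MvPolynomial.eval z (P t) = 0).card : ℝ)) / (S.card : ℝ) ^ n ≤
        (P t).totalDegree / S.card := by
      have := (NNRat.cast_le (K := ℝ)).mpr hsz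
      push_cast at this
      convert this
    refine hsz'.trans ?_
    gcongr
    exact hd t
  calc probability S bad
      ≤ (∑ t ∈ Finset.range m, (((Fintype.piFinset fun _ : Fin n => S).filter
          fun z => MvPolynomial.eval z (P t) = 0).card : ℝ)) / (S.card : ℝ) ^ n := by
        rw [probability]
        gcongr
        refine le_trans (Nat.cast_le.mpr ?_)
          ((Nat.cast_le (α := ℝ)).mpr (Finset.card_biUnion_le (s := Finset.range m)
            (t := fun t => (Fintype.piFinset fun _ : Fin n => S).filter
              fun z => MvPolynomial.eval z (P t) = 0)) |>.trans ?_)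
        · convert Finset.card_le_card hsub
        · push_cast
          rfl
    _ ≤ ∑ t ∈ Finset.range m, (d : ℝ) / S.card := by
        rw [Finset.sum_div]
        exact Finset.sum_le_sum fun t _ => hone t
    _ = m * d / S.card := by
        rw [Finset.sum_const, Finset.card_range, nsmul_eq_mul]
        ring

theorem solvesMatroidIntersection_of_outputs_outSet {F : Type*} [Field F] [Algebra F K]
    {p : Prog} {T : ℝ} (hrn : r ≤ n)
    (hp : ∀ (Q₁ : Matrix (Fin r) (Fin n) K) (Q₂ : Matrix (Fin n) (Fin r) K) (z : Fin n → K),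
      (∀ i, z i ≠ 0) → ∀ s : State K, HoldsInput Q₁ Q₂ z s →
        HaltsWithin p s T (fun s' => outputSet n s' = outSet Q₁ Q₂ z)) :
    SolvesMatroidIntersection p F K n r T 2 := by
  intro P₁ P₂ M₁ M₂ hM₁ hM₂
  set Q₁ := P₁.map (algebraMap F K) with hQ₁
  set Q₂ := P₂.map (algebraMap F K) with hQ₂
  -- Linear independence over `F` is unaffected by passing to the extension field `K`.
  have hind₁ : ∀ I : Set (Fin n), M₁.Indep I ↔ LinearIndepOn K Q₁.col I := fun I => by
    rw [hM₁.2]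
    exact (linearIndependent_algebraMap_comp_iff (S := K)).symm
  have hind₂ : ∀ I : Set (Fin n), M₂.Indep I ↔ LinearIndepOn K Q₂.row I := fun I => by
    rw [hM₂.2]
    exact (linearIndependent_algebraMap_comp_iff (S := K)).symm
  refine ⟨fun z hz s hs => ?_, fun S hS h0 => ?_⟩
  · obtain ⟨t, s', hrun, ht, hout⟩ := hp Q₁ Q₂ z hz s hs
    exact ⟨t, s', hrun, ht, by
      change IsAlgOutput Q₁ Q₂ z (outputSet n s')
      rw [hout]
      exact isAlgOutput_outSet Q₁ Q₂ z⟩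
  · refine (probability_le_sum (m := r + n) hS (goodPoly Q₁ Q₂) (goodPoly_ne_zero Q₁ Q₂)
      (totalDegree_goodPoly_le Q₁ Q₂) _ ?_).trans ?_
    · intro z hzS hbad
      have hz : ∀ i, z i ≠ 0 := fun i hi =>
        h0 (hi ▸ Fintype.mem_piFinset.mp hzS i)
      by_contra hne
      push Not at hne
      refine hbad fun s hs => ?_
      obtain ⟨t, s', hrun, ht, hout⟩ := hp Q₁ Q₂ z hz s hs
      refine ⟨t, s', hrun, ht, ?_⟩
      obtain ⟨h1, h2⟩ := outSet_linearIndepOn (Q₁ := Q₁) (Q₂ := Q₂) hz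
      rw [hout]
      refine ⟨⟨(hind₁ _).mpr h1, (hind₂ _).mpr h2⟩, fun J' hJ' => ?_⟩
      rw [outSet_eq_genSet Q₁ Q₂ hz hne]
      exact card_le_card_genSet Q₁ Q₂ ((hind₁ _).mp hJ'.1) ((hind₂ _).mp hJ'.2)
    -- The error constant: `(r + n) * n ≤ 2 * n ^ 2`.
    · have h1 : (r : ℝ) ≤ n := by exact_mod_cast hrn
      refine div_le_div_of_nonneg_right ?_ (Nat.cast_nonneg _)
      push_cast
      nlinarith [Nat.cast_nonneg (α := ℝ) n]

end Randomness

end MatInt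

namespace MatInt

/-! ### Rules for reasoning about programs -/

section Logic

variable {K : Type*} [Field K]

/-- Started in `s`, the program `p` halts, and `Q` holds of the number of steps and the memory. -/
def Exec (p : Prog) (s : State K) (Q : ℕ → State K → Prop) : Prop :=
  ∃ t s', Runs p s t s' ∧ Q t s'

theorem Exec.mono {p : Prog} {s : State K} {P Q : ℕ → State K → Prop} (h : Exec p s P)
    (hPQ : ∀ t s', P t s' → Q t s') : Exec p s Q :=
  let ⟨t, s', hr, hp⟩ := h
  ⟨t, s', hr, hPQ t s' hp⟩

theorem Exec.seq {p q : Prog} {s : State K} {P Q : ℕ → State K → Prop} (h : Exec p s P)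
    (hq : ∀ t s', P t s' → Exec q s' fun t' s'' => Q (t + t') s'') : Exec (.seq p q) s Q :=
  let ⟨t, s', hr, hp⟩ := h
  let ⟨t', s'', hr', hQ⟩ := hq t s' hp
  ⟨t + t', s'', .seq hr hr', hQ⟩

theorem Exec.skip {s : State K} {Q : ℕ → State K → Prop} (h : Q 1 s) : Exec .skip s Q :=
  ⟨1, s, .skip s, h⟩

theorem Exec.setNat {a : ℕ} {i x : NExpr} {s : State K} {Q : ℕ → State K → Prop}
    (h : Q (i.cost + x.cost + 1) (s.putNat a (i.eval s) (x.eval s))) :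
    Exec (.setNat a i x) s Q :=
  ⟨_, _, .setNat s a i x, h⟩

theorem Exec.setFld {a : ℕ} {i j : NExpr} {x : FExpr} {s : State K} {Q : ℕ → State K → Prop}
    (h : Q (i.cost + j.cost + x.cost + 1) (s.putFld a (i.eval s) (j.eval s) (x.eval s))) :
    Exec (.setFld a i j x) s Q :=
  ⟨_, _, .setFld s a i j x, h⟩

theorem Exec.ite {b : Test} {p q : Prog} {s : State K} {Q : ℕ → State K → Prop}
    (ht : b.Holds s → Exec p s fun t s' => Q (b.cost + 1 + t) s')
    (hf : ¬ b.Holds s → Exec q s fun t s' => Q (b.cost + 1 + t) s') : Exec (.ite b p q) s Q := by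
  by_cases hb : b.Holds s
  · obtain ⟨t, s', hr, hQ⟩ := ht hb
    exact ⟨_, s', .iteTrue hb hr, hQ⟩
  · obtain ⟨t, s', hr, hQ⟩ := hf hb
    exact ⟨_, s', .iteFalse hb hr, hQ⟩

/-- The number `n` of iterations is fixed in advance. The time in the invariant counts the bodies
only; the `n + 1` tests are added at the end. -/
theorem Exec.while {b : Test} {p : Prog} {s : State K} {Q : ℕ → State K → Prop}
    (Inv : ℕ → ℕ → State K → Prop) (n : ℕ) (h0 : Inv 0 0 s)
    (hbody : ∀ i t s, i < n → Inv i t s → b.Holds s ∧ Exec p s fun t' s' => Inv (i + 1) (t + t') s')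
    (hend : ∀ t s, Inv n t s → ¬ b.Holds s ∧ Q (t + (n + 1) * (b.cost + 1)) s) :
    Exec (.while b p) s Q := by
  have key : ∀ m i t s, i + m = n → Inv i t s →
      Exec (.while b p) s fun t' s' => Q (t + t' + i * (b.cost + 1)) s' := by
    intro m
    induction m with
    | zero =>
      intro i t s hi hI
      obtain rfl : i = n := by omega
      obtain ⟨hb, hQ⟩ := hend t s hI
      refine ⟨_, s, .whileFalse hb, ?_⟩
      convert hQ using 1
      ring
    | succ m ih =>
      intro i t s hi hI
      obtain ⟨hb, t₁, s₁, hr, hI'⟩ := hbody i t s (by omega) hI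
      obtain ⟨t₂, s₂, hr₂, hQ⟩ := ih (i + 1) _ s₁ (by omega) hI'
      refine ⟨_, s₂, .whileTrue hb hr hr₂, ?_⟩
      convert hQ using 1
      ring
  refine (key n 0 0 s (by omega) h0).mono fun t s' h => ?_
  simpa using h

/-- The scalar stored in entry `0` of an integer array. -/
abbrev NExpr.var (a : ℕ) : NExpr := .get a (.const 0)

/-- `for c from 0 to N - 1 do p`. -/
def forLoop (c : ℕ) (N : NExpr) (p : Prog) : Prog :=
  .seq (.setNat c (.const 0) (.const 0))
    (.while (.natLt (.var c) N) (.seq p (.setNat c (.const 0) (.add (.var c) (.const 1)))))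

/-- Invariants are required for every memory that differs only in the counter array, so assignments
to the counter need no treatment by the user. An iteration costs `N.cost + 4` for the test and `6`
for the increment; the initialization and the last test cost `N.cost + 7`. -/
theorem Exec.for {c : ℕ} {N : NExpr} {p : Prog} {s : State K} {Q : ℕ → State K → Prop}
    (Inv : ℕ → ℕ → State K → Prop) (n : ℕ) (hN : ∀ i t s, Inv i t s → N.eval s = n)
    (h0 : ∀ s', s'.fld = s.fld → (∀ a, a ≠ c → s'.nat a = s.nat a) → Inv 0 0 s')
    (hbody : ∀ i t s, i < n → Inv i t s → s.nat c 0 = i → Exec p s fun t' s' =>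
      s'.nat c 0 = i ∧ ∀ s'', s''.fld = s'.fld → (∀ a, a ≠ c → s''.nat a = s'.nat a) →
        Inv (i + 1) (t + t') s'')
    (hend : ∀ t s, Inv n t s → Q (t + n * (N.cost + 10) + N.cost + 7) s) :
    Exec (forLoop c N p) s Q := by
  refine Exec.seq (P := fun t s' => t = 3 ∧ Inv 0 0 s' ∧ s'.nat c 0 = 0) (Exec.setNat ?_) ?_
  · refine ⟨rfl, h0 _ rfl fun a ha => ?_, ?_⟩
    · funext i
      simp [State.putNat, ha]
    · simp [State.putNat, NExpr.eval]
  · rintro t s' ⟨rfl, hI, hc⟩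
    refine Exec.while (fun i t s => ∃ t', t = t' + i * 6 ∧ Inv i t' s ∧ s.nat c 0 = i) n
      ⟨0, rfl, hI, hc⟩ ?_ ?_
    · rintro i t s hi ⟨t', rfl, hI, hc⟩
      refine ⟨?_, ?_⟩
      · simp [Test.Holds, NExpr.eval, hc, hN _ _ _ hI, hi]
      · refine Exec.seq (hbody i t' s hi hI hc) ?_
        rintro t₁ s₁ ⟨hc₁, hI₁⟩
        refine Exec.setNat ⟨t' + t₁, ?_, hI₁ _ rfl fun a ha => ?_, ?_⟩
        · simp only [NExpr.cost]; ring
        · funext i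
          simp [State.putNat, ha]
        · simp [State.putNat, NExpr.eval, hc₁]
    · rintro t s ⟨t', rfl, hI, hc⟩
      refine ⟨?_, ?_⟩
      · simp [Test.Holds, NExpr.eval, hc, hN _ _ _ hI]
      · convert hend t' s hI using 1
        simp only [Test.cost, NExpr.cost]
        ring

/-- An upper bound for the arrays that a program writes to. -/
def Prog.bound : Prog → ℕ
  | .skip => 0
  | .setNat a _ _ => a + 1
  | .setFld a _ _ _ => a + 1
  | .seq p q => max p.bound q.bound
  | .ite _ p q => max p.bound q.bound
  | .while _ p => p.bound

/-- Array names in assignments are literals, so a program can change only arrays named in its text.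
This is why an unknown multiplication program can be called without damage to data stored above its
bound. -/
theorem Runs.frame {p : Prog} {s s' : State K} {t : ℕ} (h : Runs p s t s') :
    ∀ a, p.bound ≤ a → s'.nat a = s.nat a ∧ s'.fld a = s.fld a := by
  induction h with
  | skip => exact fun a _ => ⟨rfl, rfl⟩
  | setNat s a i x =>
    intro b hb
    have : b ≠ a := by simp only [Prog.bound] at hb; omega
    refine ⟨?_, rfl⟩
    funext j
    simp [State.putNat, this]
  | setFld s a i j x =>
    intro b hb
    have : b ≠ a := by simp only [Prog.bound] at hb; omega
    refine ⟨rfl, ?_⟩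
    funext j l
    simp [State.putFld, this]
  | seq _ _ ih₁ ih₂ =>
    intro a ha
    simp only [Prog.bound, max_le_iff] at ha
    exact ⟨(ih₂ a ha.2).1.trans (ih₁ a ha.1).1, (ih₂ a ha.2).2.trans (ih₁ a ha.1).2⟩
  | iteTrue _ _ ih =>
    intro a ha
    simp only [Prog.bound, max_le_iff] at ha
    exact ih a ha.1
  | iteFalse _ _ ih =>
    intro a ha
    simp only [Prog.bound, max_le_iff] at ha
    exact ih a ha.2
  | whileTrue _ _ _ ih₁ ih₂ =>
    intro a ha
    exact ⟨(ih₂ a ha).1.trans (ih₁ a ha).1, (ih₂ a ha).2.trans (ih₁ a ha).2⟩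
  | whileFalse => exact fun a _ => ⟨rfl, rfl⟩

end Logic

/-! ### Filling rectangles of arrays -/

section Fill

variable {K : Type*}

/-- Assign `e` to the entries `(ro + i, co + j)` of array `A` for `i < N`, `j < M`, where the loop
variables `i` and `j` are kept in the integer arrays `ci` and `cj`. -/
def fill (ci cj A : ℕ) (ro co N M : NExpr) (e : FExpr) : Prog :=
  forLoop ci N (forLoop cj M
    (.setFld A (.add ro (.var ci)) (.add co (.var cj)) e))

/-- The function `α` overwritten by `f` in a rectangle. -/
def patch (α : ℕ → ℕ → K) (ro co N M : ℕ) (f : ℕ → ℕ → K) : ℕ → ℕ → K := fun x y =>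
  if ro ≤ x ∧ x < ro + N ∧ co ≤ y ∧ y < co + M then f (x - ro) (y - co) else α x y

theorem patch_in (α : ℕ → ℕ → K) {ro co N M : ℕ} (f : ℕ → ℕ → K) {i j : ℕ} (hi : i < N)
    (hj : j < M) : patch α ro co N M f (ro + i) (co + j) = f i j := by
  rw [patch, if_pos (by omega)]
  simp

theorem patch_out (α : ℕ → ℕ → K) {ro co N M : ℕ} (f : ℕ → ℕ → K) {x y : ℕ}
    (h : x < ro ∨ ro + N ≤ x ∨ y < co ∨ co + M ≤ y) : patch α ro co N M f x y = α x y := by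
  rw [patch, if_neg (by omega)]

theorem patch_row_zero (α : ℕ → ℕ → K) (ro co M : ℕ) (f : ℕ → ℕ → K) :
    patch α ro co 0 M f = α := by
  funext x y
  exact patch_out _ _ (by omega)

theorem patch_col_zero (α : ℕ → ℕ → K) (ro co N : ℕ) (f : ℕ → ℕ → K) :
    patch α ro co N 0 f = α := by
  funext x y
  exact patch_out _ _ (by omega)

theorem patch_zero_zero (α : ℕ → ℕ → K) {S : ℕ} (f : ℕ → ℕ → K) {x y : ℕ} (hx : x < S)
    (hy : y < S) : patch α 0 0 S S f x y = f x y := by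
  rw [patch, if_pos (by omega)]
  simp

theorem patch_row_succ (α : ℕ → ℕ → K) (ro co i j M : ℕ) (f : ℕ → ℕ → K) (x y : ℕ) :
    patch (patch α ro co i M f) (ro + i) co 1 (j + 1) (fun _ => f i) x y =
      if x = ro + i ∧ y = co + j then f i j else
        patch (patch α ro co i M f) (ro + i) co 1 j (fun _ => f i) x y := by
  unfold patch
  split_ifs <;> first | rfl | omega | (congr 1 <;> omega)

theorem patch_succ (α : ℕ → ℕ → K) (ro co i M : ℕ) (f : ℕ → ℕ → K) (x y : ℕ) :
    patch (patch α ro co i M f) (ro + i) co 1 M (fun _ => f i) x y =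
      patch α ro co (i + 1) M f x y := by
  unfold patch
  split_ifs <;> first | rfl | omega | (rw [show x - ro = i by omega])

variable [Field K]

/-- The expression may be evaluated under the assumption that its target entry still has the old
value; this covers accumulation and updates in place. -/
theorem exec_fill {ci cj A : ℕ} {ro co N M : NExpr} {e : FExpr} {s : State K} (hij : ci ≠ cj)
    (vro vco vN vM : ℕ) (f : ℕ → ℕ → K)
    (hval : ∀ s' : State K, (∀ a, a ≠ ci → a ≠ cj → s'.nat a = s.nat a) →
      ro.eval s' = vro ∧ co.eval s' = vco ∧ N.eval s' = vN ∧ M.eval s' = vM)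
    (he : ∀ (s' : State K) (i j : ℕ), i < vN → j < vM →
      (∀ a, a ≠ ci → a ≠ cj → s'.nat a = s.nat a) → (∀ a, a ≠ A → s'.fld a = s.fld a) →
      s'.nat ci 0 = i → s'.nat cj 0 = j →
      s'.fld A (vro + i) (vco + j) = s.fld A (vro + i) (vco + j) → e.eval s' = f i j)
    (hcost : ro.cost + co.cost + N.cost + M.cost + e.cost ≤ 80) :
    Exec (fill ci cj A ro co N M e) s fun t s' =>
      t ≤ 100 * ((vN + 1) * (vM + 1)) ∧ (∀ a, a ≠ ci → a ≠ cj → s'.nat a = s.nat a) ∧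
      (∀ a, a ≠ A → s'.fld a = s.fld a) ∧
      s'.fld A = patch (s.fld A) vro vco vN vM f := by
  set bc := ro.cost + co.cost + e.cost + 7 with hbc
  refine Exec.for (fun i t s' => t = i * (vM * bc + vM * (M.cost + 10) + M.cost + 7) ∧
    (∀ a, a ≠ ci → a ≠ cj → s'.nat a = s.nat a) ∧
    (∀ a, a ≠ A → s'.fld a = s.fld a) ∧ s'.fld A = patch (s.fld A) vro vco i vM f) vN ?_ ?_ ?_ ?_
  · rintro i t s' ⟨-, h, -⟩
    exact (hval s' h).2.2.1
  · intro s' hf hn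
    refine ⟨by simp, fun a ha _ => hn a ha, fun a _ => by rw [hf], ?_⟩
    rw [hf, patch_row_zero]
  · rintro i t s₁ hi ⟨rfl, hn₁, hf₁, hA₁⟩ hc₁
    refine Exec.for (fun j t s' => t = j * bc ∧
      (∀ a, a ≠ ci → a ≠ cj → s'.nat a = s.nat a) ∧ s'.nat ci 0 = i ∧
      (∀ a, a ≠ A → s'.fld a = s.fld a) ∧
      s'.fld A = patch (patch (s.fld A) vro vco i vM f) (vro + i) vco 1 j (fun _ => f i))
      vM ?_ ?_ ?_ ?_
    · rintro j t s' ⟨-, h, -⟩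
      exact (hval s' h).2.2.2
    · intro s' hf hn
      refine ⟨by simp, fun a ha ha' => (hn a ha').trans (hn₁ a ha ha'), ?_,
        fun a ha => by rw [hf, hf₁ a ha], ?_⟩
      · rw [hn ci hij, hc₁]
      · rw [hf, patch_col_zero, hA₁]
    · rintro j t s₂ hj ⟨rfl, hn₂, hi₂, hf₂, hA₂⟩ hc₂
      obtain ⟨hro, hco, -, -⟩ := hval s₂ hn₂
      have hev : e.eval s₂ = f i j := by
        refine he s₂ i j hi hj hn₂ hf₂ hi₂ hc₂ ?_
        -- The target lies outside the finished rows and outside the finished part of its own row.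
        rw [hA₂, patch_out _ _ (by omega), patch_out _ _ (by omega)]
      refine Exec.setFld ⟨by simpa [State.putFld] using hc₂, ?_⟩
      intro s₃ hf₃ hn₃
      refine ⟨by simp only [NExpr.cost, hbc]; ring, fun a ha ha' => (hn₃ a ha').trans (hn₂ a ha
        ha'),
        ?_, ?_, ?_⟩
      · rw [hn₃ ci hij]
        simpa [State.putFld] using hi₂
      · intro a ha
        rw [hf₃, ← hf₂ a ha]
        funext x y
        simp [State.putFld, ha]
      · rw [hf₃]
        funext x y
        simp only [State.putFld, NExpr.eval, hro, hco, hi₂, hc₂, hev, hA₂]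
        rw [patch_row_succ]
        simp only [true_and]
    · rintro t s' ⟨rfl, hn', hi', hf', hA'⟩
      refine ⟨hi', ?_⟩
      intro s'' hf'' hn''
      refine ⟨by ring, ?_, fun a ha => by rw [hf'', hf' a ha], ?_⟩
      · intro a ha ha'
        rw [hn'' a ha, hn' a ha ha']
      · rw [hf'', hA']
        funext x y
        rw [patch_succ]
  · rintro t s' ⟨rfl, hn', hf', hA'⟩
    refine ⟨?_, hn', hf', hA'⟩
    -- The costs for each entry, for each row and outside the loops are at most `100` each.
    have h1 : bc + (M.cost + 10) ≤ 100 := by omega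
    have h2 : M.cost + 7 + (N.cost + 10) ≤ 100 := by omega
    have h3 : N.cost + 7 ≤ 100 := by omega
    have h4 := Nat.mul_le_mul_left vM h1
    have h5 := Nat.mul_le_mul_left vN (Nat.add_le_add h4 h2)
    linarith

/-- Assign `x` to entry `i` of integer array `a` for `i < N`, where the loop variable `i` is kept in
the integer array `c`. -/
def fillNat (c a : ℕ) (N x : NExpr) : Prog :=
  forLoop c N (.setNat a (.var c) x)

theorem exec_fillNat {c a : ℕ} {N x : NExpr} {s : State K} (hca : c ≠ a) (vN : ℕ) (f : ℕ → ℕ)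
    (hN : ∀ s' : State K, (∀ b, b ≠ c → b ≠ a → s'.nat b = s.nat b) → N.eval s' = vN)
    (hx : ∀ (s' : State K) (i : ℕ), i < vN → (∀ b, b ≠ c → b ≠ a → s'.nat b = s.nat b) →
      s'.nat c 0 = i → x.eval s' = f i)
    (hcost : N.cost + x.cost ≤ 80) :
    Exec (fillNat c a N x) s fun t s' =>
      t ≤ 100 * (vN + 1) ∧ (∀ b, b ≠ c → b ≠ a → s'.nat b = s.nat b) ∧ s'.fld = s.fld ∧
      ∀ i < vN, s'.nat a i = f i := by
  refine Exec.for (fun i t s' => t = i * (x.cost + 3) ∧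
    (∀ b, b ≠ c → b ≠ a → s'.nat b = s.nat b) ∧ s'.fld = s.fld ∧
    ∀ j < i, s'.nat a j = f j) vN ?_ ?_ ?_ ?_
  · rintro i t s' ⟨-, h, -⟩
    exact hN s' h
  · intro s' hf hn
    exact ⟨by simp, fun b hb _ => hn b hb, hf, by simp⟩
  · rintro i t s₁ hi ⟨rfl, hn₁, hf₁, ha₁⟩ hc₁
    refine Exec.setNat ⟨?_, ?_⟩
    · simpa [State.putNat, hca] using hc₁
    · intro s₂ hf₂ hn₂
      refine ⟨by simp only [NExpr.cost]; ring, ?_, hf₂.trans hf₁, ?_⟩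
      · intro b hb hb'
        rw [hn₂ b hb, ← hn₁ b hb hb']
        funext j
        simp [State.putNat, hb']
      · intro j hj
        rw [hn₂ a hca.symm]
        simp only [State.putNat, NExpr.eval, hc₁, hx s₁ i hi hn₁ hc₁, true_and]
        split_ifs with h
        · rw [h]
        · exact ha₁ j (by omega)
  · rintro t s' ⟨rfl, hn', hf', ha'⟩
    refine ⟨?_, hn', hf', ha'⟩
    have h1 : x.cost + 3 + (N.cost + 10) ≤ 100 := by omega
    have h4 := Nat.mul_le_mul_left vN h1
    linarith

end Fill

end MatInt

namespace MatInt

/-! ### Pivot steps and calls of the multiplication program -/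

section Macros

variable {K : Type*} [Field K]

/-- The rank-1 update of the array `A` that clears row `p` and column `q`. Arrays from `B` on are
used; the size is in the integer variable `B + 2`. -/
def pivot (B A : ℕ) (p q : NExpr) : Prog :=
  .seq (fill (B + 7) (B + 8) (B + 5) (.const 0) (.const 0) (.const 1) (.var (B + 2))
    (.div (.get A p (.var (B + 8))) (.get A p q)))
  (.seq (fill (B + 7) (B + 8) (B + 6) (.const 0) (.const 0) (.const 1) (.var (B + 2))
    (.get A (.var (B + 8)) q))
  (fill (B + 7) (B + 8) A (.const 0) (.const 0) (.var (B + 2)) (.var (B + 2))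
    (.sub (.get A (.var (B + 7)) (.var (B + 8)))
      (.mul (.get (B + 6) (.const 0) (.var (B + 7))) (.get (B + 5) (.const 0) (.var (B + 8)))))))

/-- The pivot row, divided by the pivot, and the pivot column are first copied to the arrays `B + 5`
and `B + 6`, since the update in place would destroy them. Hence only old entries appear in the
result. -/
theorem exec_pivot {B A S : ℕ} {p q : NExpr} {s : State K} (hA5 : A ≠ B + 5) (hA6 : A ≠ B + 6)
    (vp vq : ℕ) (hS : s.nat (B + 2) 0 = S)
    (hpq : ∀ s' : State K, (∀ a, a ≠ B + 7 → a ≠ B + 8 → s'.nat a = s.nat a) →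
      p.eval s' = vp ∧ q.eval s' = vq)
    (hp : p.cost ≤ 10) (hq : q.cost ≤ 10) :
    Exec (pivot B A p q) s fun t s' =>
      t ≤ 600 * ((S + 1) * (S + 1)) ∧
      (∀ a, a ≠ B + 7 → a ≠ B + 8 → s'.nat a = s.nat a) ∧
      (∀ a, a ≠ A → a ≠ B + 5 → a ≠ B + 6 → s'.fld a = s.fld a) ∧
      s'.fld A = patch (s.fld A) 0 0 S S fun i j =>
        s.fld A i j - s.fld A i vq * (s.fld A vp j / s.fld A vp vq) := by
  refine Exec.seq (exec_fill (by omega) 0 0 1 S (fun _ j => s.fld A vp j / s.fld A vp vq)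
    ?_ ?_ ?_) ?_
  · intro s' h
    simp [NExpr.eval, h, hS]
  · intro s' i j _ _ hn hf _ hj _
    simp [FExpr.eval, NExpr.eval, hpq s' hn, hf A hA5, hj]
  · simp only [NExpr.cost, FExpr.cost]
    omega
  rintro t₁ s₁ ⟨ht₁, hn₁, hf₁, hA₁⟩
  refine Exec.seq (exec_fill (by omega) 0 0 1 S (fun _ j => s.fld A j vq) ?_ ?_ ?_) ?_
  · intro s' h
    simp [NExpr.eval, h, hn₁, hS]
  · intro s' i j _ _ hn hf _ hj _
    simp [FExpr.eval, NExpr.eval, hf A hA6, hf₁ A hA5, hj,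
      hpq s' fun a ha hb => (hn a ha hb).trans (hn₁ a ha hb)]
  · simp only [NExpr.cost, FExpr.cost]
    omega
  rintro t₂ s₂ ⟨ht₂, hn₂, hf₂, hA₂⟩
  have hsA : s₂.fld A = s.fld A := by rw [hf₂ A hA6, hf₁ A hA5]
  have hsR : s₂.fld (B + 5) = s₁.fld (B + 5) := hf₂ _ (by omega)
  refine (exec_fill (by omega) 0 0 S S
    (fun i j => s.fld A i j - s.fld A i vq * (s.fld A vp j / s.fld A vp vq)) ?_ ?_ ?_).mono ?_
  · intro s' h
    simp [NExpr.eval, h, hn₁, hn₂, hS]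
  · intro s' i j hi hj _ hf hci hcj hown
    have e1 := hf (B + 5) (by omega)
    have e2 := hf (B + 6) (by omega)
    have p1 := patch_in (s.fld (B + 5)) (ro := 0) (co := 0)
      (fun _ j => s.fld A vp j / s.fld A vp vq) (Nat.zero_lt_one) hj
    have p2 := patch_in (s₁.fld (B + 6)) (ro := 0) (co := 0)
      (fun _ j => s.fld A j vq) (Nat.zero_lt_one) hi
    simp only [zero_add] at p1 p2 hown
    simp only [FExpr.eval, NExpr.eval, hci, hcj, hown, e1, e2, hA₂, hsR, hA₁, hsA, p1, p2]
  · simp only [NExpr.cost, FExpr.cost]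
    omega
  · rintro t₃ s₃ ⟨ht₃, hn₃, hf₃, hA₃⟩
    refine ⟨?_, ?_, ?_, ?_⟩
    · nlinarith
    · intro a ha hb
      rw [hn₃ a ha hb, hn₂ a ha hb, hn₁ a ha hb]
    · intro a h1 h2 h3
      rw [hf₃ a h1, hf₂ a h3, hf₁ a h2]
    · rw [hA₃, hsA]

/-- The program `mm` multiplies `m × m` matrices in at most `T` steps and leaves the arrays from `B`
on unchanged. -/
def MulSpec (mm : Prog) (K : Type*) [Field K] (B m T : ℕ) : Prop :=
  ∀ s : State K, s.nat 0 0 = m → Exec mm s fun t s' =>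
    t ≤ T ∧ (∀ a, B ≤ a → s'.nat a = s.nat a ∧ s'.fld a = s.fld a) ∧
    ∀ i j, i < m → j < m → s'.fld 2 i j = ∑ l ∈ Finset.range m, s.fld 0 i l * s.fld 1 l j

theorem mulSpec_of_multipliesMatrices {mm : Prog} {ω C : ℝ} (h : MultipliesMatrices mm K ω C)
    {B m : ℕ} (hB : mm.bound ≤ B) (hm : 1 ≤ m) : MulSpec mm K B m ⌊C * (m : ℝ) ^ ω⌋₊ := by
  intro s hs
  obtain ⟨t, s', hr, ht, hpost⟩ := h m hm (Matrix.of fun i j => s.fld 0 i j)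
    (Matrix.of fun i j => s.fld 1 i j) s hs (fun _ _ => rfl) (fun _ _ => rfl)
  refine ⟨t, s', hr, Nat.le_floor ht, fun a ha => hr.frame a (hB.trans ha), fun i j hi hj => ?_⟩
  rw [hpost ⟨i, hi⟩ ⟨j, hj⟩, Matrix.mul_apply, ← Fin.sum_univ_eq_sum_range
    (fun l => s.fld 0 i l * s.fld 1 l j)]
  rfl

/-- Multiply the square matrices with entries `e₀` and `e₁`, add `eb` and assign the result to a
square in array `A`. The size is in the integer variable `B + 1`. -/
def mulStep (mm : Prog) (B A : ℕ) (ro co : NExpr) (e₀ e₁ eb : FExpr) : Prog :=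
  .seq (fill (B + 7) (B + 8) 0 (.const 0) (.const 0) (.var (B + 1)) (.var (B + 1)) e₀)
  (.seq (fill (B + 7) (B + 8) 1 (.const 0) (.const 0) (.var (B + 1)) (.var (B + 1)) e₁)
  (.seq (.setNat 0 (.const 0) (.var (B + 1)))
  (.seq mm
  (fill (B + 7) (B + 8) A ro co (.var (B + 1)) (.var (B + 1))
    (.add eb (.get 2 (.var (B + 7)) (.var (B + 8))))))))

/-- Both factors are copied to the arrays `0` and `1` before anything is written to `A`, so they may
be read from `A` itself. The summand `eb` is evaluated during the last fill and may read its own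
target. -/
theorem exec_mulStep {mm : Prog} {B A r T : ℕ} {ro co : NExpr} {e₀ e₁ eb : FExpr} {s : State K}
    (hB : 3 ≤ B) (hA : B ≤ A) (hmm : MulSpec mm K B r T) (hr : s.nat (B + 1) 0 = r)
    (vro vco : ℕ) (f₀ f₁ fb : ℕ → ℕ → K)
    (hval : ∀ s' : State K, (∀ a, B ≤ a → a ≠ B + 7 → a ≠ B + 8 → s'.nat a = s.nat a) →
      ro.eval s' = vro ∧ co.eval s' = vco)
    (h₀ : ∀ (s' : State K) (i j : ℕ), i < r → j < r →
      (∀ a, B ≤ a → a ≠ B + 7 → a ≠ B + 8 → s'.nat a = s.nat a) →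
      (∀ a, B ≤ a → s'.fld a = s.fld a) →
      s'.nat (B + 7) 0 = i → s'.nat (B + 8) 0 = j → e₀.eval s' = f₀ i j)
    (h₁ : ∀ (s' : State K) (i j : ℕ), i < r → j < r →
      (∀ a, B ≤ a → a ≠ B + 7 → a ≠ B + 8 → s'.nat a = s.nat a) →
      (∀ a, B ≤ a → s'.fld a = s.fld a) →
      s'.nat (B + 7) 0 = i → s'.nat (B + 8) 0 = j → e₁.eval s' = f₁ i j)
    (hb : ∀ (s' : State K) (i j : ℕ), i < r → j < r →
      (∀ a, B ≤ a → a ≠ B + 7 → a ≠ B + 8 → s'.nat a = s.nat a) →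
      s'.nat (B + 7) 0 = i → s'.nat (B + 8) 0 = j →
      s'.fld A (vro + i) (vco + j) = s.fld A (vro + i) (vco + j) → eb.eval s' = fb i j)
    (hc : ro.cost + co.cost ≤ 20) (hc₀ : e₀.cost ≤ 40) (hc₁ : e₁.cost ≤ 40) (hcb : eb.cost ≤ 40) :
    Exec (mulStep mm B A ro co e₀ e₁ eb) s fun t s' =>
      t ≤ 400 * ((r + 1) * (r + 1)) + T ∧
      (∀ a, B ≤ a → a ≠ B + 7 → a ≠ B + 8 → s'.nat a = s.nat a) ∧
      (∀ a, B ≤ a → a ≠ A → s'.fld a = s.fld a) ∧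
      s'.fld A = patch (s.fld A) vro vco r r fun i j =>
        fb i j + ∑ l ∈ Finset.range r, f₀ i l * f₁ l j := by
  refine Exec.seq (exec_fill (by omega) 0 0 r r f₀ ?_ ?_ ?_) ?_
  · intro s' h
    simp [NExpr.eval, h, hr]
  · intro s' i j hi hj hn hf hci hcj _
    exact h₀ s' i j hi hj (fun a _ => hn a) (fun a ha => hf a (by omega)) hci hcj
  · simp only [NExpr.cost]
    omega
  rintro t₁ s₁ ⟨ht₁, hn₁, hf₁, hA₁⟩
  refine Exec.seq (exec_fill (by omega) 0 0 r r f₁ ?_ ?_ ?_) ?_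
  · intro s' h
    simp [NExpr.eval, h, hn₁, hr]
  · intro s' i j hi hj hn hf hci hcj _
    exact h₁ s' i j hi hj (fun a _ h h' => (hn a h h').trans (hn₁ a h h'))
      (fun a ha => (hf a (by omega)).trans (hf₁ a (by omega))) hci hcj
  · simp only [NExpr.cost]
    omega
  rintro t₂ s₂ ⟨ht₂, hn₂, hf₂, hA₂⟩
  refine Exec.seq (P := fun t s' => t = 4 ∧ s'.nat 0 0 = r ∧ s'.fld = s₂.fld ∧
    ∀ a, B ≤ a → s'.nat a = s₂.nat a) (Exec.setNat ⟨rfl, ?_, rfl, fun a ha => ?_⟩) ?_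
  · simp [State.putNat, NExpr.eval, hn₂, hn₁, hr]
  · have : a ≠ 0 := by omega
    funext i
    simp [State.putNat, this]
  rintro t₃ s₃ ⟨rfl, h00, hf₃, hn₃⟩
  refine Exec.seq (hmm s₃ h00) ?_
  rintro t₄ s₄ ⟨ht₄, hB₄, hprod⟩
  have hn : ∀ a, B ≤ a → a ≠ B + 7 → a ≠ B + 8 → s₄.nat a = s.nat a := fun a ha h h' => by
    rw [(hB₄ a ha).1, hn₃ a ha, hn₂ a h h', hn₁ a h h']
  have hf : ∀ a, B ≤ a → s₄.fld a = s.fld a := fun a ha => by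
    rw [(hB₄ a ha).2, hf₃, hf₂ a (by omega), hf₁ a (by omega)]
  have h0 : ∀ i l, i < r → l < r → s₃.fld 0 i l = f₀ i l := by
    intro i l hi hl
    have := patch_in (s.fld 0) (ro := 0) (co := 0) f₀ hi hl
    rw [hf₃, hf₂ 0 (by omega), hA₁]
    simpa using this
  have h1 : ∀ i l, i < r → l < r → s₃.fld 1 i l = f₁ i l := by
    intro i l hi hl
    have := patch_in (s₁.fld 1) (ro := 0) (co := 0) f₁ hi hl
    rw [hf₃, hA₂]
    simpa using this
  refine (exec_fill (by omega) vro vco r r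
    (fun i j => fb i j + ∑ l ∈ Finset.range r, f₀ i l * f₁ l j) ?_ ?_ ?_).mono ?_
  · intro s' h
    obtain ⟨e1, e2⟩ := hval s' fun a ha h1 h2 => (h a h1 h2).trans (hn a ha h1 h2)
    refine ⟨e1, e2, ?_, ?_⟩ <;> simp [NExpr.eval, h, hn, hr]
  · intro s' i j hi hj hn' hf' hci hcj hown
    have e2 := hf' 2 (by omega)
    rw [FExpr.eval, hb s' i j hi hj (fun a ha h1 h2 => (hn' a h1 h2).trans (hn a ha h1 h2)) hci hcj
      (by rw [hown, hf A hA])]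
    simp only [FExpr.eval, NExpr.eval, hci, hcj, e2, hprod i j hi hj]
    congr 1
    refine Finset.sum_congr rfl fun l hl => ?_
    rw [h0 i l hi (Finset.mem_range.mp hl), h1 l j (Finset.mem_range.mp hl) hj]
  · simp only [NExpr.cost, FExpr.cost]
    omega
  · rintro t₅ s₅ ⟨ht₅, hn₅, hf₅, hA₅⟩
    refine ⟨?_, ?_, ?_, ?_⟩
    -- Three fills cost `300 * ((r + 1) * (r + 1))`; passing the size to `mm` costs `4` more steps.
    · have : 1 ≤ (r + 1) * (r + 1) := Nat.succ_le_of_lt (by positivity)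
      omega
    · intro a ha h1 h2
      rw [hn₅ a h1 h2, hn a ha h1 h2]
    · intro a ha h1
      rw [hf₅ a h1, hf a ha]
    · rw [hA₅, hf A hA]

end Macros

end MatInt

namespace MatInt

open scoped Matrix

/-! ### Meaning of the arrays of the elimination and of the scan -/

section Relations

variable {K : Type*} [Field K] {a b n r : ℕ}

/-- A matrix as a function on pairs of natural numbers, extended by zero. -/
def natFun (A : Matrix (Fin a) (Fin b) K) : ℕ → ℕ → K := fun i j =>
  if h : i < a ∧ j < b then A ⟨i, h.1⟩ ⟨j, h.2⟩ else 0

theorem natFun_fin (A : Matrix (Fin a) (Fin b) K) (i : Fin a) (j : Fin b) :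
    natFun A i j = A i j := by
  simp [natFun]

theorem natFun_of_lt (A : Matrix (Fin a) (Fin b) K) {i j : ℕ} (hi : i < a) (hj : j < b) :
    natFun A i j = A ⟨i, hi⟩ ⟨j, hj⟩ := by
  simp [natFun, hi, hj]

theorem natFun_of_row_le (A : Matrix (Fin a) (Fin b) K) {i j : ℕ} (hi : a ≤ i) :
    natFun A i j = 0 := by
  rw [natFun, dif_neg (by omega)]

theorem natFun_of_col_le (A : Matrix (Fin a) (Fin b) K) {i j : ℕ} (hj : b ≤ j) :
    natFun A i j = 0 := by
  rw [natFun, dif_neg (by omega)]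

theorem sum_natFun_mul {c : ℕ} (A : Matrix (Fin a) (Fin b) K) (B : Matrix (Fin b) (Fin c) K)
    {i j : ℕ} (hi : i < a) (hj : j < c) :
    ∑ l ∈ Finset.range b, natFun A i l * natFun B l j = natFun (A * B) i j := by
  rw [natFun_of_lt _ hi hj, Matrix.mul_apply, ← Fin.sum_univ_eq_sum_range
    (fun l => natFun A i l * natFun B l j)]
  refine Finset.sum_congr rfl fun l _ => ?_
  rw [natFun_of_lt _ hi l.2, natFun_of_lt _ l.2 hj]

/-- The array of the elimination after the selection of `σ`. -/
def ElimRel (A : Matrix (Fin r) (Fin r) K) (σ : Sel r) (α : ℕ → ℕ → K) : Prop :=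
  ∀ i j : Fin r, α i j = schur A σ i j ∧ α i (r + j) = (1 - A * placedInv A σ) i j ∧
    α (r + i) j = (1 - placedInv A σ * A) i j ∧ α (r + i) (r + j) = -placedInv A σ i j

theorem placedInv_nil (A : Matrix (Fin r) (Fin r) K) : placedInv A (Sel.nil r) = 0 := by
  ext x y
  rw [placedInv, Matrix.mul_apply]
  exact Finset.sum_of_isEmpty (ι := Fin 0) _

theorem elimRel_nil {A : Matrix (Fin r) (Fin r) K} {α : ℕ → ℕ → K}
    (h : ∀ i j : Fin r, α i j = A i j ∧ α i (r + j) = (1 : Matrix (Fin r) (Fin r) K) i j ∧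
      α (r + i) j = (1 : Matrix (Fin r) (Fin r) K) i j ∧ α (r + i) (r + j) = 0) :
    ElimRel A (Sel.nil r) α := by
  intro i j
  simpa [schur, placedInv_nil] using h i j

/-- The array arises from the quadrants `A`, `1`, `1`, `0` by elimination, and one pivot at `(p, q)`
updates all four at once. The sign in the last quadrant makes its rule the same as that of the
others. -/
theorem ElimRel.snoc {A : Matrix (Fin r) (Fin r) K} {σ : Sel r} {α : ℕ → ℕ → K}
    (h : ElimRel A σ α) (hdet : SelDet A σ) {p q : Fin r} (hp : schur A σ p q ≠ 0) :
    ElimRel A (σ.snoc p q) (patch α 0 0 (r + r) (r + r)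
      fun x y => α x y - α x q * (α p y / α p q)) := by
  intro i j
  rw [patch_zero_zero _ _ (by omega) (by omega), patch_zero_zero _ _ (by omega) (by omega),
    patch_zero_zero _ _ (by omega) (by omega), patch_zero_zero _ _ (by omega) (by omega),
    (h i j).1, (h i j).2.1, (h i j).2.2.1, (h i j).2.2.2, (h i q).1, (h i q).2.2.1, (h p j).1,
    (h p j).2.1, (h p q).1, schur_snoc_apply hdet hp, mul_placedInv_snoc_apply hdet hp,
    placedInv_mul_snoc_apply hdet hp, placedInv_snoc_apply hdet hp]
  exact ⟨rfl, rfl, rfl, by ring⟩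

/-- The array of the scan within a block with columns `U` of `Q₁` and rows `V` of `Q₂`. -/
def ScanRel (X U V : Matrix (Fin r) (Fin r) K) (β : ℕ → ℕ → K) : Prop :=
  ∀ i j : Fin r, β i j = X i j ∧ β i (r + j) = (X * U) i j ∧
    β (r + i) j = (V * X) i j ∧ β (r + i) (r + j) = (V * X * U) i j

/-- The array is `X` multiplied on the left by `1` stacked on `V` and on the right by `1` beside
`U`. A rank-one update of `X` therefore becomes one of the array, and its denominator `vᵀXu` is the
diagonal entry `(r + p, r + p)`. -/
theorem ScanRel.pivot {X U V : Matrix (Fin r) (Fin r) K} {β : ℕ → ℕ → K} (h : ScanRel X U V β)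
    (p : Fin r) :
    ScanRel (X - ((V * X * U) p p)⁻¹ • Matrix.vecMulVec (X *ᵥ U.col p) (V.row p ᵥ* X)) U V
      (patch β 0 0 (r + r) (r + r)
        fun x y => β x y - β x (r + p) * (β (r + p) y / β (r + p) (r + p))) := by
  intro i j
  rw [patch_zero_zero _ _ (by omega) (by omega), patch_zero_zero _ _ (by omega) (by omega),
    patch_zero_zero _ _ (by omega) (by omega), patch_zero_zero _ _ (by omega) (by omega),
    (h i j).1, (h i j).2.1, (h i j).2.2.1, (h i j).2.2.2, (h i p).2.1, (h i p).2.2.2,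
    (h p j).2.2.1, (h p j).2.2.2, (h p p).2.2.2]
  have e1 : (X *ᵥ U.col p) = (X * U).col p := rfl
  have e2 : V.row p ᵥ* X = (V * X).row p := rfl
  have e3 : V *ᵥ (X * U).col p = (V * X * U).col p := by
    rw [Matrix.mul_assoc]; rfl
  have e4 : (V * X).row p ᵥ* U = (V * X * U).row p := rfl
  rw [e1, e2, Matrix.sub_mul, Matrix.mul_sub, Matrix.sub_mul, Matrix.mul_smul, Matrix.smul_mul,
    Matrix.smul_mul, Matrix.mul_vecMulVec, Matrix.vecMulVec_mul, Matrix.vecMulVec_mul, e3, e4]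
  simp only [Matrix.sub_apply, Matrix.smul_apply, Matrix.vecMulVec_apply, Matrix.col_apply,
    Matrix.row_apply, smul_eq_mul]
  refine ⟨?_, ?_, ?_, ?_⟩ <;> ring

/-- The columns `s, …, s + r - 1` of `Q₁`, extended by zeros. -/
def colBlock (Q₁ : Matrix (Fin r) (Fin n) K) (s : ℕ) : Matrix (Fin r) (Fin r) K :=
  Matrix.of fun i j => natFun Q₁ i (s + j)

/-- The rows `s, …, s + r - 1` of `Q₂`, extended by zeros. -/
def rowBlock (Q₂ : Matrix (Fin n) (Fin r) K) (s : ℕ) : Matrix (Fin r) (Fin r) K :=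
  Matrix.of fun i j => natFun Q₂ (s + i) j

variable (Q₁ : Matrix (Fin r) (Fin n) K) (Q₂ : Matrix (Fin n) (Fin r) K) (z : Fin n → K)

/-- The state of the scan for the selected rows and columns. -/
noncomputable def outState (t : ℕ) : AlgState K n (outSel Q₁ Q₂ z).m :=
  algState r (Q₁.submatrix (outSel Q₁ Q₂ z).a id) (Q₂.submatrix id (outSel Q₁ Q₂ z).b) z t

/-- The matrix `W` of the scan with its rows and columns put in their places. -/
noncomputable def outMat (t : ℕ) : Matrix (Fin r) (Fin r) K :=
  colSel K (outSel Q₁ Q₂ z) * (outState Q₁ Q₂ z t).W * rowSel K (outSel Q₁ Q₂ z)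

theorem outMat_zero : outMat Q₁ Q₂ z 0 = placedInv (Y₀ Q₁ Q₂ z) (outSel Q₁ Q₂ z) := by
  rw [outMat, placedInv, ← Y₀_submatrix]
  rfl

theorem mul_outMat_mul (t : ℕ) :
    Q₂ * outMat Q₁ Q₂ z t * Q₁ = Q₂.submatrix id (outSel Q₁ Q₂ z).b * (outState Q₁ Q₂ z t).W *
      Q₁.submatrix (outSel Q₁ Q₂ z).a id := by
  rw [outMat, ← mul_colSel, ← rowSel_mul]
  simp only [Matrix.mul_assoc]

variable {z}

/-- Restricting `Q₁` and `Q₂` or enlarging `W` by zeros gives the same products, and the enlargement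
commutes with the update. So the program works with the unrestricted matrices and never renumbers
rows or columns. -/
theorem outState_succ (hz : ∀ i, z i ≠ 0) (e : Fin n) :
    ((Q₂ * outMat Q₁ Q₂ z e * Q₁) e e ≠ 0 →
      (outState Q₁ Q₂ z (e + 1)).J = insert e (outState Q₁ Q₂ z e).J ∧
      e ∉ (outState Q₁ Q₂ z e).J ∧
      outMat Q₁ Q₂ z (e + 1) = outMat Q₁ Q₂ z e - ((Q₂ * outMat Q₁ Q₂ z e * Q₁) e e)⁻¹ •
        Matrix.vecMulVec (outMat Q₁ Q₂ z e *ᵥ Q₁.col e) (Q₂.row e ᵥ* outMat Q₁ Q₂ z e)) ∧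
    ((Q₂ * outMat Q₁ Q₂ z e * Q₁) e e = 0 →
      (outState Q₁ Q₂ z (e + 1)).J = (outState Q₁ Q₂ z e).J ∧
      outMat Q₁ Q₂ z (e + 1) = outMat Q₁ Q₂ z e) := by
  have hinv := scanInv_algState (r := r) hz (det_Y₀_outSel Q₁ Q₂ z) e e.2.le
  have h := hinv.step_eq hz
  rw [← algState_succ] at h
  rw [mul_outMat_mul]
  refine ⟨fun h0 => ?_, fun h0 => ?_⟩
  · obtain ⟨hJ, hW⟩ := h.1 h0
    refine ⟨hJ, hinv.notMem, ?_⟩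
    have hW' : (outState Q₁ Q₂ z (e + 1)).W = _ := hW
    rw [outMat, hW', Matrix.mul_sub, Matrix.sub_mul, Matrix.mul_smul, Matrix.smul_mul,
      Matrix.mul_vecMulVec, Matrix.vecMulVec_mul]
    have e1 : (Q₁.submatrix (outSel Q₁ Q₂ z).a id).col e =
        rowSel K (outSel Q₁ Q₂ z) *ᵥ Q₁.col e := by
      rw [← rowSel_mul]; rfl
    have e2 : (Q₂.submatrix id (outSel Q₁ Q₂ z).b).row e =
        Q₂.row e ᵥ* colSel K (outSel Q₁ Q₂ z) := by
      rw [← mul_colSel]; rfl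
    rw [e1, e2]
    simp only [Matrix.mulVec_mulVec, Matrix.vecMul_vecMul, outMat, Matrix.mul_assoc]
    rfl
  · obtain ⟨hJ, hW⟩ := h.2 h0
    refine ⟨hJ, ?_⟩
    have hW' : (outState Q₁ Q₂ z (e + 1)).W = (outState Q₁ Q₂ z e).W := hW
    rw [outMat, hW', outMat]

theorem outState_of_le (t : ℕ) (ht : n ≤ t) :
    outState Q₁ Q₂ z (t + 1) = outState Q₁ Q₂ z t := by
  rw [outState, outState, algState_of_le _ _ _ _ _ (by omega), algState_of_le _ _ _ _ t ht]

/-- The current set is independent in a space whose dimension is the number of pivots. This bound on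
accepted elements limits the cost of all updates of the scan together. -/
theorem card_outState_le (hz : ∀ i, z i ≠ 0) (t : ℕ) : (outState Q₁ Q₂ z t).J.card ≤ r := by
  have hle : ∀ u ≤ n, (outState Q₁ Q₂ z u).J.card ≤ r := by
    intro u hu
    have hinv := scanInv_algState (r := r) hz (det_Y₀_outSel Q₁ Q₂ z) u hu
    refine (card_le_of_linearIndepOn (linearIndepOn_of_det_Z hinv.det_ne).1).trans ?_
    have : (outSel Q₁ Q₂ z).m = (Y₀ Q₁ Q₂ z).rank := selRun_m_eq_rank _
    rw [this]
    exact Matrix.rank_le_width _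
  rcases le_total t n with h | h
  · exact hle t h
  · have := hle n le_rfl
    rwa [outState, ← algState_of_le _ _ _ _ t h] at this

/-- One step of the scan inside a block, in terms of the block. -/
theorem outMat_block_step (hz : ∀ i, z i ≠ 0) (s : ℕ) (p : Fin r) :
    ((rowBlock Q₂ s * outMat Q₁ Q₂ z (s + p) * colBlock Q₁ s) p p ≠ 0 →
      ∃ h : s + p < n,
        (outState Q₁ Q₂ z (s + p + 1)).J = insert ⟨s + p, h⟩ (outState Q₁ Q₂ z (s + p)).J ∧
        (⟨s + p, h⟩ : Fin n) ∉ (outState Q₁ Q₂ z (s + p)).J ∧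
        outMat Q₁ Q₂ z (s + p + 1) = outMat Q₁ Q₂ z (s + p) -
          ((rowBlock Q₂ s * outMat Q₁ Q₂ z (s + p) * colBlock Q₁ s) p p)⁻¹ •
          Matrix.vecMulVec (outMat Q₁ Q₂ z (s + p) *ᵥ (colBlock Q₁ s).col p)
            ((rowBlock Q₂ s).row p ᵥ* outMat Q₁ Q₂ z (s + p))) ∧
    ((rowBlock Q₂ s * outMat Q₁ Q₂ z (s + p) * colBlock Q₁ s) p p = 0 →
      (outState Q₁ Q₂ z (s + p + 1)).J = (outState Q₁ Q₂ z (s + p)).J ∧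
      outMat Q₁ Q₂ z (s + p + 1) = outMat Q₁ Q₂ z (s + p)) := by
  have hent : ∀ X : Matrix (Fin r) (Fin r) K, (rowBlock Q₂ s * X * colBlock Q₁ s) p p =
      (rowBlock Q₂ s).row p ⬝ᵥ X *ᵥ (colBlock Q₁ s).col p := fun X => (dot_mulVec_eq X p).symm
  by_cases h : s + p < n
  · have hc : (colBlock Q₁ s).col p = Q₁.col ⟨s + p, h⟩ := by
      funext i
      exact natFun_of_lt _ i.2 h
    have hr : (rowBlock Q₂ s).row p = Q₂.row ⟨s + p, h⟩ := by
      funext i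
      exact natFun_of_lt _ h i.2
    have := outState_succ Q₁ Q₂ hz ⟨s + p, h⟩
    rw [hent, hr, hc, dot_mulVec_eq]
    exact ⟨fun h0 => ⟨h, this.1 h0⟩, this.2⟩
  -- Past the last element the padded row of `Q₂` is zero, so the test rejects, in agreement with a
  -- state that no longer changes.
  · have hr : (rowBlock Q₂ s).row p = 0 := by
      funext i
      exact natFun_of_row_le _ (by omega)
    rw [hent, hr, zero_dotProduct]
    have := outState_of_le Q₁ Q₂ (z := z) (s + p) (by omega)
    exact ⟨fun h0 => absurd rfl h0, fun _ => ⟨by rw [this], by rw [outMat, this, outMat]⟩⟩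

end Relations

end MatInt

namespace MatInt

/-! ### Preparation of the memory -/

section Program

variable {K : Type*} [Field K] {n r : ℕ}

/-- The memory holds the sizes and the padded input in the arrays from `B` on. -/
structure Env (B : ℕ) (Q₁ : Matrix (Fin r) (Fin n) K) (Q₂ : Matrix (Fin n) (Fin r) K)
    (z : Fin n → K) (s : State K) : Prop where
  n_eq : s.nat B 0 = n
  r_eq : s.nat (B + 1) 0 = r
  two_r : s.nat (B + 2) 0 = r + r
  left : ∀ i j, i < r → j < n + r → s.fld B i j = natFun Q₁ i j
  right : ∀ i j, i < n + r → j < r → s.fld (B + 1) i j = natFun Q₂ i j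
  diag : ∀ i : Fin n, s.fld (B + 2) 0 i = z i

variable {B : ℕ} {Q₁ : Matrix (Fin r) (Fin n) K} {Q₂ : Matrix (Fin n) (Fin r) K} {z : Fin n → K}

theorem Env.congr {s s' : State K} (h : Env B Q₁ Q₂ z s)
    (hn : ∀ a, B ≤ a → a < B + 3 → s'.nat a = s.nat a)
    (hf : ∀ a, B ≤ a → a < B + 3 → s'.fld a = s.fld a) : Env B Q₁ Q₂ z s' where
  n_eq := by rw [hn _ le_rfl (by omega), h.n_eq]
  r_eq := by rw [hn _ (by omega) (by omega), h.r_eq]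
  two_r := by rw [hn _ (by omega) (by omega), h.two_r]
  left := by rw [hf _ le_rfl (by omega)]; exact h.left
  right := by rw [hf _ (by omega) (by omega)]; exact h.right
  diag := by rw [hf _ (by omega) (by omega)]; exact h.diag

/-- Store the sizes. -/
def storeSizes (B : ℕ) : Prog :=
  .seq (.setNat B (.const 0) (.get 0 (.const 0)))
  (.seq (.setNat (B + 1) (.const 0) (.get 0 (.const 1)))
  (.seq (.setNat (B + 2) (.const 0) (.add (.var (B + 1)) (.var (B + 1))))
  (.setNat (B + 3) (.const 0) (.add (.var B) (.var (B + 1))))))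

theorem exec_storeSizes (hB : 3 ≤ B) {s : State K} (hn : s.nat 0 0 = n) (hr : s.nat 0 1 = r) :
    Exec (storeSizes B) s fun t s' => t ≤ 30 ∧ s'.fld = s.fld ∧ s'.nat B 0 = n ∧
      s'.nat (B + 1) 0 = r ∧ s'.nat (B + 2) 0 = r + r ∧ s'.nat (B + 3) 0 = n + r := by
  have hB0 : B ≠ 0 := by omega
  refine Exec.seq (P := fun t s' => t = 4 ∧ s' = s.putNat B 0 n) (Exec.setNat ?_) ?_
  · simp [NExpr.cost, NExpr.eval, hn]
  rintro t₁ s₁ ⟨rfl, rfl⟩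
  refine Exec.seq (P := fun t s' => t = 4 ∧ s' = (s.putNat B 0 n).putNat (B + 1) 0 r)
    (Exec.setNat ?_) ?_
  · simp [NExpr.cost, NExpr.eval, State.putNat, hr, hB0.symm]
  rintro t₂ s₂ ⟨rfl, rfl⟩
  refine Exec.seq (P := fun t s' => t = 7 ∧
    s' = ((s.putNat B 0 n).putNat (B + 1) 0 r).putNat (B + 2) 0 (r + r)) (Exec.setNat ?_) ?_
  · simp [NExpr.cost, NExpr.eval, State.putNat]
  rintro t₃ s₃ ⟨rfl, rfl⟩
  refine Exec.setNat ?_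
  simp [NExpr.cost, NExpr.eval, State.putNat]

/-- Copy the input, extended by zeros. -/
def copyInput (B : ℕ) : Prog :=
  .seq (fill (B + 7) (B + 8) B (.const 0) (.const 0) (.var (B + 1)) (.var (B + 3)) .zero)
  (.seq (fill (B + 7) (B + 8) B (.const 0) (.const 0) (.var (B + 1)) (.var B)
    (.get 0 (.var (B + 7)) (.var (B + 8))))
  (.seq (fill (B + 7) (B + 8) (B + 1) (.const 0) (.const 0) (.var (B + 3)) (.var (B + 1)) .zero)
  (.seq (fill (B + 7) (B + 8) (B + 1) (.const 0) (.const 0) (.var B) (.var (B + 1))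
    (.get 1 (.var (B + 7)) (.var (B + 8))))
  (fill (B + 7) (B + 8) (B + 2) (.const 0) (.const 0) (.const 1) (.var B)
    (.get 2 (.const 0) (.var (B + 8)))))))

/-- The arrays `0`, `1`, `2` serve the multiplication program, so the input is moved away. The
padding with zeros up to `n + r` lets the last block be treated as complete. -/
theorem exec_copyInput (hB : 3 ≤ B) (hr : 1 ≤ r) (hrn : r ≤ n) {s : State K}
    (h1 : ∀ (i : Fin r) (j : Fin n), s.fld 0 i j = Q₁ i j)
    (h2 : ∀ (i : Fin n) (j : Fin r), s.fld 1 i j = Q₂ i j)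
    (h3 : ∀ i : Fin n, s.fld 2 0 i = z i)
    (hsz : s.nat B 0 = n ∧ s.nat (B + 1) 0 = r ∧ s.nat (B + 2) 0 = r + r ∧
      s.nat (B + 3) 0 = n + r) :
    Exec (copyInput B) s fun t s' => t ≤ 2400 * (n * r) ∧ Env B Q₁ Q₂ z s' := by
  obtain ⟨en, er, e2, enr⟩ := hsz
  refine Exec.seq (exec_fill (by omega) 0 0 r (n + r) (fun _ _ => 0) ?_ ?_ (by simp [NExpr.cost,
    FExpr.cost])) ?_
  · intro s' h
    simp [NExpr.eval, h, er, enr]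
  · intros
    rfl
  rintro t₁ s₁ ⟨ht₁, hn₁, hf₁, hA₁⟩
  refine Exec.seq (exec_fill (by omega) 0 0 r n (natFun Q₁) ?_ ?_ (by simp [NExpr.cost,
    FExpr.cost])) ?_
  · intro s' h
    simp [NExpr.eval, h, hn₁, er, en]
  · intro s' i j hi hj _ hf hci hcj _
    have := h1 ⟨i, hi⟩ ⟨j, hj⟩
    simp only [FExpr.eval, NExpr.eval, hci, hcj, hf 0 (by omega), hf₁ 0 (by omega),
      natFun_of_lt _ hi hj]
    exact this
  rintro t₂ s₂ ⟨ht₂, hn₂, hf₂, hA₂⟩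
  refine Exec.seq (exec_fill (by omega) 0 0 (n + r) r (fun _ _ => 0) ?_ ?_ (by simp [NExpr.cost,
    FExpr.cost])) ?_
  · intro s' h
    simp [NExpr.eval, h, hn₁, hn₂, er, enr]
  · intros
    rfl
  rintro t₃ s₃ ⟨ht₃, hn₃, hf₃, hA₃⟩
  refine Exec.seq (exec_fill (by omega) 0 0 n r (natFun Q₂) ?_ ?_ (by simp [NExpr.cost,
    FExpr.cost])) ?_
  · intro s' h
    simp [NExpr.eval, h, hn₁, hn₂, hn₃, er, en]
  · intro s' i j hi hj _ hf hci hcj _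
    have := h2 ⟨i, hi⟩ ⟨j, hj⟩
    simp only [FExpr.eval, NExpr.eval, hci, hcj, hf 1 (by omega), hf₃ 1 (by omega),
      hf₂ 1 (by omega), hf₁ 1 (by omega), natFun_of_lt _ hi hj]
    exact this
  rintro t₄ s₄ ⟨ht₄, hn₄, hf₄, hA₄⟩
  refine (exec_fill (by omega) 0 0 1 n (fun _ j => s.fld 2 0 j) ?_ ?_ (by simp [NExpr.cost,
    FExpr.cost])).mono ?_
  · intro s' h
    simp [NExpr.eval, h, hn₁, hn₂, hn₃, hn₄, en]
  · intro s' i j _ _ _ hf _ hcj _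
    simp only [FExpr.eval, NExpr.eval, hcj, hf 2 (by omega), hf₄ 2 (by omega), hf₃ 2 (by omega),
      hf₂ 2 (by omega), hf₁ 2 (by omega)]
  rintro t₅ s₅ ⟨ht₅, hn₅, hf₅, hA₅⟩
  have hnat : ∀ a, a ≠ B + 7 → a ≠ B + 8 → s₅.nat a = s.nat a := fun a h h' => by
    rw [hn₅ a h h', hn₄ a h h', hn₃ a h h', hn₂ a h h', hn₁ a h h']
  refine ⟨?_, ?_, ?_, ?_, ?_, ?_, ?_⟩
  · have b1 : (r + 1) * (n + r + 1) ≤ 6 * (n * r) := by nlinarith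
    have b2 : (r + 1) * (n + 1) ≤ 4 * (n * r) := by nlinarith
    have b3 : (1 + 1) * (n + 1) ≤ 4 * (n * r) := by nlinarith
    rw [mul_comm (n + r + 1)] at ht₃
    rw [mul_comm (n + 1)] at ht₄
    linarith
  · rw [hnat _ (by omega) (by omega), en]
  · rw [hnat _ (by omega) (by omega), er]
  · rw [hnat _ (by omega) (by omega), e2]
  · intro i j hi hj
    rw [hf₅ _ (by omega), hf₄ _ (by omega), hf₃ _ (by omega), hA₂]
    by_cases hjn : j < n
    · simpa using patch_in (s₁.fld B) (ro := 0) (co := 0) (natFun Q₁) hi hjn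
    · rw [patch_out _ _ (by omega), hA₁, natFun_of_col_le _ (by omega)]
      simpa using patch_in (s.fld B) (ro := 0) (co := 0) (fun _ _ => 0) hi hj
  · intro i j hi hj
    rw [hf₅ _ (by omega), hA₄]
    by_cases hin : i < n
    · simpa using patch_in (s₃.fld (B + 1)) (ro := 0) (co := 0) (natFun Q₂) hin hj
    · rw [patch_out _ _ (by omega), hA₃, natFun_of_row_le _ (by omega)]
      simpa using patch_in (s₂.fld (B + 1)) (ro := 0) (co := 0) (fun _ _ => 0) hi hj
  · intro i
    rw [hA₅, ← h3]
    simpa using patch_in (s₄.fld (B + 2)) (ro := 0) (co := 0) (fun _ j => s.fld 2 0 j)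
      Nat.zero_lt_one i.2

/-- Initialize the output and the array of the elimination. -/
def initArrays (B : ℕ) : Prog :=
  .seq (fillNat (B + 8) (B + 9) (.var B) (.const 0))
  (.seq (fill (B + 7) (B + 8) (B + 3) (.const 0) (.const 0) (.var (B + 2)) (.var (B + 2)) .zero)
  (forLoop (B + 5) (.var (B + 1))
    (.seq (.setFld (B + 3) (.var (B + 5)) (.add (.var (B + 1)) (.var (B + 5))) .one)
      (.setFld (B + 3) (.add (.var (B + 1)) (.var (B + 5))) (.var (B + 5)) .one))))

theorem exec_initArrays (hr : 1 ≤ r) (hrn : r ≤ n) {s : State K} (henv : Env B Q₁ Q₂ z s) :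
    Exec (initArrays B) s fun t s' => t ≤ 1500 * (n * r) ∧ Env B Q₁ Q₂ z s' ∧
      (∀ i < n, s'.nat (B + 9) i = 0) ∧
      ∀ x y, x < r + r → y < r + r →
        s'.fld (B + 3) x y = if y = r + x ∨ x = r + y then 1 else 0 := by
  refine Exec.seq (exec_fillNat (by omega) n (fun _ => 0) ?_ ?_ (by simp [NExpr.cost])) ?_
  · intro s' h
    simp [NExpr.eval, h, henv.n_eq]
  · intros
    rfl
  rintro t₁ s₁ ⟨ht₁, hn₁, hf₁, hA₁⟩
  refine Exec.seq (exec_fill (by omega) 0 0 (r + r) (r + r) (fun _ _ => 0) ?_ ?_ (by simp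
    [NExpr.cost, FExpr.cost])) ?_
  · intro s' h
    simp [NExpr.eval, h, hn₁, henv.two_r]
  · intros
    rfl
  rintro t₂ s₂ ⟨ht₂, hn₂, hf₂, hA₂⟩
  refine Exec.for (fun i t s' => t = i * 18 ∧ Env B Q₁ Q₂ z s' ∧
    (∀ i < n, s'.nat (B + 9) i = 0) ∧ ∀ x y, x < r + r → y < r + r →
      s'.fld (B + 3) x y = if (x < i ∧ y = r + x) ∨ (y < i ∧ x = r + y) then 1 else 0)
    r ?_ ?_ ?_ ?_
  · rintro i t s' ⟨-, he, -⟩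
    exact he.r_eq
  · intro s' hf hn
    refine ⟨by simp, henv.congr ?_ ?_, ?_, ?_⟩
    · intro a _ _
      rw [hn a (by omega), hn₂ a (by omega) (by omega), hn₁ a (by omega) (by omega)]
    · intro a _ _
      rw [hf, hf₂ a (by omega), hf₁]
    · intro i hi
      rw [hn _ (by omega), hn₂ _ (by omega) (by omega), hA₁ i hi]
    · intro x y hx hy
      rw [hf, hA₂, patch_zero_zero _ _ hx hy]
      simp
  · rintro i t s' hi ⟨rfl, he, ho, hM⟩ hc
    refine Exec.seq (P := fun t s'' => t = 9 ∧ s'' = s'.putFld (B + 3) i (r + i) 1)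
      (Exec.setFld ?_) ?_
    · simp [NExpr.cost, FExpr.cost, NExpr.eval, FExpr.eval, he.r_eq, hc]
    rintro t₁ s₁ ⟨rfl, rfl⟩
    refine Exec.setFld ?_
    simp only [NExpr.eval, FExpr.eval]
    have e1 : (s'.putFld (B + 3) i (r + i) 1).nat = s'.nat := rfl
    rw [e1, he.r_eq, hc]
    refine ⟨hc, fun s'' hf hn => ⟨?_, he.congr ?_ ?_, ?_, ?_⟩⟩
    · simp only [NExpr.cost, FExpr.cost]
      ring
    · intro a _ _
      rw [hn a (by omega)]
      rfl
    · intro a _ _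
      rw [hf]
      funext x y
      have : a ≠ B + 3 := by omega
      simp [State.putFld, this]
    · intro j hj
      rw [hn _ (by omega)]
      exact ho j hj
    · intro x y hx hy
      rw [hf]
      simp only [State.putFld, true_and, hM x y hx hy]
      split_ifs <;> first | rfl | omega
  · rintro t s' ⟨rfl, he, ho, hM⟩
    refine ⟨?_, he, ho, fun x y hx hy => ?_⟩
    · simp only [NExpr.cost]
      have b1 : (r + r + 1) * (r + r + 1) ≤ 9 * (n * r) := by nlinarith
      have b2 : n + 1 ≤ 2 * (n * r) := by nlinarith
      have b3 : r ≤ n * r := by nlinarith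
      have b4 : 1 ≤ n * r := by nlinarith
      linarith
    · rw [hM x y hx hy]
      congr 1
      apply propext
      omega

end Program

end MatInt

namespace MatInt

/-! ### Computation of `Y` and elimination -/

section Elim

variable {K : Type*} [Field K] {n r B : ℕ} {Q₁ : Matrix (Fin r) (Fin n) K}
  {Q₂ : Matrix (Fin n) (Fin r) K} {z : Fin n → K}

/-- The number of blocks. -/
def numBlocks (n r : ℕ) : ℕ := (n + r - 1) / r

theorem le_numBlocks_mul (hr : 1 ≤ r) : n ≤ numBlocks n r * r := by
  have h1 := Nat.div_add_mod (n + r - 1) r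
  have h2 := Nat.mod_lt (n + r - 1) hr
  rw [numBlocks, mul_comm]
  omega

theorem numBlocks_mul_lt (hr : 1 ≤ r) : numBlocks n r * r < n + r := by
  have h1 := Nat.div_mul_le_self (n + r - 1) r
  rw [numBlocks]
  omega

theorem lt_of_lt_numBlocks (hr : 1 ≤ r) {b : ℕ} (hb : b < numBlocks n r) : b * r < n := by
  have h1 := numBlocks_mul_lt (n := n) hr
  have h2 : (b + 1) * r ≤ numBlocks n r * r := Nat.mul_le_mul_right r hb
  rw [add_mul] at h2
  omega

/-- A loop over the blocks, with the start of the block in the integer variable `B + 4`. -/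
def blockLoop (B : ℕ) (p : Prog) : Prog :=
  .seq (.setNat (B + 4) (.const 0) (.const 0))
    (.while (.natLt (.var (B + 4)) (.var B))
      (.seq p (.setNat (B + 4) (.const 0) (.add (.var (B + 4)) (.var (B + 1))))))

/-- The machine has no integer multiplication, so the start `i * r` of a block is itself the loop
variable. A round costs `6` for the test and `7` for the increment. -/
theorem exec_blockLoop (hr : 1 ≤ r) {p : Prog} {s : State K} {Q : ℕ → State K → Prop}
    (Inv : ℕ → ℕ → State K → Prop) (henv : ∀ i t s, Inv i t s → Env B Q₁ Q₂ z s)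
    (h0 : ∀ s', s'.fld = s.fld → (∀ a, a ≠ B + 4 → s'.nat a = s.nat a) → Inv 0 0 s')
    (hbody : ∀ i t s, i * r < n → Inv i t s → s.nat (B + 4) 0 = i * r → Exec p s fun t' s' =>
      s'.nat (B + 4) 0 = i * r ∧ Env B Q₁ Q₂ z s' ∧
      ∀ s'', s''.fld = s'.fld → (∀ a, a ≠ B + 4 → s''.nat a = s'.nat a) →
        Inv (i + 1) (t + t') s'')
    (hend : ∀ t s, Inv (numBlocks n r) t s → Q (t + numBlocks n r * 13 + 9) s) :
    Exec (blockLoop B p) s Q := by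
  refine Exec.seq (P := fun t s' => t = 3 ∧ Inv 0 0 s' ∧ s'.nat (B + 4) 0 = 0) (Exec.setNat ?_) ?_
  · refine ⟨rfl, h0 _ rfl fun a ha => ?_, ?_⟩
    · funext i
      simp [State.putNat, ha]
    · simp [State.putNat, NExpr.eval]
  · rintro t s' ⟨rfl, hI, hc⟩
    refine Exec.while (fun i t s => ∃ t', t = t' + i * 7 ∧ Inv i t' s ∧ s.nat (B + 4) 0 = i * r)
      (numBlocks n r) ⟨0, rfl, hI, by simpa using hc⟩ ?_ ?_
    · rintro i t s hi ⟨t', rfl, hI, hc⟩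
      have hlt := lt_of_lt_numBlocks hr hi
      refine ⟨?_, ?_⟩
      · simp [Test.Holds, NExpr.eval, hc, (henv _ _ _ hI).n_eq, hlt]
      · refine Exec.seq (hbody i t' s hlt hI hc) ?_
        rintro t₁ s₁ ⟨hc₁, he₁, hI₁⟩
        refine Exec.setNat ⟨t' + t₁, ?_, hI₁ _ rfl fun a ha => ?_, ?_⟩
        · simp only [NExpr.cost]; ring
        · funext i
          simp [State.putNat, ha]
        · simp [State.putNat, NExpr.eval, hc₁, he₁.r_eq]
          ring
    · rintro t s ⟨t', rfl, hI, hc⟩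
      refine ⟨?_, ?_⟩
      · simp [Test.Holds, NExpr.eval, hc, (henv _ _ _ hI).n_eq, le_numBlocks_mul hr]
      · convert hend t' s hI using 1
        simp only [Test.cost, NExpr.cost]
        ring

/-- A summand of an entry of `Y`. -/
noncomputable def yTerm (Q₁ : Matrix (Fin r) (Fin n) K) (Q₂ : Matrix (Fin n) (Fin r) K)
    (z : Fin n → K) (i j p : ℕ) : K :=
  (0 - natFun Q₁ i p / natFun (Matrix.of fun _ : Fin 1 => z) 0 p) * natFun Q₂ p j

/-- The padded rows of `Q₂` are zero, so summing over complete blocks adds nothing. -/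
theorem sum_yTerm (i j : Fin r) {m : ℕ} (hm : n ≤ m) :
    ∑ p ∈ Finset.range m, yTerm Q₁ Q₂ z i j p = Y₀ Q₁ Q₂ z i j := by
  rw [← Finset.sum_subset (Finset.range_mono hm), ← Fin.sum_univ_eq_sum_range, Y₀,
    Matrix.neg_apply, mul_diagonal_mul_apply, ← Finset.sum_neg_distrib]
  · refine Finset.sum_congr rfl fun p _ => ?_
    rw [yTerm, natFun_fin, natFun_fin, natFun_of_lt _ Nat.zero_lt_one p.2, Matrix.of_apply]
    ring
  · intro p _ hp
    rw [yTerm, natFun_of_row_le Q₂ (by simpa using hp), mul_zero]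

/-- Compute `Y` in the leading block of array `B + 3`. -/
def accumulate (mm : Prog) (B : ℕ) : Prog :=
  blockLoop B (mulStep mm B (B + 3) (.const 0) (.const 0)
    (.sub .zero (.div (.get B (.var (B + 7)) (.add (.var (B + 4)) (.var (B + 8))))
      (.get (B + 2) (.const 0) (.add (.var (B + 4)) (.var (B + 8))))))
    (.get (B + 1) (.add (.var (B + 4)) (.var (B + 7))) (.var (B + 8)))
    (.get (B + 3) (.var (B + 7)) (.var (B + 8))))

theorem exec_accumulate {mm : Prog} {T : ℕ} (hB : 3 ≤ B) (hmm : MulSpec mm K B r T) (hr : 1 ≤ r)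
    {s : State K} (henv : Env B Q₁ Q₂ z s) (hout : ∀ i < n, s.nat (B + 9) i = 0)
    (hM : ∀ x y, x < r + r → y < r + r →
      s.fld (B + 3) x y = if y = r + x ∨ x = r + y then 1 else 0) :
    Exec (accumulate mm B) s fun t s' =>
      t ≤ numBlocks n r * (400 * ((r + 1) * (r + 1)) + T + 13) + 10 ∧ Env B Q₁ Q₂ z s' ∧
      (∀ i < n, s'.nat (B + 9) i = 0) ∧
      ElimRel (Y₀ Q₁ Q₂ z) (Sel.nil r) (s'.fld (B + 3)) := by
  refine exec_blockLoop hr (fun b t s' => t ≤ b * (400 * ((r + 1) * (r + 1)) + T) ∧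
    Env B Q₁ Q₂ z s' ∧ (∀ i < n, s'.nat (B + 9) i = 0) ∧
    (∀ i j, i < r → j < r →
      s'.fld (B + 3) i j = ∑ p ∈ Finset.range (b * r), yTerm Q₁ Q₂ z i j p) ∧
    ∀ x y, x < r + r → y < r + r → r ≤ x ∨ r ≤ y →
      s'.fld (B + 3) x y = if y = r + x ∨ x = r + y then 1 else 0)
    (fun i t s h => h.2.1) ?_ ?_ ?_
  · intro s' hf hn
    refine ⟨by simp, henv.congr ?_ ?_, ?_, ?_, ?_⟩
    · intro a _ _
      exact hn a (by omega)
    · intro a _ _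
      rw [hf]
    · intro i hi
      rw [hn _ (by omega), hout i hi]
    · intro i j hi hj
      rw [hf, hM i j (by omega) (by omega), if_neg (by omega)]
      simp
    · intro x y hx hy _
      rw [hf, hM x y hx hy]
  · rintro b t s' hb ⟨ht, he, ho, hsum, hrest⟩ hvs
    refine (exec_mulStep hB (by omega) hmm he.r_eq 0 0
      (fun i l => 0 - natFun Q₁ i (b * r + l) / natFun (Matrix.of fun _ : Fin 1 => z) 0 (b * r + l))
      (fun l j => natFun Q₂ (b * r + l) j)
      (fun i j => ∑ p ∈ Finset.range (b * r), yTerm Q₁ Q₂ z i j p) ?_ ?_ ?_ ?_ (by simp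
        [NExpr.cost])
      (by simp [NExpr.cost, FExpr.cost]) (by simp [NExpr.cost, FExpr.cost])
      (by simp [NExpr.cost, FExpr.cost])).mono ?_
    · intro s'' _
      exact ⟨rfl, rfl⟩
    · intro s'' i j hi hj hn hf hci hcj
      have e4 : s''.nat (B + 4) 0 = b * r := by
        rw [hn _ (by omega) (by omega) (by omega), hvs]
      simp only [FExpr.eval, NExpr.eval, hci, hcj, e4, hf B le_rfl, hf (B + 2) (by omega),
        he.left i (b * r + j) hi (by omega)]
      -- Past `n` the array of the `z i` has arbitrary contents, but the numerator is a padded zero,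
      -- and zero divided by anything is zero on this machine.
      by_cases hj' : b * r + j < n
      · rw [natFun_of_lt (Matrix.of fun _ : Fin 1 => z) Nat.zero_lt_one hj', Matrix.of_apply,
          ← he.diag]
      · rw [natFun_of_col_le Q₁ (by omega), zero_div, zero_div]
    · intro s'' i j hi hj hn hf hci hcj
      have e4 : s''.nat (B + 4) 0 = b * r := by
        rw [hn _ (by omega) (by omega) (by omega), hvs]
      simp only [FExpr.eval, NExpr.eval, hci, hcj, e4, hf (B + 1) (by omega)]
      exact he.right _ _ (by omega) hj
    · intro s'' i j hi hj hn hci hcj hown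
      simp only [FExpr.eval, NExpr.eval, hci, hcj]
      rw [zero_add, zero_add] at hown
      rw [hown, hsum i j hi hj]
    · rintro t' s'' ⟨ht', hn, hf, hA⟩
      have he' : Env B Q₁ Q₂ z s'' := he.congr (fun a h1 h2 => hn a h1 (by omega) (by omega))
        fun a h1 h2 => hf a h1 (by omega)
      refine ⟨?_, he', fun s₃ hf₃ hn₃ => ⟨?_, he'.congr ?_ ?_, ?_, ?_, ?_⟩⟩
      · rw [hn _ (by omega) (by omega) (by omega), hvs]
      · linarith
      · intro a _ _
        exact hn₃ a (by omega)
      · intro a _ _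
        rw [hf₃]
      · intro i hi
        rw [hn₃ _ (by omega), hn _ (by omega) (by omega) (by omega), ho i hi]
      · intro i j hi hj
        rw [hf₃, hA, patch_zero_zero _ _ hi hj, add_mul, one_mul, Finset.sum_range_add]
        rfl
      · intro x y hx hy hxy
        rw [hf₃, hA, patch_out _ _ (by omega), hrest x y hx hy hxy]
  · rintro t s' ⟨ht, he, ho, hsum, hrest⟩
    refine ⟨by linarith, he, ho, elimRel_nil fun i j => ⟨?_, ?_, ?_, ?_⟩⟩
    · rw [hsum i j i.2 j.2, sum_yTerm i j (le_numBlocks_mul hr)]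
    · rw [hrest _ _ (by omega) (by omega) (by omega), Matrix.one_apply]
      congr 1
      rw [Fin.ext_iff]
      apply propext
      omega
    · rw [hrest _ _ (by omega) (by omega) (by omega), Matrix.one_apply]
      congr 1
      rw [Fin.ext_iff]
      apply propext
      omega
    · rw [hrest _ _ (by omega) (by omega) (by omega), if_neg (by omega)]

/-- Find the last nonzero entry of a row; the row is in the integer variable `B + 5`, the result
in `B + 6`. -/
def search (B : ℕ) : Prog :=
  .seq (.setNat (B + 6) (.const 0) (.var (B + 1)))
  (forLoop (B + 10) (.var (B + 1))
    (.ite (.not (.fldEq (.get (B + 3) (.var (B + 5)) (.var (B + 10))) .zero))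
      (.setNat (B + 6) (.const 0) (.var (B + 10))) .skip))

/-- The value `r`, which is no column index, stands for a zero row. Columns are visited in
increasing order and the result is overwritten, so the last nonzero entry wins. -/
theorem exec_search {s : State K} {p : ℕ} (hr : s.nat (B + 1) 0 = r) (hp : s.nat (B + 5) 0 = p) :
    Exec (search B) s fun t s' => t ≤ 100 * (r + 1) ∧
      (∀ a, a ≠ B + 6 → a ≠ B + 10 → s'.nat a = s.nat a) ∧ s'.fld = s.fld ∧
      ((s'.nat (B + 6) 0 = r ∧ ∀ j < r, s.fld (B + 3) p j = 0) ∨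
        ∃ q < r, s'.nat (B + 6) 0 = q ∧ s.fld (B + 3) p q ≠ 0 ∧
          ∀ j, q < j → j < r → s.fld (B + 3) p j = 0) := by
  refine Exec.seq (P := fun t s' => t = 4 ∧ s' = s.putNat (B + 6) 0 r) (Exec.setNat ?_) ?_
  · simp [NExpr.cost, NExpr.eval, hr]
  rintro t s' ⟨rfl, rfl⟩
  refine Exec.for (fun i t s' => t ≤ i * 13 ∧
    (∀ a, a ≠ B + 6 → a ≠ B + 10 → s'.nat a = s.nat a) ∧ s'.fld = s.fld ∧
      ((s'.nat (B + 6) 0 = r ∧ ∀ j < i, s.fld (B + 3) p j = 0) ∨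
        ∃ q < i, s'.nat (B + 6) 0 = q ∧ s.fld (B + 3) p q ≠ 0 ∧
          ∀ j, q < j → j < i → s.fld (B + 3) p j = 0)) r ?_ ?_ ?_ ?_
  · rintro i t s' ⟨-, hn, -⟩
    rw [NExpr.eval, NExpr.eval, hn _ (by omega) (by omega), hr]
  · intro s' hf hn
    refine ⟨by simp, fun a h h' => ?_, hf, Or.inl ⟨?_, by simp⟩⟩
    · rw [hn a h']
      funext i
      simp [State.putNat, h]
    · rw [hn _ (by omega)]
      simp [State.putNat]
  · rintro i t s' hi ⟨ht, hn, hf, hq⟩ hc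
    have e5 : s'.nat (B + 5) 0 = p := by rw [hn _ (by omega) (by omega), hp]
    refine Exec.ite (fun hb => ?_) (fun hb => ?_)
    · simp only [Test.Holds, FExpr.eval, NExpr.eval, e5, hc, hf] at hb
      refine Exec.setNat ?_
      simp only [NExpr.eval, hc]
      refine ⟨by simpa [State.putNat] using hc, fun s'' hf'' hn'' => ⟨?_, ?_, hf''.trans hf, Or.inr
        ⟨i, Nat.lt_succ_self i, ?_, hb, fun j h1 h2 => by omega⟩⟩⟩
      · simp only [Test.cost, FExpr.cost, NExpr.cost]
        linarith
      · intro a h h'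
        rw [hn'' a h', ← hn a h h']
        funext j
        simp [State.putNat, h]
      · rw [hn'' _ (by omega)]
        simp [State.putNat]
    · simp only [Test.Holds, FExpr.eval, NExpr.eval, e5, hc, hf, not_not] at hb
      refine Exec.skip ⟨hc, fun s'' hf'' hn'' => ⟨?_, ?_, hf''.trans hf, ?_⟩⟩
      · simp only [Test.cost, FExpr.cost, NExpr.cost]
        linarith
      · intro a h h'
        rw [hn'' a h', hn a h h']
      · rw [hn'' _ (by omega)]
        rcases hq with ⟨h1, h2⟩ | ⟨q, h1, h2, h3, h4⟩
        · refine Or.inl ⟨h1, fun j hj => ?_⟩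
          rcases Nat.lt_succ_iff_lt_or_eq.mp hj with h | rfl
          · exact h2 j h
          · exact hb
        · refine Or.inr ⟨q, by omega, h2, h3, fun j hj hj' => ?_⟩
          rcases Nat.lt_succ_iff_lt_or_eq.mp hj' with h | rfl
          · exact h4 j hj h
          · exact hb
  · rintro t s' ⟨ht, hn, hf, hq⟩
    refine ⟨?_, hn, hf, hq⟩
    simp only [NExpr.cost]
    omega

/-- Gaussian elimination of the array `B + 3`. -/
def eliminate (B : ℕ) : Prog :=
  forLoop (B + 5) (.var (B + 1))
    (.seq (search B)
      (.ite (.natLt (.var (B + 6)) (.var (B + 1)))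
        (pivot B (B + 3) (.var (B + 5)) (.var (B + 6))) .skip))

/-- A nonzero entry of the current row is an admissible extension of the selection by
`selDet_snoc_iff`, so the search carries out the greedy step. There are at most `r` pivots on an
array of side `2r`. -/
theorem exec_eliminate {s : State K} (henv : Env B Q₁ Q₂ z s)
    (hout : ∀ i < n, s.nat (B + 9) i = 0)
    (hrel : ElimRel (Y₀ Q₁ Q₂ z) (Sel.nil r) (s.fld (B + 3))) :
    Exec (eliminate B) s fun t s' =>
      t ≤ r * (100 * (r + 1) + 600 * ((r + r + 1) * (r + r + 1)) + 30) + 10 ∧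
      Env B Q₁ Q₂ z s' ∧ (∀ i < n, s'.nat (B + 9) i = 0) ∧
      ElimRel (Y₀ Q₁ Q₂ z) (outSel Q₁ Q₂ z) (s'.fld (B + 3)) := by
  refine Exec.for (fun i t s' =>
    t ≤ i * (100 * (r + 1) + 600 * ((r + r + 1) * (r + r + 1)) + 10) ∧ Env B Q₁ Q₂ z s' ∧
    (∀ i < n, s'.nat (B + 9) i = 0) ∧
    ElimRel (Y₀ Q₁ Q₂ z) (selRun (SelDet (Y₀ Q₁ Q₂ z)) i) (s'.fld (B + 3))) r ?_ ?_ ?_ ?_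
  · rintro i t s' ⟨-, he, -⟩
    exact he.r_eq
  · intro s' hf hn
    refine ⟨by simp, henv.congr ?_ ?_, ?_, ?_⟩
    · intro a _ _
      exact hn a (by omega)
    · intro a _ _
      rw [hf]
    · intro i hi
      rw [hn _ (by omega), hout i hi]
    · rw [hf]
      exact hrel
  · rintro i t s' hi ⟨ht, he, ho, hM⟩ hc
    have hdet := selDet_selRun (Y₀ Q₁ Q₂ z) i
    have hrun := selRun_succ (SelDet (Y₀ Q₁ Q₂ z)) ⟨i, hi⟩
    simp only at hrun
    refine Exec.seq (exec_search he.r_eq hc) ?_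
    rintro t₁ s₁ ⟨ht₁, hn₁, hf₁, hq₁⟩
    have hr₁ : s₁.nat (B + 1) 0 = r := by rw [hn₁ _ (by omega) (by omega), he.r_eq]
    refine Exec.ite (fun hb => ?_) (fun hb => ?_)
    · simp only [Test.Holds, NExpr.eval, hr₁] at hb
      obtain ⟨q, hq, hq', hne, hlast⟩ : ∃ q < r, s₁.nat (B + 6) 0 = q ∧ s'.fld (B + 3) i q ≠ 0 ∧
          ∀ j, q < j → j < r → s'.fld (B + 3) i j = 0 := by
        rcases hq₁ with ⟨h1, -⟩ | h
        · omega
        · exact h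
      have hsel : selRun (SelDet (Y₀ Q₁ Q₂ z)) (i + 1) =
          (selRun (SelDet (Y₀ Q₁ Q₂ z)) i).snoc ⟨i, hi⟩ ⟨q, hq⟩ := by
        rw [hrun]
        refine selStep_of_last ?_ fun j hj => ?_
        · rw [selDet_snoc_iff hdet, ← (hM ⟨i, hi⟩ ⟨q, hq⟩).1]
          exact hne
        · rw [selDet_snoc_iff hdet, ← (hM ⟨i, hi⟩ j).1, not_not]
          exact hlast j hj j.2
      have hp : schur (Y₀ Q₁ Q₂ z) (selRun (SelDet (Y₀ Q₁ Q₂ z)) i) ⟨i, hi⟩ ⟨q, hq⟩ ≠ 0 := by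
        rw [← (hM ⟨i, hi⟩ ⟨q, hq⟩).1]
        exact hne
      refine (exec_pivot (S := r + r) (by omega) (by omega) i q ?_ ?_ (by simp [NExpr.cost])
        (by simp [NExpr.cost])).mono ?_
      · rw [hn₁ _ (by omega) (by omega), he.two_r]
      · intro s'' hn
        simp only [NExpr.eval]
        rw [hn _ (by omega) (by omega), hn _ (by omega) (by omega), hq',
          hn₁ _ (by omega) (by omega), hc]
        exact ⟨rfl, rfl⟩
      · rintro t₂ s₂ ⟨ht₂, hn₂, hf₂, hA₂⟩
        refine ⟨?_, fun s₃ hf₃ hn₃ => ⟨?_, he.congr ?_ ?_, ?_, ?_⟩⟩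
        · rw [hn₂ _ (by omega) (by omega), hn₁ _ (by omega) (by omega), hc]
        · simp only [Test.cost, NExpr.cost]
          linarith
        · intro a _ _
          rw [hn₃ a (by omega), hn₂ a (by omega) (by omega), hn₁ a (by omega) (by omega)]
        · intro a _ _
          rw [hf₃, hf₂ a (by omega) (by omega) (by omega), hf₁]
        · intro j hj
          rw [hn₃ _ (by omega), hn₂ _ (by omega) (by omega), hn₁ _ (by omega) (by omega), ho j hj]
        · rw [hsel, hf₃, hA₂, hf₁]
          exact hM.snoc hdet hp
    · simp only [Test.Holds, NExpr.eval, hr₁] at hb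
      have hzero : ∀ j < r, s'.fld (B + 3) i j = 0 := by
        rcases hq₁ with ⟨-, h⟩ | ⟨q, h1, h2, -⟩
        · exact h
        · omega
      have hsel : selRun (SelDet (Y₀ Q₁ Q₂ z)) (i + 1) = selRun (SelDet (Y₀ Q₁ Q₂ z)) i := by
        rw [hrun]
        refine selStep_of_forall_not fun j => ?_
        rw [selDet_snoc_iff hdet, ← (hM ⟨i, hi⟩ j).1, not_not]
        exact hzero j j.2
      refine Exec.skip ⟨?_, fun s₃ hf₃ hn₃ => ⟨?_, he.congr ?_ ?_, ?_, ?_⟩⟩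
      · rw [hn₁ _ (by omega) (by omega), hc]
      · simp only [Test.cost, NExpr.cost]
        have := Nat.zero_le (600 * ((r + r + 1) * (r + r + 1)))
        linarith
      · intro a _ _
        rw [hn₃ a (by omega), hn₁ a (by omega) (by omega)]
      · intro a _ _
        rw [hf₃, hf₁]
      · intro j hj
        rw [hn₃ _ (by omega), hn₁ _ (by omega) (by omega), ho j hj]
      · rw [hsel, hf₃, hf₁]
        exact hM
  · rintro t s' ⟨ht, he, ho, hM⟩
    refine ⟨?_, he, ho, hM⟩
    simp only [NExpr.cost]
    linarith

end Elim

end MatInt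

namespace MatInt

/-! ### The scan on the machine and the whole program -/

section Scan

variable {K : Type*} [Field K] {B n r : ℕ} {Q₁ : Matrix (Fin r) (Fin n) K}
  {Q₂ : Matrix (Fin n) (Fin r) K} {z : Fin n → K}

/-- The integer array `B + 9` marks the elements chosen in the first `t` steps of the scan. -/
def Marks (B : ℕ) (Q₁ : Matrix (Fin r) (Fin n) K) (Q₂ : Matrix (Fin n) (Fin r) K) (z : Fin n → K)
    (t : ℕ) (s : State K) : Prop :=
  ∀ i : Fin n, s.nat (B + 9) i ≠ 0 ↔ i ∈ (outState Q₁ Q₂ z t).J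

theorem Marks.congr {t : ℕ} {s s' : State K} (h : Marks B Q₁ Q₂ z t s)
    (hn : s'.nat (B + 9) = s.nat (B + 9)) : Marks B Q₁ Q₂ z t s' := by
  intro i
  rw [hn]
  exact h i

/-- Processing of the elements of a block after the preparation of the array `B + 4`. -/
def scanElements (B : ℕ) : Prog :=
  forLoop (B + 5) (.var (B + 1))
    (.ite (.not (.fldEq (.get (B + 4) (.add (.var (B + 1)) (.var (B + 5)))
        (.add (.var (B + 1)) (.var (B + 5)))) .zero))
      (.seq (pivot B (B + 4) (.add (.var (B + 1)) (.var (B + 5)))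
          (.add (.var (B + 1)) (.var (B + 5))))
        (.setNat (B + 9) (.add (.var (B + 4)) (.var (B + 5))) (.const 1)))
      .skip)

/-- Amortized accounting: every element is charged a constant, and the cost of a pivot is charged to
the increase of `|J|`. The term on the left lets these bounds be added over the blocks. -/
theorem exec_scanElements (hz : ∀ i, z i ≠ 0) {v : ℕ} {s : State K} (henv : Env B Q₁ Q₂ z s)
    (hv : s.nat (B + 4) 0 = v) (hmarks : Marks B Q₁ Q₂ z v s)
    (hrel : ScanRel (outMat Q₁ Q₂ z v) (colBlock Q₁ v) (rowBlock Q₂ v) (s.fld (B + 4))) :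
    Exec (scanElements B) s fun t s' =>
      t + (outState Q₁ Q₂ z v).J.card * (600 * ((r + r + 1) * (r + r + 1)) + 10) ≤
        r * 40 + 10 + (outState Q₁ Q₂ z (v + r)).J.card *
          (600 * ((r + r + 1) * (r + r + 1)) + 10) ∧
      Env B Q₁ Q₂ z s' ∧ s'.nat (B + 4) 0 = v ∧ Marks B Q₁ Q₂ z (v + r) s' ∧
      ∀ i j : Fin r, s'.fld (B + 4) i j = outMat Q₁ Q₂ z (v + r) i j := by
  set c := 600 * ((r + r + 1) * (r + r + 1)) + 10 with hcdef
  refine Exec.for (fun p t s' =>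
    t + (outState Q₁ Q₂ z v).J.card * c ≤ p * 20 + (outState Q₁ Q₂ z (v + p)).J.card * c ∧
    Env B Q₁ Q₂ z s' ∧ s'.nat (B + 4) 0 = v ∧ Marks B Q₁ Q₂ z (v + p) s' ∧
    ScanRel (outMat Q₁ Q₂ z (v + p)) (colBlock Q₁ v) (rowBlock Q₂ v) (s'.fld (B + 4))) r
    ?_ ?_ ?_ ?_
  · rintro i t s' ⟨-, he, -⟩
    exact he.r_eq
  · intro s' hf hn
    refine ⟨by simp, henv.congr ?_ ?_, ?_, hmarks.congr (hn _ (by omega)), ?_⟩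
    · intro a _ _
      exact hn a (by omega)
    · intro a _ _
      rw [hf]
    · rw [hn _ (by omega), hv]
    · rw [hf]
      exact hrel
  · rintro p t s' hp ⟨ht, he, hv', hm, hN⟩ hc
    have hstep := outMat_block_step Q₁ Q₂ hz v ⟨p, hp⟩
    have hent := (hN ⟨p, hp⟩ ⟨p, hp⟩).2.2.2
    simp only at hstep hent
    rw [← hent] at hstep
    refine Exec.ite (fun hb => ?_) (fun hb => ?_)
    · simp only [Test.Holds, FExpr.eval, NExpr.eval, he.r_eq, hc] at hb
      obtain ⟨h, hJ, hnot, hW⟩ := hstep.1 hb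
      refine Exec.seq (exec_pivot (S := r + r) (by omega) (by omega) (r + p) (r + p) he.two_r ?_
        (by simp [NExpr.cost]) (by simp [NExpr.cost])) ?_
      · intro s'' hn
        simp only [NExpr.eval]
        rw [hn _ (by omega) (by omega), hn _ (by omega) (by omega), he.r_eq, hc]
        exact ⟨rfl, rfl⟩
      · rintro t₁ s₁ ⟨ht₁, hn₁, hf₁, hA₁⟩
        have e4 : s₁.nat (B + 4) 0 = v := by rw [hn₁ _ (by omega) (by omega), hv']
        have e5 : s₁.nat (B + 5) 0 = p := by rw [hn₁ _ (by omega) (by omega), hc]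
        have hput : ∀ a, a ≠ B + 9 → (s₁.putNat (B + 9) (v + p) 1).nat a = s₁.nat a := by
          intro a ha
          funext i
          simp [State.putNat, ha]
        refine Exec.setNat ?_
        simp only [NExpr.eval, e4, e5]
        refine ⟨by rw [hput _ (by omega), e5], fun s₃ hf₃ hn₃ =>
          ⟨?_, he.congr ?_ ?_, ?_, ?_, ?_⟩⟩
        · rw [← add_assoc v, hJ, Finset.card_insert_of_notMem hnot]
          simp only [Test.cost, FExpr.cost, NExpr.cost]
          linarith
        · intro a _ _
          rw [hn₃ a (by omega), hput a (by omega), hn₁ a (by omega) (by omega)]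
        · intro a _ _
          rw [hf₃]
          exact hf₁ a (by omega) (by omega) (by omega)
        · rw [hn₃ _ (by omega), hput _ (by omega), e4]
        · intro i
          rw [hn₃ _ (by omega), ← add_assoc v, hJ, Finset.mem_insert]
          simp only [State.putNat, true_and]
          split_ifs with hi
          · simp [Fin.ext_iff, hi]
          · rw [hn₁ _ (by omega) (by omega), hm i]
            simp [Fin.ext_iff, hi]
        · have := hN.pivot ⟨p, hp⟩
          simp only at this
          rw [← hent, ← hW] at this
          rw [hf₃]
          change ScanRel _ _ _ (s₁.fld (B + 4))
          rw [hA₁]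
          exact this
    · simp only [Test.Holds, FExpr.eval, NExpr.eval, he.r_eq, hc, not_not] at hb
      obtain ⟨hJ, hW⟩ := hstep.2 hb
      refine Exec.skip ⟨hc, fun s₃ hf₃ hn₃ => ⟨?_, he.congr ?_ ?_, ?_, ?_, ?_⟩⟩
      · rw [← add_assoc v, hJ]
        simp only [Test.cost, FExpr.cost, NExpr.cost]
        linarith
      · intro a _ _
        exact hn₃ a (by omega)
      · intro a _ _
        rw [hf₃]
      · rw [hn₃ _ (by omega), hv']
      · intro i
        rw [hn₃ _ (by omega), ← add_assoc v, hJ]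
        exact hm i
      · rw [hf₃, ← add_assoc v, hW]
        exact hN
  · rintro t s' ⟨ht, he, hv', hm, hN⟩
    refine ⟨?_, he, hv', hm, fun i j => (hN i j).1⟩
    simp only [NExpr.cost]
    linarith

/-- Processing of a block. The block starts at the integer variable `B + 4`. -/
def scanBlock (mm : Prog) (B : ℕ) : Prog :=
  .seq (mulStep mm B (B + 4) (.const 0) (.var (B + 1))
    (.get (B + 4) (.var (B + 7)) (.var (B + 8)))
    (.get B (.var (B + 7)) (.add (.var (B + 4)) (.var (B + 8)))) .zero)
  (.seq (mulStep mm B (B + 4) (.var (B + 1)) (.const 0)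
    (.get (B + 1) (.add (.var (B + 4)) (.var (B + 7))) (.var (B + 8)))
    (.get (B + 4) (.var (B + 7)) (.var (B + 8))) .zero)
  (.seq (mulStep mm B (B + 4) (.var (B + 1)) (.var (B + 1))
    (.get (B + 4) (.add (.var (B + 1)) (.var (B + 7))) (.var (B + 8)))
    (.get B (.var (B + 7)) (.add (.var (B + 4)) (.var (B + 8)))) .zero)
  (scanElements B)))

/-- The last quadrant `VXU` is computed from the quadrant `VX` already in the array, so three
multiplications prepare a block. -/
theorem exec_scanBlock {mm : Prog} {T : ℕ} (hB : 3 ≤ B) (hmm : MulSpec mm K B r T)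
    (hz : ∀ i, z i ≠ 0) {v : ℕ} (hvn : v < n) {s : State K} (henv : Env B Q₁ Q₂ z s)
    (hv : s.nat (B + 4) 0 = v) (hmarks : Marks B Q₁ Q₂ z v s)
    (hmat : ∀ i j : Fin r, s.fld (B + 4) i j = outMat Q₁ Q₂ z v i j) :
    Exec (scanBlock mm B) s fun t s' =>
      t + (outState Q₁ Q₂ z v).J.card * (600 * ((r + r + 1) * (r + r + 1)) + 10) ≤
        3 * (400 * ((r + 1) * (r + 1)) + T) + r * 40 + 10 +
        (outState Q₁ Q₂ z (v + r)).J.card * (600 * ((r + r + 1) * (r + r + 1)) + 10) ∧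
      Env B Q₁ Q₂ z s' ∧ s'.nat (B + 4) 0 = v ∧ Marks B Q₁ Q₂ z (v + r) s' ∧
      ∀ i j : Fin r, s'.fld (B + 4) i j = outMat Q₁ Q₂ z (v + r) i j := by
  set X := outMat Q₁ Q₂ z v with hX
  set U := colBlock Q₁ v with hU
  set V := rowBlock Q₂ v with hV
  have hleft : ∀ i j, i < r → j < r → s.fld B i (v + j) = natFun U i j := by
    intro i j hi hj
    rw [henv.left i (v + j) hi (by omega), natFun_of_lt U hi hj]
    rfl
  have hright : ∀ i j, i < r → j < r → s.fld (B + 1) (v + i) j = natFun V i j := by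
    intro i j hi hj
    rw [henv.right (v + i) j (by omega) hj, natFun_of_lt V hi hj]
    rfl
  have hcur : ∀ i j, i < r → j < r → s.fld (B + 4) i j = natFun X i j := by
    intro i j hi hj
    rw [natFun_of_lt X hi hj]
    exact hmat ⟨i, hi⟩ ⟨j, hj⟩
  refine Exec.seq (exec_mulStep hB (by omega) hmm henv.r_eq 0 r (natFun X) (natFun U)
    (fun _ _ => 0) ?_ ?_ ?_ ?_ (by simp [NExpr.cost]) (by simp [NExpr.cost, FExpr.cost])
    (by simp [NExpr.cost, FExpr.cost]) (by simp [FExpr.cost])) ?_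
  · intro s' hn
    simp only [NExpr.eval]
    rw [hn _ (by omega) (by omega) (by omega), henv.r_eq]
    exact ⟨trivial, rfl⟩
  · intro s' i j hi hj _ hf hci hcj
    simp only [FExpr.eval, NExpr.eval, hci, hcj, hf (B + 4) (by omega)]
    exact hcur i j hi hj
  · intro s' i j hi hj hn hf hci hcj
    simp only [FExpr.eval, NExpr.eval, hci, hcj, hf B le_rfl]
    rw [hn _ (by omega) (by omega) (by omega), hv]
    exact hleft i j hi hj
  · intros
    rfl
  rintro t₁ s₁ ⟨ht₁, hn₁, hf₁, hA₁⟩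
  have he₁ : Env B Q₁ Q₂ z s₁ := henv.congr (fun a h1 h2 => hn₁ a h1 (by omega) (by omega))
    fun a h1 h2 => hf₁ a h1 (by omega)
  refine Exec.seq (exec_mulStep hB (by omega) hmm he₁.r_eq r 0 (natFun V) (natFun X)
    (fun _ _ => 0) ?_ ?_ ?_ ?_ (by simp [NExpr.cost]) (by simp [NExpr.cost, FExpr.cost])
    (by simp [NExpr.cost, FExpr.cost]) (by simp [FExpr.cost])) ?_
  · intro s' hn
    simp only [NExpr.eval]
    rw [hn _ (by omega) (by omega) (by omega), he₁.r_eq]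
    exact ⟨rfl, trivial⟩
  · intro s' i j hi hj hn hf hci hcj
    simp only [FExpr.eval, NExpr.eval, hci, hcj, hf (B + 1) (by omega), hf₁ (B + 1) (by omega)
      (by omega)]
    rw [hn _ (by omega) (by omega) (by omega), hn₁ _ (by omega) (by omega) (by omega), hv]
    exact hright i j hi hj
  · intro s' i j hi hj _ hf hci hcj
    simp only [FExpr.eval, NExpr.eval, hci, hcj, hf (B + 4) (by omega), hA₁]
    rw [patch_out _ _ (by omega)]
    exact hcur i j hi hj
  · intros
    rfl
  rintro t₂ s₂ ⟨ht₂, hn₂, hf₂, hA₂⟩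
  have he₂ : Env B Q₁ Q₂ z s₂ := he₁.congr (fun a h1 h2 => hn₂ a h1 (by omega) (by omega))
    fun a h1 h2 => hf₂ a h1 (by omega)
  refine Exec.seq (exec_mulStep hB (by omega) hmm he₂.r_eq r r (natFun (V * X)) (natFun U)
    (fun _ _ => 0) ?_ ?_ ?_ ?_ (by simp [NExpr.cost]) (by simp [NExpr.cost, FExpr.cost])
    (by simp [NExpr.cost, FExpr.cost]) (by simp [FExpr.cost])) ?_
  · intro s' hn
    simp only [NExpr.eval]
    rw [hn _ (by omega) (by omega) (by omega), he₂.r_eq]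
    exact ⟨rfl, rfl⟩
  · intro s' i j hi hj hn hf hci hcj
    have := patch_in (s₁.fld (B + 4)) (ro := r) (co := 0)
      (fun i j => 0 + ∑ l ∈ Finset.range r, natFun V i l * natFun X l j) hi hj
    rw [zero_add, zero_add, sum_natFun_mul V X hi hj] at this
    simp only [FExpr.eval, NExpr.eval, hci, hcj, hf (B + 4) (by omega), hA₂]
    rw [hn _ (by omega) (by omega) (by omega), he₂.r_eq]
    exact this
  · intro s' i j hi hj hn hf hci hcj
    simp only [FExpr.eval, NExpr.eval, hci, hcj, hf B le_rfl, hf₂ B le_rfl (by omega),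
      hf₁ B le_rfl (by omega)]
    rw [hn _ (by omega) (by omega) (by omega), hn₂ _ (by omega) (by omega) (by omega),
      hn₁ _ (by omega) (by omega) (by omega), hv]
    exact hleft i j hi hj
  · intros
    rfl
  rintro t₃ s₃ ⟨ht₃, hn₃, hf₃, hA₃⟩
  have hnat : ∀ a, B ≤ a → a ≠ B + 7 → a ≠ B + 8 → s₃.nat a = s.nat a := fun a h h' h'' => by
    rw [hn₃ a h h' h'', hn₂ a h h' h'', hn₁ a h h' h'']
  have he₃ : Env B Q₁ Q₂ z s₃ := he₂.congr (fun a h1 h2 => hn₃ a h1 (by omega) (by omega))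
    fun a h1 h2 => hf₃ a h1 (by omega)
  refine (exec_scanElements hz he₃ (by rw [hnat _ (by omega) (by omega) (by omega), hv])
    (hmarks.congr (hnat _ (by omega) (by omega) (by omega))) ?_).mono ?_
  · intro i j
    rw [← hX, ← hU, ← hV, hA₃]
    refine ⟨?_, ?_, ?_, ?_⟩
    · rw [patch_out _ _ (by omega), hA₂, patch_out _ _ (by omega), hA₁, patch_out _ _ (by omega)]
      exact hmat i j
    · rw [patch_out _ _ (by omega), hA₂, patch_out _ _ (by omega), hA₁]
      have := patch_in (s.fld (B + 4)) (ro := 0) (co := r)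
        (fun i j => 0 + ∑ l ∈ Finset.range r, natFun X i l * natFun U l j) i.2 j.2
      rwa [zero_add, zero_add, sum_natFun_mul X U i.2 j.2, natFun_fin] at this
    · rw [patch_out _ _ (by omega), hA₂]
      have := patch_in (s₁.fld (B + 4)) (ro := r) (co := 0)
        (fun i j => 0 + ∑ l ∈ Finset.range r, natFun V i l * natFun X l j) i.2 j.2
      rwa [zero_add, zero_add, sum_natFun_mul V X i.2 j.2, natFun_fin] at this
    · rw [patch_in _ _ i.2 j.2, zero_add, sum_natFun_mul (V * X) U i.2 j.2, natFun_fin]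
  · rintro t₄ s₄ ⟨ht₄, h⟩
    exact ⟨by linarith, h⟩

/-- The scan, with the inverse of the selected submatrix taken from array `B + 3`. -/
def scan (mm : Prog) (B : ℕ) : Prog :=
  .seq (fill (B + 7) (B + 8) (B + 4) (.const 0) (.const 0) (.var (B + 1)) (.var (B + 1))
    (.sub .zero (.get (B + 3) (.add (.var (B + 1)) (.var (B + 7)))
      (.add (.var (B + 1)) (.var (B + 8))))))
  (.seq (blockLoop B (scanBlock mm B))
  (fillNat (B + 8) 1 (.var B) (.get (B + 9) (.var (B + 8)))))

theorem outState_numBlocks (hr : 1 ≤ r) :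
    (outState Q₁ Q₂ z (numBlocks n r * r)).J = outSet Q₁ Q₂ z := by
  rw [outState, algState_of_le _ _ _ _ _ (le_numBlocks_mul hr)]
  rfl

theorem exec_scan {mm : Prog} {T : ℕ} (hB : 3 ≤ B) (hmm : MulSpec mm K B r T) (hr : 1 ≤ r)
    (hz : ∀ i, z i ≠ 0) {s : State K} (henv : Env B Q₁ Q₂ z s) (hout : ∀ i < n, s.nat (B + 9) i = 0)
    (hrel : ElimRel (Y₀ Q₁ Q₂ z) (outSel Q₁ Q₂ z) (s.fld (B + 3))) :
    Exec (scan mm B) s fun t s' =>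
      t ≤ 100 * ((r + 1) * (r + 1)) + numBlocks n r * (3 * (400 * ((r + 1) * (r + 1)) + T) +
        r * 40 + 23) + r * (600 * ((r + r + 1) * (r + r + 1)) + 10) + 100 * (n + 1) + 9 ∧
      outputSet n s' = outSet Q₁ Q₂ z := by
  set c := 600 * ((r + r + 1) * (r + r + 1)) + 10 with hcdef
  -- The elimination has left minus the placed inverse in its last quadrant; the subtraction from
  -- zero restores the sign.
  refine Exec.seq (exec_fill (by omega) 0 0 r r
    (fun i j => 0 - s.fld (B + 3) (r + i) (r + j)) ?_ ?_ (by simp [NExpr.cost, FExpr.cost])) ?_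
  · intro s' h
    simp [NExpr.eval, h, henv.r_eq]
  · intro s' i j _ _ hn hf hci hcj _
    have e1 : s'.nat (B + 1) 0 = r := by rw [hn _ (by omega) (by omega), henv.r_eq]
    simp only [FExpr.eval, NExpr.eval, hci, hcj, hf (B + 3) (by omega), e1]
  rintro t₁ s₁ ⟨ht₁, hn₁, hf₁, hA₁⟩
  have he₁ : Env B Q₁ Q₂ z s₁ := henv.congr (fun a h1 h2 => hn₁ a (by omega) (by omega))
    fun a h1 h2 => hf₁ a (by omega)
  have hJ0 : (outState Q₁ Q₂ z 0).J = ∅ := rfl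
  refine Exec.seq (P := fun t s' => t ≤ numBlocks n r * (3 * (400 * ((r + 1) * (r + 1)) + T) +
      r * 40 + 23) + r * c + 9 ∧ Env B Q₁ Q₂ z s' ∧ Marks B Q₁ Q₂ z (numBlocks n r * r) s')
    (exec_blockLoop (Q₁ := Q₁) (Q₂ := Q₂) (z := z) hr (fun b t s' =>
      t ≤ b * (3 * (400 * ((r + 1) * (r + 1)) + T) + r * 40 + 10) +
        (outState Q₁ Q₂ z (b * r)).J.card * c ∧
      Env B Q₁ Q₂ z s' ∧ Marks B Q₁ Q₂ z (b * r) s' ∧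
      ∀ i j : Fin r, s'.fld (B + 4) i j = outMat Q₁ Q₂ z (b * r) i j)
      (fun i t s h => h.2.1) ?_ ?_ ?_) ?_
  · intro s' hf hn
    refine ⟨by simp, he₁.congr ?_ ?_, ?_, ?_⟩
    · intro a _ _
      exact hn a (by omega)
    · intro a _ _
      rw [hf]
    · intro i
      rw [zero_mul, hJ0, hn _ (by omega), hn₁ _ (by omega) (by omega), hout i i.2]
      simp
    · intro i j
      rw [hf, hA₁, patch_zero_zero _ _ i.2 j.2, zero_mul, outMat_zero, (hrel i j).2.2.2]
      simp
  · rintro b t s' hb ⟨ht, he, hm, hX⟩ hvs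
    refine (exec_scanBlock hB hmm hz hb he hvs hm hX).mono ?_
    rintro t' s'' ⟨ht', he', hv', hm', hX'⟩
    have e : (b + 1) * r = b * r + r := by ring
    rw [← hcdef] at ht'
    refine ⟨hv', he', fun s₃ hf₃ hn₃ => ⟨?_, he'.congr ?_ ?_, ?_, ?_⟩⟩
    · rw [e, add_mul b, one_mul]
      linarith
    · intro a _ _
      exact hn₃ a (by omega)
    · intro a _ _
      rw [hf₃]
    · rw [e]
      exact hm'.congr (hn₃ _ (by omega))
    · rw [e, hf₃]
      exact hX'
  · rintro t s' ⟨ht, he, hm, -⟩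
    refine ⟨?_, he, hm⟩
    -- At most `r` elements are accepted over all blocks, so the pivots of the scan cost at most `r
    -- * c` in total.
    have := Nat.mul_le_mul_right c (card_outState_le Q₁ Q₂ hz (numBlocks n r * r))
    linarith
  rintro t₂ s₂ ⟨ht₂, he₂, hm₂⟩
  refine (exec_fillNat (by omega) n (fun i => s₂.nat (B + 9) i) ?_ ?_
    (by simp [NExpr.cost])).mono ?_
  · intro s' h
    rw [NExpr.eval, NExpr.eval, h _ (by omega) (by omega), he₂.n_eq]
  · intro s' i _ h hi
    simp only [NExpr.eval, hi]
    rw [h _ (by omega) (by omega)]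
  · rintro t₃ s₃ ⟨ht₃, -, -, h1⟩
    refine ⟨by linarith, ?_⟩
    rw [← outState_numBlocks hr]
    ext i
    rw [outputSet, Finset.mem_filter, h1 i i.2, hm₂ i]
    simp

/-- The program for matroid intersection that multiplies matrices by the program `mm`. -/
def intersection (mm : Prog) (B : ℕ) : Prog :=
  .seq (storeSizes B) (.seq (copyInput B) (.seq (initArrays B) (.seq (accumulate mm B)
    (.seq (eliminate B) (scan mm B)))))

theorem exec_intersection {mm : Prog} {T : ℕ} (hB : 3 ≤ B) (hmm : MulSpec mm K B r T) (hr : 1 ≤ r)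
    (hrn : r ≤ n) (hz : ∀ i, z i ≠ 0) {s : State K} (hs : HoldsInput Q₁ Q₂ z s) :
    Exec (intersection mm B) s fun t s' =>
      t ≤ 30000 * (n * r + r ^ 3) + 4 * (numBlocks n r * T) ∧ outputSet n s' = outSet Q₁ Q₂ z := by
  obtain ⟨h0, h1, h2, h3, h4⟩ := hs
  refine Exec.seq (exec_storeSizes hB h0 h1) ?_
  rintro t₁ s₁ ⟨ht₁, hf₁, hsz⟩
  refine Exec.seq (exec_copyInput (Q₁ := Q₁) (Q₂ := Q₂) (z := z) hB hr hrn ?_ ?_ ?_ hsz) ?_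
  · rwa [hf₁]
  · rwa [hf₁]
  · rwa [hf₁]
  rintro t₂ s₂ ⟨ht₂, he₂⟩
  refine Exec.seq (exec_initArrays hr hrn he₂) ?_
  rintro t₃ s₃ ⟨ht₃, he₃, ho₃, hM₃⟩
  refine Exec.seq (exec_accumulate hB hmm hr he₃ ho₃ hM₃) ?_
  rintro t₄ s₄ ⟨ht₄, he₄, ho₄, hM₄⟩
  refine Exec.seq (exec_eliminate he₄ ho₄ hM₄) ?_
  rintro t₅ s₅ ⟨ht₅, he₅, ho₅, hM₅⟩
  refine (exec_scan hB hmm hr hz he₅ ho₅ hM₅).mono ?_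
  rintro t₆ s₆ ⟨ht₆, hout⟩
  refine ⟨?_, hout⟩
  -- Since `r ≤ n`, there are at most `2 * n / r` blocks, and costs of order `r²` in each add up to
  -- order `nr`. The term `r ^ 3` pays for the pivots; the factor `4` counts one product per block
  -- for `Y` and three for the scan.
  have hb : numBlocks n r * r ≤ 2 * n := by
    have := numBlocks_mul_lt (n := n) hr
    omega
  have hb1 : numBlocks n r * (r * r) ≤ 2 * (n * r) := by
    rw [← mul_assoc, ← mul_assoc]
    exact Nat.mul_le_mul_right r hb
  have hb2 : numBlocks n r ≤ numBlocks n r * (r * r) := Nat.le_mul_of_pos_right _ (by positivity)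
  have hb3 : numBlocks n r * r ≤ numBlocks n r * (r * r) :=
    Nat.mul_le_mul_left _ (Nat.le_mul_of_pos_right _ hr)
  have hr1 : r ≤ r * r := Nat.le_mul_of_pos_right _ hr
  have hr3 : r * r ≤ r ^ 3 := by
    rw [pow_succ, pow_two]
    exact Nat.le_mul_of_pos_right _ hr
  have hrr : r * (r * r) = r ^ 3 := by ring
  have hn1 : n ≤ n * r := Nat.le_mul_of_pos_right _ hr
  linarith

end Scan

end MatInt

namespace MatInt

/-! ### Bounds with real exponents -/

section Bounds

theorem rpow_sub_one_mul {r : ℕ} (hr : 1 ≤ r) (ω : ℝ) :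
    (r : ℝ) ^ (ω - 1) * r = (r : ℝ) ^ ω := by
  have hr0 : (0 : ℝ) < r := by exact_mod_cast hr
  rw [← Real.rpow_add_one hr0.ne', sub_add_cancel]

/-- From `numBlocks n r * r ≤ 2 * n`, the products cost at most `4 * 2 * |C| * n * r ^ (ω - 1)`. The
term `nr` is absorbed because `r ≤ r ^ (ω - 1)` for `ω ≥ 2`. The absolute value is there because `C`
may be negative. -/
theorem intersection_steps_le {n r : ℕ} {ω : ℝ} (hω : 2 ≤ ω) (hr : 1 ≤ r) (hrn : r ≤ n) (C : ℝ)
    {t : ℕ} (ht : t ≤ 30000 * (n * r + r ^ 3) + 4 * (numBlocks n r * ⌊C * (r : ℝ) ^ ω⌋₊)) :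
    (t : ℝ) ≤ (30000 + 8 * |C|) * ((n : ℝ) * (r : ℝ) ^ (ω - 1) + (r : ℝ) ^ 3) := by
  have hr1 : (1 : ℝ) ≤ r := by exact_mod_cast hr
  have hpos : (0 : ℝ) ≤ (r : ℝ) ^ (ω - 1) := Real.rpow_nonneg (by linarith) _
  have hle : (r : ℝ) ≤ (r : ℝ) ^ (ω - 1) := by
    simpa using Real.rpow_le_rpow_of_exponent_le hr1 (show (1 : ℝ) ≤ ω - 1 by linarith)
  have hT : (⌊C * (r : ℝ) ^ ω⌋₊ : ℝ) ≤ |C| * ((r : ℝ) ^ (ω - 1) * r) := by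
    rw [rpow_sub_one_mul hr]
    have h0 : (0 : ℝ) ≤ (r : ℝ) ^ ω := Real.rpow_nonneg (by linarith) _
    refine le_trans ?_ (Nat.floor_le (mul_nonneg (abs_nonneg C) h0))
    exact_mod_cast Nat.floor_mono (mul_le_mul_of_nonneg_right (le_abs_self C) h0)
  have hb : (numBlocks n r : ℝ) * r ≤ 2 * n := by
    have := numBlocks_mul_lt (n := n) hr
    exact_mod_cast (show numBlocks n r * r ≤ 2 * n by omega)
  have ht' : (t : ℝ) ≤ 30000 * (n * r + r ^ 3) + 4 * (numBlocks n r * ⌊C * (r : ℝ) ^ ω⌋₊) := by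
    exact_mod_cast ht
  have h1 : (n : ℝ) * r ≤ n * (r : ℝ) ^ (ω - 1) := mul_le_mul_of_nonneg_left hle n.cast_nonneg
  have h2 : (numBlocks n r : ℝ) * ⌊C * (r : ℝ) ^ ω⌋₊ ≤ 2 * n * (|C| * (r : ℝ) ^ (ω - 1)) :=
    calc (numBlocks n r : ℝ) * ⌊C * (r : ℝ) ^ ω⌋₊
        ≤ numBlocks n r * (|C| * ((r : ℝ) ^ (ω - 1) * r)) :=
          mul_le_mul_of_nonneg_left hT (Nat.cast_nonneg _)
      _ = numBlocks n r * r * (|C| * (r : ℝ) ^ (ω - 1)) := by ring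
      _ ≤ _ := mul_le_mul_of_nonneg_right hb (mul_nonneg (abs_nonneg C) hpos)
  have h3 : (0 : ℝ) ≤ |C| * (r : ℝ) ^ 3 := by positivity
  linarith

/-- The base `max 3 mm.bound` protects the data from `mm` and keeps them apart from the interface
arrays `0`, `1`, `2`, even if `mm` writes to fewer arrays. -/
theorem solves_intersection {F K : Type*} [Field F] [Field K] [Algebra F K] {mm : Prog} {ω C : ℝ}
    (hω : 2 ≤ ω) (hmm : MultipliesMatrices mm K ω C) {n r : ℕ} (hr : 1 ≤ r) (hrn : r ≤ n) {T : ℝ}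
    (hT : (30000 + 8 * |C|) * ((n : ℝ) * (r : ℝ) ^ (ω - 1) + (r : ℝ) ^ 3) ≤ T) :
    SolvesMatroidIntersection (intersection mm (max 3 mm.bound)) F K n r T 2 := by
  refine solvesMatroidIntersection_of_outputs_outSet hrn fun Q₁ Q₂ z hz s hs => ?_
  obtain ⟨t, s', hrun, ht, hout⟩ := exec_intersection (le_max_left _ _)
    (mulSpec_of_multipliesMatrices hmm (le_max_right 3 mm.bound) hr) hr hrn hz hs
  exact ⟨t, s', hrun, (intersection_steps_le hω hr hrn C ht).trans hT, hout⟩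

/-- Write `r ^ 3 = r ^ (4 - ω) * r ^ (ω - 1)` and bound the first factor by `a⁻¹ * n`. -/
theorem add_cube_le {n r : ℕ} (hr : 1 ≤ r) {ω a : ℝ} (ha : 0 < a)
    (h : a * (r : ℝ) ^ (4 - ω) ≤ n) :
    (n : ℝ) * (r : ℝ) ^ (ω - 1) + (r : ℝ) ^ 3 ≤ (1 + a⁻¹) * ((n : ℝ) * (r : ℝ) ^ (ω - 1)) := by
  have hr0 : (0 : ℝ) < r := by exact_mod_cast hr
  have hcube : (r : ℝ) ^ 3 = (r : ℝ) ^ (4 - ω) * (r : ℝ) ^ (ω - 1) := by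
    rw [← Real.rpow_add hr0, ← Real.rpow_natCast]
    congr 1
    push_cast
    ring
  have h1 : (r : ℝ) ^ (4 - ω) ≤ a⁻¹ * n := by
    rwa [inv_mul_eq_div, le_div_iff₀' ha]
  have h2 := mul_le_mul_of_nonneg_right h1 (Real.rpow_nonneg hr0.le (ω - 1))
  rw [hcube]
  linarith

end Bounds

/-! ### Naive matrix multiplication -/

section Naive

variable {K : Type*} [Field K]

/-- The naive program for matrix multiplication. -/
def naiveMul : Prog :=
  .seq (fill 1 2 2 (.const 0) (.const 0) (.var 0) (.var 0) .zero)
  (forLoop 3 (.var 0) (fill 1 2 2 (.const 0) (.const 0) (.var 0) (.var 0)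
    (.add (.get 2 (.var 1) (.var 2)) (.mul (.get 0 (.var 1) (.var 3)) (.get 1 (.var 3) (.var 2))))))

/-- The outer loop runs over the summation index, so each round adds one outer product in place by a
single fill. -/
theorem exec_naiveMul {m : ℕ} (hm : 1 ≤ m) {s : State K} (hs : s.nat 0 0 = m) :
    Exec naiveMul s fun t s' => t ≤ 1000 * m ^ 3 ∧ ∀ i j, i < m → j < m →
      s'.fld 2 i j = ∑ l ∈ Finset.range m, s.fld 0 i l * s.fld 1 l j := by
  refine Exec.seq (exec_fill (by omega) 0 0 m m (fun _ _ => 0) ?_ ?_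
    (by simp [NExpr.cost, FExpr.cost])) ?_
  · intro s' h
    simp [NExpr.eval, h, hs]
  · intros
    rfl
  rintro t₁ s₁ ⟨ht₁, hn₁, hf₁, hA₁⟩
  refine Exec.for (fun l t s' => t ≤ l * (100 * ((m + 1) * (m + 1))) ∧
    s'.nat 0 = s.nat 0 ∧ s'.fld 0 = s.fld 0 ∧ s'.fld 1 = s.fld 1 ∧ ∀ i j, i < m → j < m →
      s'.fld 2 i j = ∑ l ∈ Finset.range l, s.fld 0 i l * s.fld 1 l j) m ?_ ?_ ?_ ?_
  · rintro l t s' ⟨-, h, -⟩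
    rw [NExpr.eval, NExpr.eval, h, hs]
  · intro s' hf hn
    refine ⟨by simp, ?_, ?_, ?_, ?_⟩
    · rw [hn _ (by omega), hn₁ _ (by omega) (by omega)]
    · rw [hf, hf₁ _ (by omega)]
    · rw [hf, hf₁ _ (by omega)]
    · intro i j hi hj
      rw [hf, hA₁, patch_zero_zero _ _ hi hj, Finset.range_zero, Finset.sum_empty]
  · rintro l t s' hl ⟨ht, hn, hf0, hf1, hsum⟩ hc
    refine (exec_fill (by omega) 0 0 m m (fun i j => s'.fld 2 i j + s.fld 0 i l * s.fld 1 l j)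
      ?_ ?_ (by simp [NExpr.cost, FExpr.cost])).mono ?_
    · intro s'' h
      simp [NExpr.eval, h, hn, hs]
    · intro s'' i j hi hj hn' hf' hci hcj hown
      have e3 : s''.nat 3 0 = l := by rw [hn' _ (by omega) (by omega), hc]
      rw [zero_add, zero_add] at hown
      simp only [FExpr.eval, NExpr.eval, hci, hcj, e3, hown, hf' 0 (by omega), hf' 1 (by omega),
        hf0, hf1]
    · rintro t₂ s₂ ⟨ht₂, hn₂, hf₂, hA₂⟩
      refine ⟨by rw [hn₂ _ (by omega) (by omega), hc], fun s₃ hf₃ hn₃ => ⟨?_, ?_, ?_, ?_, ?_⟩⟩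
      · linarith
      · rw [hn₃ _ (by omega), hn₂ _ (by omega) (by omega), hn]
      · rw [hf₃, hf₂ _ (by omega), hf0]
      · rw [hf₃, hf₂ _ (by omega), hf1]
      · intro i j hi hj
        rw [hf₃, hA₂, patch_zero_zero _ _ hi hj, hsum i j hi hj, Finset.sum_range_succ]
  · rintro t s' ⟨ht, -, -, -, hsum⟩
    refine ⟨?_, hsum⟩
    simp only [NExpr.cost]
    have h1 : m ≤ m * m := Nat.le_mul_of_pos_right _ hm
    have h2 : m * m ≤ m ^ 3 := by
      rw [pow_succ, pow_two]
      exact Nat.le_mul_of_pos_right _ hm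
    have h3 : m * (m * m) = m ^ 3 := by ring
    linarith

theorem multipliesMatrices_naiveMul (K : Type*) [Field K] : MultipliesMatrices naiveMul K 3 1000 :=
    by
  intro m hm X Y s hs hX hY
  obtain ⟨t, s', hrun, ht, hsum⟩ := exec_naiveMul hm hs
  refine ⟨t, s', hrun, ?_, fun i j => ?_⟩
  · have : ((3 : ℕ) : ℝ) = 3 := by norm_num
    rw [← this, Real.rpow_natCast]
    exact_mod_cast ht
  · rw [hsum i j i.2 j.2, Matrix.mul_apply, ← Fin.sum_univ_eq_sum_range
      (fun l => s.fld 0 i l * s.fld 1 l j)]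
    exact Finset.sum_congr rfl fun l _ => by rw [hX, hY]

end Naive

end MatInt

/-! ### The theorem -/

theorem mainTheorem10 :
    -- the scan maintains `𝒴(J)` and the current diagonal block of `Z(J)⁻¹`, and tests correctly
    (∀ (K : Type*) [Field K] (n k r : ℕ) (Q₁ : Matrix (Fin k) (Fin n) K)
        (Q₂ : Matrix (Fin n) (Fin k) K) (z : Fin n → K),
      1 ≤ r → (∀ i, z i ≠ 0) → (MatInt.Y₀ Q₁ Q₂ z).det ≠ 0 →
      (∀ t ≤ n,
        (MatInt.Z Q₁ Q₂ z (MatInt.algState r Q₁ Q₂ z t).J).det ≠ 0 ∧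
        (MatInt.Y Q₁ Q₂ z (MatInt.algState r Q₁ Q₂ z t).J).det ≠ 0 ∧
        (MatInt.algState r Q₁ Q₂ z t).W =
          MatInt.calY Q₁ Q₂ z (MatInt.algState r Q₁ Q₂ z t).J) ∧
      (∀ i : Fin n,
        (i ∈ (MatInt.algState r Q₁ Q₂ z (i + 1)).J ↔
          (MatInt.Z Q₁ Q₂ z (insert i (MatInt.algState r Q₁ Q₂ z i).J)).det ≠ 0) ∧
        ∀ p q : Fin n, (p : ℕ) / r = (i : ℕ) / r → (q : ℕ) / r = (i : ℕ) / r →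
          (MatInt.algState r Q₁ Q₂ z (i + 1)).D p q =
            (MatInt.Z Q₁ Q₂ z (MatInt.algState r Q₁ Q₂ z (i + 1)).J)⁻¹ (Sum.inr p) (Sum.inr q))) ∧
    -- running time with a given program for matrix multiplication
    (∀ (mm : MatInt.Prog) (ω C : ℝ), 2 ≤ ω →
      ∃ (p : MatInt.Prog) (c e : ℝ),
        (∀ (F K : Type*) [Field F] [Field K] [Algebra F K], MatInt.MultipliesMatrices mm K ω C →
          ∀ n r : ℕ, 1 ≤ r → r ≤ n →
            MatInt.SolvesMatroidIntersection p F K n r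
              (c * ((n : ℝ) * (r : ℝ) ^ (ω - 1) + (r : ℝ) ^ 3)) e) ∧
        (∀ a : ℝ, 0 < a → ∃ c' : ℝ,
          ∀ (F K : Type*) [Field F] [Field K] [Algebra F K], MatInt.MultipliesMatrices mm K ω C →
            ∀ n r : ℕ, 1 ≤ r → r ≤ n → a * (r : ℝ) ^ (4 - ω) ≤ (n : ℝ) →
              MatInt.SolvesMatroidIntersection p F K n r
                (c' * ((n : ℝ) * (r : ℝ) ^ (ω - 1))) e)) ∧
    -- running time with naive matrix multiplication
    (∃ (p : MatInt.Prog) (c e : ℝ),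
      ∀ (F K : Type*) [Field F] [Field K] [Algebra F K],
        ∀ n r : ℕ, 1 ≤ r → r ≤ n →
          MatInt.SolvesMatroidIntersection p F K n r (c * ((n : ℝ) * (r : ℝ) ^ 2)) e) := by
  refine ⟨fun K _ n k r Q₁ Q₂ z _ hz hdet => MatInt.scan_maintains hz hdet, fun mm ω C hω => ?_, ?_⟩
  · refine ⟨MatInt.intersection mm (max 3 mm.bound), 30000 + 8 * |C|, 2, ?_, fun a ha =>
      ⟨(30000 + 8 * |C|) * (1 + a⁻¹), ?_⟩⟩
    · intro F K _ _ _ hmm n r hr hrn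
      exact MatInt.solves_intersection hω hmm hr hrn le_rfl
    · intro F K _ _ _ hmm n r hr hrn h
      refine MatInt.solves_intersection hω hmm hr hrn ?_
      rw [mul_assoc]
      exact mul_le_mul_of_nonneg_left (MatInt.add_cube_le hr ha h) (by positivity)
  · refine ⟨MatInt.intersection MatInt.naiveMul (max 3 MatInt.naiveMul.bound),
      (30000 + 8 * |(1000 : ℝ)|) * 2, 2, fun F K _ _ _ n r hr hrn => ?_⟩
    refine MatInt.solves_intersection (by norm_num) (MatInt.multipliesMatrices_naiveMul K) hr hrn ?_
    have hsq : (r : ℝ) ^ ((3 : ℝ) - 1) = (r : ℝ) ^ 2 := by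
      rw [← Real.rpow_natCast]
      norm_num
    -- Because `r ≤ n`, the cubic term is at most `n * r ^ 2`; this is the factor `2` in the
    -- constant.
    have hcube : (r : ℝ) ^ 3 ≤ n * (r : ℝ) ^ 2 := by
      rw [pow_succ' _ 2]
      exact mul_le_mul_of_nonneg_right (by exact_mod_cast hrn) (by positivity)
    rw [hsq, mul_assoc]
    exact mul_le_mul_of_nonneg_left (by linarith) (by positivity)
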